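/- A \emph{segment} is an oriented interval $[x,x+\varepsilon]\subset\mathbb{C}$ with $x\in\mathbb{Z}+i\mathbb{Z}$ and $\varepsilon\in\{1,-1,i,-i\}$. A \emph{curve} associated to a sequence $(a_k)$ of signs $\pm1$ is a sequence of segments $C_k=[x_k,x_k+\varepsilon_k]$ (indexed by $\{1,\dots,n\}$, by $\mathbb{N}^*$ or by $\mathbb{Z}$; in the last case the curve is \emph{complete}) such that $x_{k+1}=x_k+\varepsilon_k$ and $\varepsilon_{k+1}=i^{a_k}\varepsilon_k$; at each vertex its corner is rounded off, so that it does not pass through the vertex. A \emph{covering} is a set of complete curves such that each nonoriented interval $[z,z+\varepsilon]$, $z\in\mathbb{Z}+i\mathbb{Z}$, $\varepsilon\in\{1,i\}$, is the support of exactly one segment of exactly one of the curves. All coverings are assumed to be coherently oriented: depending only on the parity of $x+y$, either all horizontal segments with endpoint $z=x+iy$ leave $z$ and all vertical ones arrive at $z$, or conversely. For a bounded set $\mathcal{B}$ of disjoint self-avoiding curves and a covering $\mathcal{C}$, write $\mathcal{B}<\mathcal{C}$ if each curve of $\mathcal{B}$ is contained in a curve of $\mathcal{C}$ and any two consecutive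 segments of a curve of $\mathcal{C}$ which both belong to curves of $\mathcal{B}$ are consecutive in one of them. Two coverings $\mathcal{C},\mathcal{D}$ are \emph{locally isomorphic} if, for each such $\mathcal{B}$, some translate $\mathcal{B}'$ of $\mathcal{B}$ satisfies $\mathcal{B}'<\mathcal{C}$ if and only if some translate $\mathcal{B}''$ of $\mathcal{B}$ satisfies $\mathcal{B}''<\mathcal{D}$. For a finite sequence $S=(a_1,\dots,a_m)$ of signs, put $\overline{S}=(-a_m,\dots,-a_1)$. The $0$-folding sequence is the empty one, and the $(n+1)$-folding sequences are the sequences $(\overline{S},\varepsilon,S)$ with $S$ an $n$-folding sequence and $\varepsilon=\pm1$. A sequence $(a_k)_{k\in\mathbb{N}^*}$ is an \emph{$\infty$-folding sequence} if $(a_1,\dots,a_{2^n-1})$ is an $n$-folding sequence for each $n$. The \emph{dragon curve} is a curve $H$ associated to the $\infty$-folding sequence $(a_k)_{k\in\mathbb{N}^*}$ with $a_{2^n}=+1$ for each $n\in\mathbb{N}$. A covering is \emph{generated} by $H$ if it consists of the complete curves obtained by connecting in pairs, at their common origin, the four curves deduced from $H$ by the rotations of angles $0,\pi/2,\pi,3\pi/2$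 around its origin (each connected pair being run backwards along one curve and then forwards along the other). \textbf{Example 8.} Let $\mathcal{C}$ be a covering generated by a dragon curve. Then: (1) $\mathcal{C}$ is locally isomorphic to a covering which consists of exactly $3$ curves, any two of which have a common vertex; (2) $\mathcal{C}$ is locally isomorphic to a covering which consists of exactly $3$ curves, two of which are separated by the third one: these two rounded curves are disjoint from the third rounded curve, and no connected component of its complement in the plane meets both of them. -/

import Mathlib

namespace Paperfolding

/-! ### Segments and curves on the Gaussian integers -/

/-- The number `i`, as a unit of the ring of Gaussian integers. -/
def iUnit : GaussianIntˣ where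
  val := ⟨0, 1⟩
  inv := ⟨0, -1⟩
  val_inv := by decide
  inv_val := by decide

/-- An oriented segment `[x, x + ε]` with `x ∈ ℤ + iℤ` and `ε ∈ {1, -1, i, -i}`
(these four numbers are the units of `ℤ[i]`). -/
@[ext]
structure Seg where
  start : GaussianInt
  dir : GaussianIntˣ

namespace Seg

/-- The terminal point `x + ε` of the segment `[x, x + ε]`. -/
def terminal (s : Seg) : GaussianInt := s.start + (s.dir : GaussianInt)

/-- The nonoriented interval which supports a segment, given by its two endpoints. -/
def support (s : Seg) : Sym2 GaussianInt := s(s.start, s.terminal)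

/-- The same interval with the opposite orientation. -/
def reverse (s : Seg) : Seg := ⟨s.terminal, -s.dir⟩

/-- The image of a segment under the translation by `u`. -/
def translate (u : GaussianInt) (s : Seg) : Seg := ⟨u + s.start, s.dir⟩

/-- The image of a segment under the rotation `z ↦ p + r (z - p)` about `p`, where
`r ∈ {1, i, -1, -i}`. -/
def rotate (p : GaussianInt) (r : GaussianIntˣ) (s : Seg) : Seg :=
  ⟨p + (r : GaussianInt) * (s.start - p), r * s.dir⟩

/-- `t` begins where `s` ends, and its direction is obtained from that of `s` by the turn
`i ^ a`, with `a = ±1`. -/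
def Turn (s t : Seg) (a : ℤˣ) : Prop :=
  t.start = s.terminal ∧ t.dir = iUnit ^ (a : ℤ) * s.dir

/-- `t` can follow `s` in a curve. -/
def Follows (s t : Seg) : Prop := ∃ a : ℤˣ, s.Turn t a

/-- The segment is horizontal, i.e. `ε = ±1`. -/
def Horizontal (s : Seg) : Prop := (s.dir : GaussianInt).im = 0

/-- The segment is vertical, i.e. `ε = ±i`. -/
def Vertical (s : Seg) : Prop := (s.dir : GaussianInt).re = 0

/-- The midpoint of a segment, as a point of the plane. -/
noncomputable def mid (s : Seg) : ℂ :=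
  GaussianInt.toComplex s.start + GaussianInt.toComplex (s.dir : GaussianInt) / 2

end Seg

/-- A finite curve: a nonempty finite sequence of segments, each of which follows the
previous one. -/
@[ext]
structure FiniteCurve where
  segs : List Seg
  ne_nil : segs ≠ []
  chain : segs.IsChain Seg.Follows

/-- A curve `(C_k)_{k ≥ 1}`; here `seg k` is `C_{k+1}`. -/
@[ext]
structure HalfCurve where
  seg : ℕ → Seg
  follows : ∀ k, (seg k).Follows (seg (k + 1))

/-- A complete curve `(C_k)_{k ∈ ℤ}`. -/
@[ext]
structure CompleteCurve where
  seg : ℤ → Seg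
  follows : ∀ k, (seg k).Follows (seg (k + 1))

theorem Seg.Follows.translate {s t : Seg} (u : GaussianInt) (h : s.Follows t) :
    (s.translate u).Follows (t.translate u) := by
  obtain ⟨a, h1, h2⟩ := h
  refine ⟨a, ?_, h2⟩
  simp only [Seg.translate, Seg.terminal] at h1 ⊢
  rw [h1, add_assoc]

theorem Seg.Follows.rotate {s t : Seg} (p : GaussianInt) (r : GaussianIntˣ)
    (h : s.Follows t) : (s.rotate p r).Follows (t.rotate p r) := by
  obtain ⟨a, h1, h2⟩ := h
  refine ⟨a, ?_, ?_⟩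
  · simp only [Seg.rotate, Seg.terminal, Units.val_mul] at h1 ⊢
    rw [h1]
    ring
  · simp only [Seg.rotate]
    rw [h2, mul_left_comm]

/-- The image of a finite curve under the translation by `u`. -/
def FiniteCurve.translate (u : GaussianInt) (β : FiniteCurve) : FiniteCurve where
  segs := β.segs.map (Seg.translate u)
  ne_nil := by simpa using β.ne_nil
  chain := by
    rw [List.isChain_map]
    exact β.chain.imp fun _ _ h => h.translate u

/-- The image of a curve `(C_k)_{k ≥ 1}` under the rotation with multiplier `r` about its
own origin. -/
def HalfCurve.rotate (r : GaussianIntˣ) (H : HalfCurve) : HalfCurve where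
  seg k := (H.seg k).rotate (H.seg 0).start r
  follows k := (H.follows k).rotate _ r

/-- The curve `(C_k)_{k ≥ 1}` is associated to the sequence `(a_k)_{k ≥ 1}`: the turn between
`C_k` and `C_{k+1}` is `a_k` (the value of `a` at `0` is not used). -/
def HalfCurve.AssociatedTo (H : HalfCurve) (a : ℕ → ℤˣ) : Prop :=
  ∀ k, (H.seg k).Turn (H.seg (k + 1)) (a (k + 1))

/-! ### Folding sequences -/

/-- The sequence `(-a_m, …, -a_1)`, denoted by `\bar S`, for `S = (a_1, …, a_m)`. It is the
sequence of turns of a curve read backwards. -/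
def bar (S : List ℤˣ) : List ℤˣ := (S.map fun a => -a).reverse

/-- The `n`-folding sequences. A strip of paper folded `n + 1` times is a strip folded once in
the middle, the two superposed halves of which are then folded `n` times; read from the
middle fold, the creases of one half are those of the other one, with opposite signs
when the strip is followed in one direction. -/
inductive IsFoldingSeq : ℕ → List ℤˣ → Prop
  | zero : IsFoldingSeq 0 []
  | succ (n : ℕ) (S : List ℤˣ) (ε : ℤˣ) (h : IsFoldingSeq n S) :
      IsFoldingSeq (n + 1) (bar S ++ ε :: S)

/-- `(a_k)_{k ≥ 1}` is an `∞`-folding sequence: each `(a_1, …, a_{2^n - 1})` is an `n`-folding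
sequence (the value of `a` at `0` is not used). -/
def IsInftyFoldingSeq (a : ℕ → ℤˣ) : Prop :=
  ∀ n : ℕ, IsFoldingSeq n (List.ofFn fun k : Fin (2 ^ n - 1) => a ((k : ℕ) + 1))

/-! ### Coverings -/

/-- A set of complete curves is a covering of the plane if each nonoriented interval
`[z, z + ε]` with `z ∈ ℤ + iℤ` and `ε ∈ {1, i}` is the support of exactly one segment of
exactly one of the curves. -/
def IsCovering (𝒞 : Set CompleteCurve) : Prop :=
  ∀ (z ε : GaussianInt), ε = 1 ∨ ε = (iUnit : GaussianInt) →
    ∃! c : CompleteCurve × ℤ, c.1 ∈ 𝒞 ∧ (c.1.seg c.2).support = s(z, z + ε)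

/-- The segments of curves of `𝒞` with endpoint `z` are among `[z, z + 1]`, `[z, z - 1]`,
`[z + i, z]`, `[z - i, z]`. -/
def HorizontalOut (𝒞 : Set CompleteCurve) (z : GaussianInt) : Prop :=
  ∀ γ ∈ 𝒞, ∀ k : ℤ, ((γ.seg k).start = z → (γ.seg k).Horizontal) ∧
    ((γ.seg k).terminal = z → (γ.seg k).Vertical)

/-- The segments of curves of `𝒞` with endpoint `z` are among `[z + 1, z]`, `[z - 1, z]`,
`[z, z + i]`, `[z, z - i]`. -/
def VerticalOut (𝒞 : Set CompleteCurve) (z : GaussianInt) : Prop :=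
  ∀ γ ∈ 𝒞, ∀ k : ℤ, ((γ.seg k).start = z → (γ.seg k).Vertical) ∧
    ((γ.seg k).terminal = z → (γ.seg k).Horizontal)

/-- The orientations of the curves of `𝒞` agree: which of the two possibilities above is
realized at `z = x + iy` depends only on the parity of `x + y`. -/
def IsCoherent (𝒞 : Set CompleteCurve) : Prop :=
  (∀ z : GaussianInt, (Even (z.re + z.im) → HorizontalOut 𝒞 z) ∧
      (Odd (z.re + z.im) → VerticalOut 𝒞 z)) ∨
    (∀ z : GaussianInt, (Even (z.re + z.im) → VerticalOut 𝒞 z) ∧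
      (Odd (z.re + z.im) → HorizontalOut 𝒞 z))

/-- `γ` is the complete curve obtained by connecting the curves `(G_k)_{k ≥ 1}` and
`(H_k)_{k ≥ 1}` at their common origin: it runs backwards along the first one, then
forwards along the second one. -/
def CompleteCurve.Connects (γ : CompleteCurve) (G H : HalfCurve) : Prop :=
  ∃ k : ℤ, ∀ n : ℕ, γ.seg (k + n) = H.seg n ∧ γ.seg (k - 1 - n) = (G.seg n).reverse

/-- `𝒞` consists of the complete curves which are formed by connecting the four curves obtained
from `H` by the rotations of angles `0`, `π/2`, `π`, `3π/2` around its origin: each curve of `𝒞`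
connects two of these four curves, and each of the four is used by a curve of `𝒞`. -/
def IsGeneratedBy (𝒞 : Set CompleteCurve) (H : HalfCurve) : Prop :=
  (∀ γ ∈ 𝒞, ∃ r s : GaussianIntˣ, γ.Connects (H.rotate r) (H.rotate s)) ∧
    ∀ r : GaussianIntˣ, ∃ γ ∈ 𝒞, ∃ s : GaussianIntˣ,
      γ.Connects (H.rotate r) (H.rotate s) ∨ γ.Connects (H.rotate s) (H.rotate r)

/-! ### Local isomorphism -/

/-- `β` is contained in the complete curve `γ`: it is a sequence of successive segments of it. -/
def FiniteCurve.ContainedIn (β : FiniteCurve) (γ : CompleteCurve) : Prop :=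
  ∃ k : ℤ, ∀ (j : ℕ) (hj : j < β.segs.length), β.segs[j] = γ.seg (k + j)

/-- A bounded set of disjoint self-avoiding curves. (The curves being rounded at the vertices,
two of them meet only if they have segments with the same support.) -/
def IsPattern (ℬ : Set FiniteCurve) : Prop :=
  ℬ.Finite ∧ (∀ β ∈ ℬ, (β.segs.map Seg.support).Nodup) ∧
    ℬ.Pairwise fun β β' => ∀ s ∈ β.segs, ∀ t ∈ β'.segs, s.support ≠ t.support

/-- The relation `ℬ < 𝒞` between a bounded set of curves and a set of complete curves: each
curve of `ℬ` is contained in a curve of `𝒞`, and any consecutive segments of a curve of `𝒞`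
which belong to curves of `ℬ` are consecutive in one of them. -/
def IsSubpattern (ℬ : Set FiniteCurve) (𝒞 : Set CompleteCurve) : Prop :=
  (∀ β ∈ ℬ, ∃ γ ∈ 𝒞, β.ContainedIn γ) ∧
    ∀ γ ∈ 𝒞, ∀ k : ℤ, (∃ β ∈ ℬ, γ.seg k ∈ β.segs) → (∃ β ∈ ℬ, γ.seg (k + 1) ∈ β.segs) →
      ∃ β ∈ ℬ, [γ.seg k, γ.seg (k + 1)] <:+: β.segs

/-- Some translate of the pattern `ℬ` occurs in `𝒞`. -/
def Occurs (ℬ : Set FiniteCurve) (𝒞 : Set CompleteCurve) : Prop :=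
  ∃ u : GaussianInt, IsSubpattern (FiniteCurve.translate u '' ℬ) 𝒞

/-- Two sets of complete curves are locally isomorphic if the same bounded sets of curves
occur in both of them, up to translation. -/
def LocallyIsomorphic (𝒞 𝒟 : Set CompleteCurve) : Prop :=
  ∀ ℬ : Set FiniteCurve, IsPattern ℬ → (Occurs ℬ 𝒞 ↔ Occurs ℬ 𝒟)

/-! ### Relative position of curves -/

/-- `z` is a vertex of `γ`, i.e. an endpoint of one of its segments. -/
def CompleteCurve.IsVertex (γ : CompleteCurve) (z : GaussianInt) : Prop :=
  ∃ k : ℤ, (γ.seg k).start = z ∨ (γ.seg k).terminal = z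

/-- The subset of the plane which is drawn by the rounded curve: at each vertex, the corner
is cut off from the midpoint of the incoming segment to the midpoint of the outgoing one, so
that the curve does not pass through the vertex. -/
noncomputable def CompleteCurve.trace (γ : CompleteCurve) : Set ℂ :=
  ⋃ k : ℤ, segment ℝ (γ.seg k).mid (γ.seg (k + 1)).mid

/-- The (rounded) curves `α` and `β` are separated by the (rounded) curve `μ`: both are
disjoint from `μ`, and no point of `α` is in the same connected component of the complement
of `μ` as a point of `β`. -/
def Separates (μ α β : CompleteCurve) : Prop :=
  Disjoint α.trace μ.trace ∧ Disjoint β.trace μ.trace ∧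
    ∀ z ∈ α.trace, ∀ w ∈ β.trace, w ∉ connectedComponentIn (μ.trace)ᶜ z

end Paperfolding

open Paperfolding

/-! ### The turn function on the Gaussian integers -/

namespace Paperfolding

/-! Put the dragon curve at the origin with first direction `1`. Its turn at a vertex `w = (1 + i) ^
n * u`, `u` odd, depends only on `w`: it is `1` if `u` is congruent to `1` modulo `2`, and `-1` if
`u` is congruent to `i` (`turnAt`, `dragon_position`). Up to rotation and translation, a generated
covering follows this rule at every vertex except the origin, where the turn is arbitrary
(`IsGeneratedBy.exists_obeys`).

Away from `0`, `turnAt` is locally constant in the `(1 + i)`-adic topology, and it does not change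
when the argument is multiplied by `q = 1 + 2 * k`. So the turns `z ↦ turnAt (ρ * q * z + b)` amount
to a translation by the `(1 + i)`-adic number `b / (ρ * q)`. If `q` does not divide `b`, the
singular point `0` is never met, and the corresponding covering is locally isomorphic to the given
one (`locallyIsomorphic_of_obeys`).

Its curves are counted inside a single system, formed by segments of step `q` with turns `turnAt`
(`embed`, `succ`). There, consecutive segments are grouped in pairs, each pair spanning `1 + i`
times a segment called their `parent`. Two segments lie on the same curve if and only if their
parents do, and taking parents contracts the starting points towards `0`. The curves are therefore
represented by the finitely many segments which are periodic under `parent` (`onCurve_of_base`,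
`ParentStable.pow_ne`). For `q = 1 - 2 * i` and for `q = 3`, three of them start in the chosen
residue class `b` modulo `q`; finite computations establish this.

For `q = 1 - 2 * i`, common vertices are found directly. For `q = 3`, let the periodic segments be
split into `A`, `M`, `B`. A corner property, checked near `0` and propagated by `parent`
(`corner_invariant`), says that membership in `B` is constant around each face bounded
counterclockwise, and membership in `A` around each face bounded clockwise. This gives a
two-colouring of diamond tiles centred at vertices and faces, whose colour changes only across the
middle curve; a connectedness argument then gives the separation (`IsLabelling.separates`). -/

theorem iUnit_val : (iUnit : GaussianInt) = ⟨0, 1⟩ := rfl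

theorem iUnit_inv : iUnit⁻¹ = -iUnit := by
  ext <;> simp [iUnit_val] <;> rfl

theorem iUnit_zpow_one : iUnit ^ ((1 : ℤˣ) : ℤ) = iUnit := by simp

theorem iUnit_zpow_neg_one : iUnit ^ ((-1 : ℤˣ) : ℤ) = -iUnit := by
  simp [iUnit_inv]

theorem unit_cases (d : GaussianIntˣ) : d = 1 ∨ d = -1 ∨ d = iUnit ∨ d = -iUnit := by
  have h : (d : GaussianInt).norm = 1 :=
    (Zsqrtd.norm_eq_one_iff' (by norm_num) _).2 d.isUnit
  rw [Zsqrtd.norm_def] at h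
  have h1 : -1 ≤ (d : GaussianInt).re ∧ (d : GaussianInt).re ≤ 1 := by
    constructor <;> nlinarith [sq_nonneg (d : GaussianInt).im]
  have h2 : -1 ≤ (d : GaussianInt).im ∧ (d : GaussianInt).im ≤ 1 := by
    constructor <;> nlinarith [sq_nonneg (d : GaussianInt).re]
  obtain ⟨h1, h1'⟩ := h1
  obtain ⟨h2, h2'⟩ := h2
  simp only [Units.ext_iff, Zsqrtd.ext_iff]
  simp only [iUnit_val, Units.val_one, Units.val_neg, Zsqrtd.re_one, Zsqrtd.im_one, Zsqrtd.re_neg,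
    Zsqrtd.im_neg]
  generalize (d : GaussianInt).re = x at *
  generalize (d : GaussianInt).im = y at *
  interval_cases x <;> interval_cases y <;> simp_all

/-- `w` is divisible by `1 + i`. -/
def IsEv (w : GaussianInt) : Prop := (w.re + w.im) % 2 = 0

instance (w : GaussianInt) : Decidable (IsEv w) := inferInstanceAs (Decidable (_ = _))

/-- The quotient of `w` by `1 + i` (for `w` even). -/
def half (w : GaussianInt) : GaussianInt := ⟨(w.re + w.im) / 2, (w.im - w.re) / 2⟩

/-- The Gaussian integer `1 + i`. -/
def opi : GaussianInt := ⟨1, 1⟩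

theorem opi_mul_half {w : GaussianInt} (h : IsEv w) : opi * half w = w := by
  unfold IsEv at h
  ext <;> simp [opi, half] <;> omega

theorem half_opi_mul (w : GaussianInt) : half (opi * w) = w := by
  ext <;> simp [opi, half] <;> omega

theorem isEv_opi_mul (w : GaussianInt) : IsEv (opi * w) := by
  simp [IsEv, opi]; omega

theorem norm_opi_mul (w : GaussianInt) : (opi * w).norm = 2 * w.norm := by
  rw [Zsqrtd.norm_mul]; rfl

/-- The turns of the dragon curve as a function of the position, with fuel. -/
def turnAux : ℕ → GaussianInt → ℤˣ
  | 0, _ => 1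
  | n + 1, w => if IsEv w then turnAux n (half w) else if w.re % 2 = 0 then -1 else 1

/-- For `w = (1 + i) ^ n * u` with `u` odd, it is `1` if `u ≡ 1` modulo `2` and `-1` if
`u ≡ i` modulo `2`. -/
def turnAt (w : GaussianInt) : ℤˣ := turnAux w.norm.natAbs w

theorem turnAux_zero (n : ℕ) : turnAux n 0 = 1 := by
  induction n with
  | zero => rfl
  | succ n ih =>
    have : half 0 = 0 := by ext <;> simp [half]
    simp [turnAux, IsEv, this, ih]

theorem norm_natAbs_half {w : GaussianInt} (h : IsEv w) :
    w.norm.natAbs = 2 * (half w).norm.natAbs := by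
  conv_lhs => rw [← opi_mul_half h, norm_opi_mul, Int.natAbs_mul]
  rfl

/-- Each division by `1 + i` halves the norm, so fuel equal to the norm suffices. At `0`, where the
division never stops, the value is `1` for any fuel. -/
theorem turnAux_eq (n : ℕ) : ∀ w : GaussianInt, w.norm.natAbs ≤ n → turnAux n w = turnAt w := by
  induction n using Nat.strong_induction_on with
  | _ n ih =>
    intro w hw
    by_cases h0 : w = 0
    · subst h0; simp [turnAt, turnAux_zero]
    have hpos : 0 < w.norm.natAbs := by
      rw [Int.natAbs_pos, Ne, Zsqrtd.norm_eq_zero_iff (by norm_num)]; exact h0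
    unfold turnAt
    obtain ⟨m, hm⟩ : ∃ m, w.norm.natAbs = m + 1 := ⟨w.norm.natAbs - 1, by omega⟩
    obtain ⟨k, rfl⟩ : ∃ k, n = k + 1 := ⟨n - 1, by omega⟩
    rw [hm]
    simp only [turnAux]
    split_ifs with he
    · have := norm_natAbs_half he
      rw [ih k (by omega) _ (by omega)]
      by_cases hmk : m + 1 = k + 1
      · obtain rfl : m = k := by omega
        rw [ih m (by omega) _ (by omega)]
      · rw [ih m (by omega) _ (by omega)]
    · rfl
    · rfl

theorem turnAt_opi_mul (w : GaussianInt) : turnAt (opi * w) = turnAt w := by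
  have h := isEv_opi_mul w
  rw [← turnAux_eq ((opi * w).norm.natAbs + 1) _ (Nat.le_succ _)]
  simp only [turnAux, if_pos h, half_opi_mul]
  apply turnAux_eq
  have := norm_natAbs_half h
  rw [half_opi_mul] at this
  omega

theorem turnAt_of_odd {w : GaussianInt} (h : ¬ IsEv w) :
    turnAt w = if w.re % 2 = 0 then -1 else 1 := by
  rw [← turnAux_eq (w.norm.natAbs + 1) _ (Nat.le_succ _)]
  simp only [turnAux, if_neg h]

theorem odd_ne_zero {w : GaussianInt} (h : ¬ IsEv w) : w ≠ 0 := by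
  rintro rfl; exact h rfl

/-- Induction on the valuation at `1 + i`. -/
theorem opi_induction {C : GaussianInt → Prop} (odd : ∀ w, ¬ IsEv w → C w)
    (even : ∀ w, w ≠ 0 → C w → C (opi * w)) (w : GaussianInt) (hw : w ≠ 0) : C w := by
  induction hn : w.norm.natAbs using Nat.strong_induction_on generalizing w with
  | _ n ih =>
    by_cases he : IsEv w
    · have h1 := norm_natAbs_half he
      have h2 : half w ≠ 0 := by
        intro h; apply hw; rw [← opi_mul_half he, h, mul_zero]
      have hpos : 0 < w.norm.natAbs := by
        rw [Int.natAbs_pos, Ne, Zsqrtd.norm_eq_zero_iff (by norm_num)]; exact hw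
      have := even _ h2 (ih _ (by omega) (half w) h2 rfl)
      rwa [opi_mul_half he] at this
    · exact odd w he

theorem two_eq : (2 : GaussianInt) = opi * (opi * ⟨0, -1⟩) := by decide

theorem opi_dvd_iff {w : GaussianInt} : opi ∣ w ↔ IsEv w :=
  ⟨by rintro ⟨v, rfl⟩; exact isEv_opi_mul v, fun h => ⟨half w, (opi_mul_half h).symm⟩⟩

/-- Local constancy of the turn in the `(1 + i)`-adic topology, away from `0`: the turn is read
modulo `2` once the factors `1 + i` are removed. -/
theorem turnAt_add (w : GaussianInt) (hw : w ≠ 0) :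
    ∃ N : ℕ, ∀ h : GaussianInt, opi ^ N ∣ h → w + h ≠ 0 ∧ turnAt (w + h) = turnAt w := by
  refine opi_induction (C := fun w => ∃ N : ℕ, ∀ h : GaussianInt, opi ^ N ∣ h →
    w + h ≠ 0 ∧ turnAt (w + h) = turnAt w) ?_ ?_ w hw
  · intro w hw
    -- `(1 + i) ^ 2` is associated to `2`, so the residue modulo `2` is unchanged.
    refine ⟨2, ?_⟩
    rintro _ ⟨v, rfl⟩
    have h1 : ¬ IsEv (w + opi ^ 2 * v) := by
      simp [IsEv, opi, pow_two] at hw ⊢; omega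
    refine ⟨odd_ne_zero h1, ?_⟩
    rw [turnAt_of_odd hw, turnAt_of_odd h1]
    have : (w + opi ^ 2 * v).re % 2 = w.re % 2 := by
      simp [opi, pow_two]
    rw [this]
  · rintro w hw ⟨N, hN⟩
    refine ⟨N + 1, ?_⟩
    rintro _ ⟨v, rfl⟩
    obtain ⟨h1, h2⟩ := hN (opi ^ N * v) (dvd_mul_right _ _)
    have : opi * w + opi ^ (N + 1) * v = opi * (w + opi ^ N * v) := by ring
    rw [this, turnAt_opi_mul, turnAt_opi_mul]
    exact ⟨mul_ne_zero (by decide) h1, h2⟩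

/-- The factor `1 + 2 * k` keeps the valuation and the residue modulo `2` of the odd part. Thanks to
this, rescaling by `q` is invisible to finite patterns. -/
theorem turnAt_mul (k w : GaussianInt) : turnAt ((1 + 2 * k) * w) = turnAt w := by
  by_cases hw : w = 0
  · simp [hw]
  refine opi_induction (C := fun w => turnAt ((1 + 2 * k) * w) = turnAt w) ?_ ?_ w hw
  · intro w hw
    have h1 : ¬ IsEv ((1 + 2 * k) * w) := by
      simp [IsEv] at hw ⊢
      ring_nf
      omega
    rw [turnAt_of_odd hw, turnAt_of_odd h1]
    have : ((1 + 2 * k) * w).re % 2 = w.re % 2 := by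
      simp; ring_nf; omega
    rw [this]
  · intro w _ ih
    rw [mul_left_comm, turnAt_opi_mul, turnAt_opi_mul, ih]

theorem turnAt_neg (w : GaussianInt) : turnAt (-w) = turnAt w := by
  have := turnAt_mul (-1) w
  rwa [show (1 + 2 * (-1) : GaussianInt) = -1 by norm_num, neg_one_mul] at this

/-- Multiplication by `i` exchanges the two odd residues `1` and `i` modulo `2`. -/
theorem turnAt_i_mul (w : GaussianInt) (hw : w ≠ 0) :
    turnAt ((iUnit : GaussianInt) * w) = -turnAt w := by
  refine opi_induction (C := fun w => turnAt ((iUnit : GaussianInt) * w) = -turnAt w) ?_ ?_ w hw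
  · intro w hw
    have h1 : ¬ IsEv ((iUnit : GaussianInt) * w) := by
      simp [IsEv, iUnit_val] at hw ⊢
      omega
    rw [turnAt_of_odd hw, turnAt_of_odd h1]
    simp [IsEv, iUnit_val] at hw ⊢
    split_ifs <;> first | rfl | omega
  · intro w _ ih
    rw [mul_left_comm, turnAt_opi_mul, turnAt_opi_mul, ih]

theorem isCoprime_opi_pow (k : GaussianInt) (N : ℕ) : IsCoprime (1 + 2 * k) (opi ^ N) := by
  apply IsCoprime.pow_right
  refine ⟨1, -(opi * ⟨0, -1⟩ * k), ?_⟩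
  rw [two_eq]; ring

/-- Congruences modulo powers of `1 + i` can be divided by units and odd numbers. -/
theorem exists_congr (k : GaussianInt) (ρ : GaussianIntˣ) (N : ℕ) (c : GaussianInt) :
    ∃ y : GaussianInt, opi ^ N ∣ (ρ : GaussianInt) * (1 + 2 * k) * y - c := by
  obtain ⟨a, b, h⟩ := isCoprime_opi_pow k N
  refine ⟨((ρ⁻¹ : GaussianIntˣ) : GaussianInt) * a * c, -b * c, ?_⟩
  have : (ρ : GaussianInt) * (1 + 2 * k) * (((ρ⁻¹ : GaussianIntˣ) : GaussianInt) * a * c) - c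
    = ((ρ : GaussianInt) * ((ρ⁻¹ : GaussianIntˣ) : GaussianInt)) * (a * (1 + 2 * k)) * c - c := by
    ring
  rw [this, Units.mul_inv, one_mul]
  linear_combination c * h
end Paperfolding

/-! ### Coherent segments and coverings which obey a turn function -/

namespace Paperfolding

/-- Go straight ahead by `m` times the direction, then turn according to `t`. For `m = 1`, this
maps a segment to the following one. -/
def adv (m : GaussianInt) (t : GaussianInt → ℤˣ) : Equiv.Perm Seg where
  toFun s := ⟨s.start + m * s.dir, iUnit ^ (t (s.start + m * s.dir) : ℤ) * s.dir⟩
  invFun s := ⟨s.start - m * ((iUnit ^ (t s.start : ℤ))⁻¹ * s.dir : GaussianIntˣ),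
    (iUnit ^ (t s.start : ℤ))⁻¹ * s.dir⟩
  left_inv s := by ext1 <;> simp
  right_inv s := by ext1 <;> simp

theorem adv_start (m : GaussianInt) (t : GaussianInt → ℤˣ) (s : Seg) :
    (adv m t s).start = s.start + m * s.dir := rfl

theorem adv_dir (m : GaussianInt) (t : GaussianInt → ℤˣ) (s : Seg) :
    (adv m t s).dir = iUnit ^ (t (s.start + m * s.dir) : ℤ) * s.dir := rfl

theorem adv_one_start (t : GaussianInt → ℤˣ) (s : Seg) : (adv 1 t s).start = s.terminal := by
  simp [adv_start, Seg.terminal]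

theorem adv_one_dir (t : GaussianInt → ℤˣ) (s : Seg) :
    (adv 1 t s).dir = iUnit ^ (t s.terminal : ℤ) * s.dir := by
  simp [adv_dir, Seg.terminal]

theorem turn_iff_adv (t : GaussianInt → ℤˣ) (s s' : Seg) :
    s.Turn s' (t s.terminal) ↔ s' = adv 1 t s := by
  rw [Seg.Turn, Seg.ext_iff, adv_one_start, adv_one_dir]

/-- Segments which have the same orientation as the horizontal segments starting from `0`
(if `κ` is even) or the vertical ones (if `κ` is odd) in a coherent covering. -/
def Coh (κ : ℤ) (s : Seg) : Prop :=
  (s.start.re + s.start.im + κ) % 2 = 0 ↔ (s.dir : GaussianInt).im = 0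

theorem unit_val_cases (d : GaussianIntˣ) : (d : GaussianInt) = ⟨1, 0⟩ ∨
    (d : GaussianInt) = ⟨-1, 0⟩ ∨ (d : GaussianInt) = ⟨0, 1⟩ ∨ (d : GaussianInt) = ⟨0, -1⟩ := by
  rcases unit_cases d with rfl | rfl | rfl | rfl
  · exact Or.inl rfl
  · exact Or.inr (Or.inl rfl)
  · exact Or.inr (Or.inr (Or.inl rfl))
  · exact Or.inr (Or.inr (Or.inr rfl))

theorem coh_reverse (κ : ℤ) (s : Seg) : Coh κ s.reverse ↔ ¬ Coh κ s := by
  unfold Coh Seg.reverse Seg.terminal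
  rcases unit_val_cases s.dir with h | h | h | h <;> simp [h] <;> omega

theorem iUnit_zpow_cases (a : ℤˣ) :
    iUnit ^ (a : ℤ) = iUnit ∨ iUnit ^ (a : ℤ) = -iUnit := by
  rcases Int.units_eq_one_or a with rfl | rfl
  · exact Or.inl iUnit_zpow_one
  · exact Or.inr iUnit_zpow_neg_one

theorem coh_adv (κ : ℤ) (k : GaussianInt) (t : GaussianInt → ℤˣ) (s : Seg) :
    Coh κ (adv (1 + 2 * k) t s) ↔ Coh κ s := by
  unfold Coh
  rw [adv_start, adv_dir]
  rcases iUnit_zpow_cases (t (s.start + (1 + 2 * k) * s.dir)) with h' | h' <;> rw [h'] <;>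
  rcases unit_val_cases s.dir with h | h | h | h <;> simp [h, iUnit_val] <;> omega

theorem coh_adv_one (κ : ℤ) (t : GaussianInt → ℤˣ) (s : Seg) :
    Coh κ (adv 1 t s) ↔ Coh κ s := by
  have := coh_adv κ 0 t s
  simpa using this

theorem coh_adv_zpow (κ : ℤ) (k : GaussianInt) (t : GaussianInt → ℤˣ) (s : Seg) (n : ℤ) :
    Coh κ ((adv (1 + 2 * k) t ^ n) s) ↔ Coh κ s := by
  induction n using Int.induction_on with
  | zero => simp
  | succ n ih => rw [add_comm (n : ℤ), zpow_one_add, Equiv.Perm.mul_apply, coh_adv, ih]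
  | pred n ih =>
    rw [← ih, ← coh_adv κ k t, ← Equiv.Perm.mul_apply, ← zpow_one_add]
    simp

theorem support_reverse (s : Seg) : s.reverse.support = s.support := by
  simp [Seg.support, Seg.reverse, Seg.terminal, Sym2.eq_swap]

theorem support_eq_iff (s s' : Seg) : s.support = s'.support ↔ s = s' ∨ s = s'.reverse := by
  constructor
  · intro h
    simp only [Seg.support, Sym2.eq_iff] at h
    rcases h with ⟨h1, h2⟩ | ⟨h1, h2⟩
    · left
      ext1
      · exact h1
      · ext1
        simpa [Seg.terminal, h1] using h2
    · right
      ext1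
      · exact h1
      · ext1
        simp only [Seg.terminal, Seg.reverse, Units.val_neg] at h1 h2 ⊢
        linear_combination h2 - h1
  · rintro (rfl | rfl)
    · rfl
    · exact support_reverse _

/-- Exactly one of the two orientations of an interval is coherent, so coherent segments can stand
for nonoriented intervals. -/
theorem Coh.eq_of_support {κ : ℤ} {s s' : Seg} (h : Coh κ s) (h' : Coh κ s')
    (e : s.support = s'.support) : s = s' := by
  rcases (support_eq_iff _ _).1 e with rfl | rfl
  · rfl
  · exact absurd h ((coh_reverse _ _).not.2 (not_not.2 h'))

theorem exists_support_eq (s : Seg) : ∃ z ε : GaussianInt, (ε = 1 ∨ ε = (iUnit : GaussianInt)) ∧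
    s.support = s(z, z + ε) := by
  rcases unit_cases s.dir with h | h | h | h
  · exact ⟨s.start, 1, Or.inl rfl, by simp [Seg.support, Seg.terminal, h]⟩
  · exact ⟨s.terminal, 1, Or.inl rfl, by simp [Seg.support, Seg.terminal, h, Sym2.eq_swap]⟩
  · exact ⟨s.start, iUnit, Or.inr rfl, by simp [Seg.support, Seg.terminal, h]⟩
  · exact ⟨s.terminal, iUnit, Or.inr rfl, by simp [Seg.support, Seg.terminal, h, Sym2.eq_swap]⟩

theorem exists_coh_support (κ : ℤ) (z : GaussianInt) (ε : GaussianIntˣ) :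
    ∃ s : Seg, Coh κ s ∧ s.support = s(z, z + ε) := by
  by_cases h : Coh κ ⟨z, ε⟩
  · exact ⟨_, h, rfl⟩
  · exact ⟨_, (coh_reverse κ ⟨z, ε⟩).2 h, support_reverse _⟩

/-- The curves of `𝒞` consist of coherent segments, and turn as indicated by `t`. -/
def Obeys (𝒞 : Set CompleteCurve) (t : GaussianInt → ℤˣ) (κ : ℤ) : Prop :=
  ∀ γ ∈ 𝒞, ∀ k : ℤ, Coh κ (γ.seg k) ∧ γ.seg (k + 1) = adv 1 t (γ.seg k)

theorem IsCovering.exists_seg_support {𝒞 : Set CompleteCurve} (h : IsCovering 𝒞) (s : Seg) :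
    ∃ γ ∈ 𝒞, ∃ k : ℤ, (γ.seg k).support = s.support := by
  obtain ⟨z, ε, hε, hs⟩ := exists_support_eq s
  obtain ⟨⟨γ, k⟩, ⟨h1, h2⟩, -⟩ := h z ε hε
  exact ⟨γ, h1, k, by rw [hs]; exact h2⟩

theorem IsCovering.unique {𝒞 : Set CompleteCurve} (h : IsCovering 𝒞) {γ γ' : CompleteCurve}
    (hγ : γ ∈ 𝒞) (hγ' : γ' ∈ 𝒞) {k k' : ℤ} (e : (γ.seg k).support = (γ'.seg k').support) :
    γ = γ' ∧ k = k' := by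
  obtain ⟨z, ε, hε, hs⟩ := exists_support_eq (γ.seg k)
  have := (h z ε hε).unique (y₁ := (γ, k)) (y₂ := (γ', k')) ⟨hγ, hs⟩ ⟨hγ', by rw [← e]; exact hs⟩
  simpa using this

theorem Obeys.exists_seg {𝒞 : Set CompleteCurve} {t : GaussianInt → ℤˣ} {κ : ℤ}
    (h : Obeys 𝒞 t κ) (hc : IsCovering 𝒞) {s : Seg} (hs : Coh κ s) :
    ∃ γ ∈ 𝒞, ∃ k : ℤ, γ.seg k = s := by
  obtain ⟨γ, hγ, k, hk⟩ := hc.exists_seg_support s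
  exact ⟨γ, hγ, k, (h γ hγ k).1.eq_of_support hs hk⟩

/-! ### Occurrence of patterns when finite windows of turns agree -/

theorem translate_injective (u : GaussianInt) : Function.Injective (Seg.translate u) := by
  intro s s' h
  simp only [Seg.translate, Seg.mk.injEq, add_right_inj] at h
  exact Seg.ext h.1 h.2

theorem translate_adv {t t' : GaussianInt → ℤˣ} {u : GaussianInt} {s : Seg}
    (h : t' (u + s.terminal) = t s.terminal) :
    (adv 1 t s).translate u = adv 1 t' (s.translate u) := by
  ext1
  · simp [Seg.translate, adv_one_start, Seg.terminal, add_assoc]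
  · have : (s.translate u).terminal = u + s.terminal := by
      simp [Seg.translate, Seg.terminal, add_assoc]
    rw [adv_one_dir, this, h]
    exact adv_one_dir t s

theorem FiniteCurve.translate_translate (u v : GaussianInt) (β : FiniteCurve) :
    (β.translate v).translate u = β.translate (u + v) := by
  ext1
  simp [FiniteCurve.translate, Function.comp_def, Seg.translate, add_assoc]

/-- A finite pattern involves only the turns at the ends of its segments. If a translation preserves
coherence and carries these turns to those of `𝒟`, then both the curves of the pattern and the
consecutiveness condition are carried along. -/
theorem isSubpattern_translate {ℬ : Set FiniteCurve} (hfin : ℬ.Finite)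
    {𝒞 𝒟 : Set CompleteCurve} {t t' : GaussianInt → ℤˣ} {κ κ' : ℤ}
    (h𝒟 : IsCovering 𝒟) (ht : Obeys 𝒞 t κ) (ht' : Obeys 𝒟 t' κ')
    (H : ∀ W : Set GaussianInt, W.Finite → ∃ u : GaussianInt,
      (∀ s : Seg, Coh κ' (s.translate u) ↔ Coh κ s) ∧ ∀ z ∈ W, t' (u + z) = t z)
    (hs : IsSubpattern ℬ 𝒞) : ∃ u, IsSubpattern (FiniteCurve.translate u '' ℬ) 𝒟 := by
  obtain ⟨u, hu1, hu2⟩ := H (⋃ β ∈ ℬ, {z | z ∈ β.segs.map Seg.terminal})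
    (hfin.biUnion fun β _ => List.finite_toSet _)
  have hmem : ∀ β ∈ ℬ, ∀ s ∈ β.segs, t' (u + s.terminal) = t s.terminal := by
    intro β hβ s hs
    apply hu2
    simp only [Set.mem_iUnion]
    exact ⟨β, hβ, List.mem_map_of_mem hs⟩
  have hin : ∀ β ∈ ℬ, ∀ s ∈ β.segs, ∃ γ ∈ 𝒞, ∃ k : ℤ, γ.seg k = s := by
    intro β hβ s hsβ
    obtain ⟨γ, hγ, k, hk⟩ := hs.1 β hβ
    obtain ⟨j, hj, rfl⟩ := List.getElem_of_mem hsβ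
    exact ⟨γ, hγ, _, (hk j hj).symm⟩
  refine ⟨u, ?_, ?_⟩
  · rintro _ ⟨β, hβ, rfl⟩
    obtain ⟨γ, hγ, k, hk⟩ := hs.1 β hβ
    have h0 : 0 < β.segs.length := List.length_pos_iff.2 β.ne_nil
    have hc0 : Coh κ' ((β.segs[0]).translate u) := by
      rw [hu1, hk 0 h0]; exact (ht γ hγ _).1
    obtain ⟨γ', hγ', k', hk'⟩ := ht'.exists_seg h𝒟 hc0
    refine ⟨γ', hγ', k', ?_⟩
    have key : ∀ (j : ℕ) (hj : j < β.segs.length), (β.segs[j]).translate u = γ'.seg (k' + j) := by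
      intro j
      induction j with
      | zero => intro _; simp [hk']
      | succ j ih =>
        intro hj
        have hj' : j < β.segs.length := by omega
        have e : β.segs[j + 1] = adv 1 t (β.segs[j]) := by
          rw [hk _ hj, hk _ hj', ← (ht γ hγ _).2]; push_cast; ring_nf
        rw [e, translate_adv (hmem β hβ _ (List.getElem_mem hj')), ih hj', ← (ht' γ' hγ' _).2]
        push_cast; ring_nf
    intro j hj
    simp only [FiniteCurve.translate, List.getElem_map]
    exact key j (by simpa [FiniteCurve.translate] using hj)
  · rintro γ hγ k ⟨_, ⟨β, hβ, rfl⟩, hsβ⟩ ⟨_, ⟨β', hβ', rfl⟩, hsβ'⟩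
    simp only [FiniteCurve.translate, List.mem_map] at hsβ hsβ'
    obtain ⟨s, hs1, hs2⟩ := hsβ
    obtain ⟨s', hs1', hs2'⟩ := hsβ'
    obtain ⟨γ₁, hγ₁, k₁, rfl⟩ := hin β hβ s hs1
    have e : s' = γ₁.seg (k₁ + 1) := by
      apply translate_injective u
      rw [hs2', (ht' γ hγ k).2, (ht γ₁ hγ₁ k₁).2, translate_adv (hmem β hβ _ hs1), hs2]
    subst e
    obtain ⟨β₂, hβ₂, hinf⟩ := hs.2 γ₁ hγ₁ k₁ ⟨β, hβ, hs1⟩ ⟨β', hβ', hs1'⟩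
    refine ⟨_, ⟨β₂, hβ₂, rfl⟩, ?_⟩
    rw [← hs2, ← hs2']
    exact hinf.map (Seg.translate u)

theorem Occurs.of_windows {ℬ : Set FiniteCurve} (hfin : ℬ.Finite)
    {𝒞 𝒟 : Set CompleteCurve} {t t' : GaussianInt → ℤˣ} {κ κ' : ℤ}
    (h𝒟 : IsCovering 𝒟) (ht : Obeys 𝒞 t κ) (ht' : Obeys 𝒟 t' κ')
    (H : ∀ W : Set GaussianInt, W.Finite → ∃ u : GaussianInt,
      (∀ s : Seg, Coh κ' (s.translate u) ↔ Coh κ s) ∧ ∀ z ∈ W, t' (u + z) = t z)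
    (h : Occurs ℬ 𝒞) : Occurs ℬ 𝒟 := by
  obtain ⟨v, hv⟩ := h
  obtain ⟨u, hu⟩ := isSubpattern_translate (hfin.image _) h𝒟 ht ht' H hv
  refine ⟨u + v, ?_⟩
  rw [Set.image_image] at hu
  simpa only [FiniteCurve.translate_translate] using hu

/-! ### Coverings built from transversals -/

/-- The complete curve through `s` whose turns are given by `t`. -/
def curveOf (t : GaussianInt → ℤˣ) (s : Seg) : CompleteCurve where
  seg k := (adv 1 t ^ k) s
  follows k := ⟨t ((adv 1 t ^ k) s).terminal, by
    rw [turn_iff_adv, add_comm, zpow_one_add, Equiv.Perm.mul_apply]⟩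

theorem curveOf_seg_succ (t : GaussianInt → ℤˣ) (s : Seg) (k : ℤ) :
    (curveOf t s).seg (k + 1) = adv 1 t ((curveOf t s).seg k) := by
  simp only [curveOf]
  rw [add_comm, zpow_one_add, Equiv.Perm.mul_apply]

theorem curveOf_injective (t : GaussianInt → ℤˣ) : Function.Injective (curveOf t) := by
  intro s s' h
  have : (curveOf t s).seg 0 = (curveOf t s').seg 0 := by rw [h]
  simpa [curveOf] using this

/-- `R` contains exactly one segment of each curve with turns `t`, and these curves
do not close up. -/
structure IsTransversal (t : GaussianInt → ℤˣ) (κ : ℤ) (R : Set Seg) : Prop where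
  coh : ∀ r ∈ R, Coh κ r
  exists_sameCycle : ∀ s, Coh κ s → ∃ r ∈ R, (adv 1 t).SameCycle r s
  eq_of_zpow : ∀ r ∈ R, ∀ r' ∈ R, ∀ n : ℤ, (adv 1 t ^ n) r = r' → n = 0

variable {t : GaussianInt → ℤˣ} {κ : ℤ} {R : Set Seg}

theorem IsTransversal.coh_seg (hR : IsTransversal t κ R) {r : Seg} (hr : r ∈ R) (k : ℤ) :
    Coh κ ((curveOf t r).seg k) := by
  have := coh_adv_zpow κ 0 t r k
  simp only [mul_zero, add_zero] at this
  exact this.2 (hR.coh r hr)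

theorem IsTransversal.obeys (hR : IsTransversal t κ R) : Obeys (curveOf t '' R) t κ := by
  rintro _ ⟨r, hr, rfl⟩ k
  exact ⟨hR.coh_seg hr k, curveOf_seg_succ t r k⟩

/-- The coherent segment on a given interval is reached from one element of the transversal, after
one number of steps. `eq_of_zpow` gives the uniqueness of both, since it excludes distinct
representatives of one curve as well as closed curves. -/
theorem IsTransversal.isCovering (hR : IsTransversal t κ R) : IsCovering (curveOf t '' R) := by
  intro z ε hε
  obtain ⟨ε, rfl⟩ : ∃ e : GaussianIntˣ, (e : GaussianInt) = ε := by
    rcases hε with rfl | rfl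
    · exact ⟨1, rfl⟩
    · exact ⟨iUnit, rfl⟩
  obtain ⟨s, hs, hs'⟩ := exists_coh_support κ z ε
  obtain ⟨r, hr, n, hn⟩ := hR.exists_sameCycle s hs
  refine ⟨(curveOf t r, n), ⟨⟨r, hr, rfl⟩, ?_⟩, ?_⟩
  · rw [← hs', ← hn]; rfl
  · rintro ⟨_, k⟩ ⟨⟨r', hr', rfl⟩, hk⟩
    have e : (adv 1 t ^ k) r' = s :=
      (hR.coh_seg hr' k).eq_of_support hs (by rw [hs']; exact hk)
    have e2 : (adv 1 t ^ (k - n)) r' = r := by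
      rw [sub_eq_neg_add, zpow_add, Equiv.Perm.mul_apply, e, ← hn, ← Equiv.Perm.mul_apply,
        ← zpow_add]
      simp
    have h0 := hR.eq_of_zpow r' hr' r hr _ e2
    rw [h0] at e2
    obtain rfl : r' = r := by simpa using e2
    rw [sub_eq_zero.1 h0]

theorem dir_re_eq_zero_iff (d : GaussianIntˣ) :
    (d : GaussianInt).re = 0 ↔ ¬ (d : GaussianInt).im = 0 := by
  rcases unit_val_cases d with h | h | h | h <;> simp [h]

theorem Obeys.isCoherent {𝒞 : Set CompleteCurve} (h : Obeys 𝒞 t κ) : IsCoherent 𝒞 := by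
  have key : ∀ γ ∈ 𝒞, ∀ k : ℤ, ∀ z : GaussianInt,
      ((γ.seg k).start = z → ((z.re + z.im + κ) % 2 = 0 ↔ (γ.seg k).Horizontal)) ∧
      ((γ.seg k).terminal = z → ((z.re + z.im + κ) % 2 = 0 ↔ (γ.seg k).Vertical)) := by
    intro γ hγ k z
    obtain ⟨h1, h2⟩ := h γ hγ k
    refine ⟨by rintro rfl; exact h1, ?_⟩
    -- An arriving segment is a quarter turn away from the segment which leaves the same vertex, so
    -- coherence of the latter determines its kind.
    have h3 := (h γ hγ (k + 1)).1
    rw [Coh, h2, adv_one_start, adv_one_dir] at h3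
    rintro rfl
    rw [h3, Seg.Vertical]
    rcases iUnit_zpow_cases (t (γ.seg k).terminal) with h' | h' <;> simp [h', iUnit_val]
  rcases Int.emod_two_eq_zero_or_one κ with hκ | hκ
  · left
    refine fun z => ⟨fun hz γ hγ k => ?_, fun hz γ hγ k => ?_⟩
    · have hz' := Int.even_iff.1 hz
      exact ⟨fun e => ((key γ hγ k z).1 e).1 (by omega), fun e => ((key γ hγ k z).2 e).1 (by omega)⟩
    · have hz' := Int.odd_iff.1 hz
      have k1 := key γ hγ k z
      simp only [Seg.Horizontal, Seg.Vertical, dir_re_eq_zero_iff] at k1 ⊢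
      exact ⟨fun e h0 => by have := (k1.1 e).2 h0; omega,
        fun e => by by_contra h0; have := (k1.2 e).2 h0; omega⟩
  · right
    refine fun z => ⟨fun hz γ hγ k => ?_, fun hz γ hγ k => ?_⟩
    · have hz' := Int.even_iff.1 hz
      have k1 := key γ hγ k z
      simp only [Seg.Horizontal, Seg.Vertical, dir_re_eq_zero_iff] at k1 ⊢
      exact ⟨fun e h0 => by have := (k1.1 e).2 h0; omega,
        fun e => by by_contra h0; have := (k1.2 e).2 h0; omega⟩
    · have hz' := Int.odd_iff.1 hz
      exact ⟨fun e => ((key γ hγ k z).1 e).1 (by omega), fun e => ((key γ hγ k z).2 e).1 (by omega)⟩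
end Paperfolding

/-! ### Deflation of curves: the parent map -/

namespace Paperfolding

/-- The segment of the derived curve to which `s` belongs. -/
def parent (q : GaussianInt) (s : Seg) : Seg :=
  if IsEv s.start then ⟨half s.start, if IsEv (half s.start) then s.dir else -iUnit * s.dir⟩
  else
    let y := half (s.start + q * s.dir)
    let d := if IsEv y then s.dir else -iUnit * s.dir
    ⟨y - q * d, d⟩

/-- The successor of `s` in the curves with turns `turnAt`, for the step `q`. -/
abbrev succ (q : GaussianInt) : Equiv.Perm Seg := adv q turnAt

/-- The first of the two segments which replace `s` in the inflated curve. -/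
def child (s : Seg) : Seg :=
  ⟨opi * s.start, if IsEv s.start then s.dir else iUnit * s.dir⟩

/-- The segment which starts at the end of `s`, after a left turn. -/
def goLeft (q : GaussianInt) (s : Seg) : Seg := ⟨s.start + q * s.dir, iUnit * s.dir⟩

/-- The segment which starts at the end of `s`, after a right turn. -/
def goRight (q : GaussianInt) (s : Seg) : Seg := ⟨s.start + q * s.dir, -iUnit * s.dir⟩

theorem succ_eq (q : GaussianInt) (s : Seg) :
    succ q s = if turnAt (s.start + q * s.dir) = 1 then goLeft q s else goRight q s := by
  split_ifs with h
  · ext1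
    · rfl
    · rw [adv_dir, h, iUnit_zpow_one]; rfl
  · ext1
    · rfl
    · rw [adv_dir, (Int.units_eq_one_or _).resolve_left h, iUnit_zpow_neg_one]; rfl

theorem isEv_add (a b : GaussianInt) : IsEv (a + b) ↔ (IsEv a ↔ IsEv b) := by
  simp [IsEv]; omega

theorem isEv_odd_mul_unit (k : GaussianInt) (d : GaussianIntˣ) :
    ¬ IsEv ((1 + 2 * k) * (d : GaussianInt)) := by
  rcases unit_val_cases d with h | h | h | h <;> simp [h, IsEv] <;> omega

theorem coh_zero_iff (s : Seg) : Coh 0 s ↔ (IsEv s.start ↔ (s.dir : GaussianInt).im = 0) := by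
  simp [Coh, IsEv]

theorem iUnit_sq : (iUnit : GaussianInt) * iUnit = -1 := by decide

theorem neg_iUnit_mul_iUnit : -iUnit * iUnit = 1 := by
  ext <;> simp [iUnit_val] 

theorem opi_eq : opi = 1 + iUnit := by decide

theorem zpow_two_mul_succ {α : Type*} (f : Equiv.Perm α) (n : ℤ) (x : α) :
    (f ^ (2 * (n + 1))) x = f (f ((f ^ (2 * n)) x)) := by
  rw [show 2 * (n + 1) = 1 + (1 + 2 * n) by ring, zpow_one_add, zpow_one_add]
  rfl

section
variable {k q : GaussianInt} {s : Seg}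

theorem not_isEv_mul_unit (hq : q = 1 + 2 * k) (d : GaussianIntˣ) : ¬ IsEv (q * (d : GaussianInt)) := by
  subst hq; exact isEv_odd_mul_unit k d

theorem isEv_step (hq : q = 1 + 2 * k) (w : GaussianInt) (d : GaussianIntˣ) :
    IsEv (w + q * d) ↔ ¬ IsEv w := by
  rw [isEv_add, iff_false_right (not_isEv_mul_unit hq d)]

theorem isEv_step_sub (hq : q = 1 + 2 * k) (w : GaussianInt) (d : GaussianIntˣ) :
    IsEv (w - q * d) ↔ ¬ IsEv w := by
  rw [← isEv_step hq w (-d), Units.val_neg, mul_neg, sub_eq_add_neg]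

/-- The turn in the middle of an inflated segment. -/
theorem turnAt_middle (hq : q = 1 + 2 * k) {s' : Seg} (he : s.start = opi * s'.start) (hs : Coh 0 s) :
    turnAt (s.start + q * s.dir) = if IsEv s'.start then 1 else -1 := by
  have h1 : ¬ IsEv (s.start + q * s.dir) := by
    rw [isEv_step hq, he, not_not]; exact isEv_opi_mul _
  rw [turnAt_of_odd h1]
  have h2 : (s.dir : GaussianInt).im = 0 := by
    rw [coh_zero_iff, he] at hs
    exact hs.1 (isEv_opi_mul _)
  rw [he, hq]
  unfold IsEv
  rcases unit_val_cases s.dir with h | h | h | h <;> rw [h] at h2 ⊢ <;> simp [opi] at h2 ⊢ <;>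
    split_ifs <;> first | rfl | omega

theorem parent_of_isEv (h : IsEv s.start) :
    parent q s = ⟨half s.start, if IsEv (half s.start) then s.dir else -iUnit * s.dir⟩ := by
  simp [parent, h]

theorem parent_of_odd (hq : q = 1 + 2 * k) (h : ¬ IsEv s.start) : ∃ y, s.start + q * s.dir = opi * y ∧
    parent q s = ⟨y - q * (if IsEv y then s.dir else -iUnit * s.dir : GaussianIntˣ),
      if IsEv y then s.dir else -iUnit * s.dir⟩ :=
  ⟨_, (opi_mul_half ((isEv_step hq _ _).2 h)).symm, by simp only [parent, if_neg h]⟩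

theorem coh_parent (hq : q = 1 + 2 * k) (hs : Coh 0 s) : Coh 0 (parent q s) := by
  rw [coh_zero_iff] at hs ⊢
  by_cases h1 : IsEv s.start
  · rw [parent_of_isEv h1]
    simp only [h1, true_iff] at hs
    by_cases h2 : IsEv (half s.start)
    · simp [h2, hs]
    · simp [h2, hs, iUnit_val, (dir_re_eq_zero_iff s.dir).not]
  · obtain ⟨y, -, hp⟩ := parent_of_odd hq h1
    simp only [h1, false_iff] at hs
    rw [hp, isEv_step_sub hq]
    by_cases h2 : IsEv y
    · simp [h2, hs]
    · simp [h2, hs, iUnit_val, dir_re_eq_zero_iff s.dir]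

/-- A coherent segment with even start is the first half of its inflated parent. By `turnAt_middle`,
the forced turn at its odd end leads to the second half. -/
theorem parent_succ_of_isEv (hq : q = 1 + 2 * k) (hs : Coh 0 s) (h : IsEv s.start) : parent q (succ q s) = parent q s := by
  have he := opi_mul_half h
  have hm := turnAt_middle hq (s' := ⟨half s.start, 1⟩) he.symm hs
  have hodd : ¬ IsEv (succ q s).start := by
    rw [adv_start, isEv_step hq, not_not]; exact h
  rw [parent_of_isEv h]
  rw [parent, if_neg hodd]
  by_cases h2 : IsEv (half s.start)
  · simp only [h2, if_true] at hm ⊢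
    have e : (succ q s).start + q * (succ q s).dir = opi * (half s.start + q * s.dir) := by
      rw [adv_start, adv_dir, hm, iUnit_zpow_one, opi_eq, mul_add, ← opi_eq, he, Units.val_mul]
      rw [opi_eq]; ring
    have h3 : ¬ IsEv (half s.start + q * s.dir) := by rw [isEv_step hq]; exact not_not.2 h2
    simp only [e, half_opi_mul, h3, if_false]
    have e2 : -iUnit * (succ q s).dir = s.dir := by
      rw [adv_dir, hm, iUnit_zpow_one, ← mul_assoc, neg_iUnit_mul_iUnit, one_mul]
    simp [e2]
  · simp only [h2, if_false] at hm ⊢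
    have e : (succ q s).start + q * (succ q s).dir
        = opi * (half s.start + q * (-iUnit * s.dir : GaussianIntˣ)) := by
      rw [adv_start, adv_dir, hm, iUnit_zpow_neg_one, mul_add, he]
      simp only [Units.val_mul, Units.val_neg, opi_eq]
      linear_combination q * s.dir * iUnit_sq
    have h3 : IsEv (half s.start + q * (-iUnit * s.dir : GaussianIntˣ)) := by
      rw [isEv_step hq]; exact h2
    have e2 : (succ q s).dir = -iUnit * s.dir := by
      rw [adv_dir, hm, iUnit_zpow_neg_one]
    simp only [e, half_opi_mul, h3, if_true]
    simp only [e2, add_sub_cancel_right]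

/-- A segment with odd start is the second half of its inflated parent, and both end at the same
place up to the factor `1 + i`. The same correction by `1` or `-i` links the directions to those of
the parents before and after the corner. -/
theorem parent_goLeft_of_odd (hq : q = 1 + 2 * k) (h : ¬ IsEv s.start) :
    parent q (goLeft q s) = goLeft q (parent q s) := by
  obtain ⟨y, hy, hp⟩ := parent_of_odd hq h
  have h1 : IsEv (goLeft q s).start := (isEv_step hq _ _).2 h
  rw [parent_of_isEv h1, hp]
  simp only [goLeft, hy, half_opi_mul]
  split_ifs <;> ext1 <;> simp [mul_left_comm]

theorem parent_goRight_of_odd (hq : q = 1 + 2 * k) (h : ¬ IsEv s.start) :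
    parent q (goRight q s) = goRight q (parent q s) := by
  obtain ⟨y, hy, hp⟩ := parent_of_odd hq h
  have h1 : IsEv (goRight q s).start := (isEv_step hq _ _).2 h
  rw [parent_of_isEv h1, hp]
  simp only [goRight, hy, half_opi_mul]
  split_ifs <;> ext1 <;> simp

theorem parent_end_of_odd (hq : q = 1 + 2 * k) (h : ¬ IsEv s.start) :
    s.start + q * s.dir = opi * ((parent q s).start + q * (parent q s).dir) := by
  obtain ⟨y, hy, hp⟩ := parent_of_odd hq h
  rw [hy, hp]; simp

/-- The turns at the ends of `s` and of its parent agree because `turnAt` is invariant under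
multiplication by `1 + i`. -/
theorem parent_succ_of_odd (hq : q = 1 + 2 * k) (h : ¬ IsEv s.start) :
    parent q (succ q s) = succ q (parent q s) := by
  rw [succ_eq, succ_eq, parent_end_of_odd hq h, turnAt_opi_mul]
  split_ifs
  · exact parent_goLeft_of_odd hq h
  · exact parent_goRight_of_odd hq h

theorem coh_succ_zpow (hq : q = 1 + 2 * k) (n : ℤ) : Coh 0 ((succ q ^ n) s) ↔ Coh 0 s := by
  subst hq; exact coh_adv_zpow 0 k turnAt s n

theorem coh_succ (hq : q = 1 + 2 * k) : Coh 0 (succ q s) ↔ Coh 0 s := by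
  subst hq; exact coh_adv 0 k turnAt s

theorem isEv_succ (hq : q = 1 + 2 * k) : IsEv (succ q s).start ↔ ¬ IsEv s.start := by
  rw [adv_start, isEv_step hq]

theorem child_parent_of_isEv (h : IsEv s.start) : child (parent q s) = s := by
  rw [parent_of_isEv h]
  have := opi_mul_half h
  ext1
  · simp [child, this]
  · simp only [child]
    split_ifs
    · rfl
    · rw [← mul_assoc, mul_comm iUnit, neg_iUnit_mul_iUnit, one_mul]

/-- On coherent segments, `parent` intertwines two steps with one step: among two consecutive steps,
exactly one changes the parent. -/
theorem parent_sq (hq : q = 1 + 2 * k) (hs : Coh 0 s) : parent q (succ q (succ q s)) = succ q (parent q s) := by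
  by_cases h : IsEv s.start
  · rw [parent_succ_of_odd hq (by rw [isEv_succ hq]; exact not_not.2 h),
      parent_succ_of_isEv hq hs h]
  · rw [parent_succ_of_isEv hq ((coh_succ hq).2 hs) ((isEv_succ hq).2 h), parent_succ_of_odd hq h]

/-- Any coherent segment is one of the two segments which replace its parent. -/
theorem eq_child_or (hq : q = 1 + 2 * k) (hs : Coh 0 s) : s = child (parent q s) ∨ s = succ q (child (parent q s)) := by
  by_cases h : IsEv s.start
  · exact Or.inl (child_parent_of_isEv h).symm
  · right
    obtain ⟨s', rfl⟩ := (succ q).surjective s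
    have hs' := (coh_succ hq).1 hs
    rw [isEv_succ hq, not_not] at h
    rw [parent_succ_of_isEv hq hs' h, child_parent_of_isEv h]

theorem sameCycle_of_parent_eq (hq : q = 1 + 2 * k) {s' : Seg} (hs : Coh 0 s) (hs' : Coh 0 s')
    (h : parent q s = parent q s') : (succ q).SameCycle s s' := by
  have key : ∀ {s : Seg}, Coh 0 s → (succ q).SameCycle (child (parent q s)) s := by
    intro s hs
    rcases eq_child_or hq hs with e | e
    · exact ⟨0, by simpa using e.symm⟩
    · exact ⟨1, by simpa using e.symm⟩
  exact (key hs).symm.trans (h ▸ key hs')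

theorem exists_parent_zpow (hq : q = 1 + 2 * k) (hs : Coh 0 s) (n : ℤ) :
    ∃ m : ℤ, parent q ((succ q ^ m) s) = (succ q ^ n) (parent q s) := by
  refine ⟨2 * n, ?_⟩
  induction n using Int.induction_on with
  | zero => simp
  | succ n ih =>
    rw [zpow_two_mul_succ, parent_sq hq ((coh_succ_zpow hq _).2 hs), ih, add_comm (n : ℤ),
      zpow_one_add, Equiv.Perm.mul_apply]
  | pred n ih =>
    apply (succ q).injective
    rw [← parent_sq hq ((coh_succ_zpow hq _).2 hs), ← zpow_two_mul_succ, ← Equiv.Perm.mul_apply,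
      ← zpow_one_add, add_sub_cancel, sub_add_cancel, ih]

/-- Two segments belong to the same curve if their parents do. -/
theorem sameCycle_of_parent (hq : q = 1 + 2 * k) {s' : Seg} (hs : Coh 0 s) (hs' : Coh 0 s')
    (h : (succ q).SameCycle (parent q s) (parent q s')) : (succ q).SameCycle s s' := by
  obtain ⟨n, hn⟩ := h
  obtain ⟨m, hm⟩ := exists_parent_zpow hq hs n
  rw [hn] at hm
  exact (show (succ q).SameCycle s _ from ⟨m, rfl⟩).trans
    (sameCycle_of_parent_eq hq ((coh_succ_zpow hq _).2 hs) hs' hm)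

theorem parent_pow_two_mul (hq : q = 1 + 2 * k) (hs : Coh 0 s) (n : ℕ) :
    parent q ((succ q ^ (2 * n)) s) = (succ q ^ n) (parent q s) := by
  induction n with
  | zero => simp
  | succ n ih =>
    have : Coh 0 ((succ q ^ (2 * n)) s) := by
      have := (coh_succ_zpow hq (s := s) (2 * n : ℕ)).2 hs
      rwa [zpow_natCast] at this
    rw [pow_succ', Equiv.Perm.mul_apply, ← ih, ← parent_sq hq this,
      ← Equiv.Perm.mul_apply, ← Equiv.Perm.mul_apply, mul_assoc, ← pow_succ', ← pow_succ']
    rfl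

theorem isEv_pow_two_mul (hq : q = 1 + 2 * k) (n : ℕ) : IsEv ((succ q ^ (2 * n)) s).start ↔ IsEv s.start := by
  induction n with
  | zero => simp
  | succ n ih =>
    rw [show 2 * (n + 1) = 2 * n + 1 + 1 by ring, pow_succ', pow_succ', Equiv.Perm.mul_apply,
      Equiv.Perm.mul_apply, isEv_succ hq, isEv_succ hq, not_not, ih]

/-- The distance along the curve is roughly divided by two. -/
theorem exists_parent_pow (hq : q = 1 + 2 * k) (hs : Coh 0 s) (m : ℕ) :
    ∃ n : ℕ, m ≤ 2 * n + 1 ∧ 2 * n ≤ m + 1 ∧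
      parent q ((succ q ^ m) s) = (succ q ^ n) (parent q s) := by
  rcases Nat.even_or_odd' m with ⟨j, rfl | rfl⟩
  · exact ⟨j, by omega, by omega, parent_pow_two_mul hq hs j⟩
  · have hc : Coh 0 ((succ q ^ (2 * j)) s) := by
      have := (coh_succ_zpow hq (s := s) (2 * j : ℕ)).2 hs
      rwa [zpow_natCast] at this
    rw [pow_succ', Equiv.Perm.mul_apply]
    by_cases h : IsEv s.start
    · refine ⟨j, by omega, by omega, ?_⟩
      rw [parent_succ_of_isEv hq hc ((isEv_pow_two_mul hq j).2 h), parent_pow_two_mul hq hs]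
    · refine ⟨j + 1, by omega, by omega, ?_⟩
      rw [parent_succ_of_odd hq ((isEv_pow_two_mul hq j).not.2 h), parent_pow_two_mul hq hs,
        ← Equiv.Perm.mul_apply, ← pow_succ']

theorem sameCycle_parent (hq : q = 1 + 2 * k) {s' : Seg} (hs : Coh 0 s) (hs' : Coh 0 s')
    (h : (succ q).SameCycle s s') : (succ q).SameCycle (parent q s) (parent q s') := by
  have key : ∀ {s s' : Seg}, Coh 0 s → ∀ m : ℕ, (succ q ^ m) s = s' →
      (succ q).SameCycle (parent q s) (parent q s') := by
    rintro s _ hs m rfl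
    obtain ⟨n, -, -, e⟩ := exists_parent_pow hq hs m
    exact ⟨n, by rw [e, zpow_natCast]⟩
  obtain ⟨n, hn⟩ := h
  obtain ⟨m, rfl | rfl⟩ := n.eq_nat_or_neg
  · exact key hs m (by simpa using hn)
  · refine (key hs' m ?_).symm
    rw [← hn, ← zpow_natCast, ← Equiv.Perm.mul_apply, ← zpow_add]
    simp

end
end Paperfolding

/-! ### Contraction to periodic segments, and invariance of corners -/

namespace Paperfolding

variable {k q : GaussianInt} {s : Seg}

/-- At the odd end of `s` the curve turns left, so the right corner leads to another parent, two
right corners away. The two equalities locate these corners: multiplied by `1 + i`, their vertices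
are at one step `q` from the end of `s`, as the induction of `corner_invariant` requires. -/
theorem parent_goRight_of_isEv (hq : q = 1 + 2 * k) (hs : Coh 0 s) (h : IsEv s.start)
    (ht : turnAt (s.start + q * s.dir) = 1) :
    parent q (goRight q s) = goRight q (goRight q (parent q s)) ∧
    opi * ((parent q s).start + q * (parent q s).dir)
      = s.start + q * s.dir + q * (iUnit * s.dir : GaussianIntˣ) ∧
    opi * ((goRight q (parent q s)).start + q * (goRight q (parent q s)).dir)
      = s.start + q * s.dir + q * s.dir := by
  have he := opi_mul_half h
  have h2 : IsEv (half s.start) := by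
    rw [turnAt_middle hq (s' := ⟨half s.start, 1⟩) he.symm hs] at ht
    by_contra h2
    simp [h2] at ht
  have hodd : ¬ IsEv (goRight q s).start := by
    rw [goRight, isEv_step hq, not_not]; exact h
  obtain ⟨y, hy, hp⟩ := parent_of_odd hq hodd
  obtain rfl : y = half s.start + q * (-iUnit * s.dir : GaussianIntˣ) := by
    apply mul_left_cancel₀ (show opi ≠ 0 by decide)
    rw [← hy, mul_add, he]
    simp only [goRight, Units.val_mul, Units.val_neg, opi_eq]
    linear_combination q * s.dir * iUnit_sq
  rw [hp, if_neg (by rw [isEv_step hq]; exact not_not.2 h2), parent_of_isEv h, if_pos h2]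
  have e : -iUnit * -iUnit = -1 := by decide +kernel
  refine ⟨?_, ?_, ?_⟩
  · ext1
    · simp only [goRight, ← mul_assoc, e]
      simp; ring
    · simp only [goRight]
  · simp only [mul_add, he, Units.val_mul]
    rw [opi_eq]; ring
  · simp only [goRight, Units.val_mul, Units.val_neg, opi_eq] at he ⊢
    linear_combination he - q * s.dir * iUnit_sq

theorem parent_goLeft_of_isEv (hq : q = 1 + 2 * k) (hs : Coh 0 s) (h : IsEv s.start)
    (ht : turnAt (s.start + q * s.dir) ≠ 1) :
    parent q (goLeft q s) = goLeft q (goLeft q (parent q s)) ∧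
    opi * ((parent q s).start + q * (parent q s).dir)
      = s.start + q * s.dir + q * (-iUnit * s.dir : GaussianIntˣ) ∧
    opi * ((goLeft q (parent q s)).start + q * (goLeft q (parent q s)).dir)
      = s.start + q * s.dir + q * s.dir := by
  have he := opi_mul_half h
  have h2 : ¬ IsEv (half s.start) := by
    rw [turnAt_middle hq (s' := ⟨half s.start, 1⟩) he.symm hs] at ht
    intro h2
    simp [h2] at ht
  have hodd : ¬ IsEv (goLeft q s).start := by
    rw [goLeft, isEv_step hq, not_not]; exact h
  obtain ⟨y, hy, hp⟩ := parent_of_odd hq hodd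
  obtain rfl : y = half s.start + q * s.dir := by
    apply mul_left_cancel₀ (show opi ≠ 0 by decide)
    rw [← hy, mul_add, he]
    simp only [goLeft, Units.val_mul, opi_eq]
    ring
  rw [hp, if_pos (by rw [isEv_step hq]; exact h2), parent_of_isEv h, if_neg h2]
  have e : iUnit * -iUnit = 1 := by decide +kernel
  refine ⟨?_, ?_, ?_⟩
  · ext1
    · simp only [goLeft, ← mul_assoc, e, one_mul]
      simp; ring
    · simp only [goLeft, ← mul_assoc, e, one_mul]
  · simp only [Units.val_mul, Units.val_neg, opi_eq] at he ⊢
    linear_combination he - q * s.dir * iUnit_sq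
  · simp only [goLeft, ← mul_assoc, e, one_mul]
    simp only [Units.val_mul, Units.val_neg, opi_eq] at he ⊢
    linear_combination he - q * s.dir * iUnit_sq

/-- The difference between the two sides is the norm of `a - 2 * b`. -/
theorem norm_add_le (a b : GaussianInt) : 2 * (a + b).norm ≤ 3 * a.norm + 6 * b.norm := by
  simp only [Zsqrtd.norm_def, Zsqrtd.re_add, Zsqrtd.im_add]
  nlinarith [sq_nonneg (a.re - 2 * b.re), sq_nonneg (a.im - 2 * b.im)]

theorem norm_unit (d : GaussianIntˣ) : (d : GaussianInt).norm = 1 :=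
  (Zsqrtd.norm_eq_one_iff' (by norm_num) _).2 d.isUnit

theorem norm_contract {w y : GaussianInt} {d : GaussianIntˣ} (h : opi * y = w + q * d) :
    4 * y.norm ≤ 3 * w.norm + 6 * q.norm := by
  have h1 := norm_opi_mul y
  have h2 := norm_add_le w (q * d)
  rw [← h, Zsqrtd.norm_mul q, norm_unit] at h2
  omega

/-- Multiplied by `1 + i`, the start of the parent is either the start of `s` or a point at one step
`q` from it. -/
theorem norm_parent (hq : q = 1 + 2 * k) :
    4 * (parent q s).start.norm ≤ 3 * s.start.norm + 6 * q.norm := by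
  by_cases h : IsEv s.start
  · have e : s.start = opi * (parent q s).start := by
      rw [parent_of_isEv h]; exact (opi_mul_half h).symm
    have := norm_opi_mul (parent q s).start
    rw [← e] at this
    have h1 := Zsqrtd.norm_nonneg (by norm_num : (-1 : ℤ) ≤ 0) q
    have h2 := Zsqrtd.norm_nonneg (by norm_num : (-1 : ℤ) ≤ 0) (parent q s).start
    omega
  · obtain ⟨y, hy, hp⟩ := parent_of_odd hq h
    by_cases h2 : IsEv y
    · rw [if_pos h2] at hp
      apply norm_contract (w := s.start) (d := -iUnit * s.dir)
      rw [hp]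
      simp only [Units.val_mul, Units.val_neg, opi_eq] at hy ⊢
      linear_combination -hy
    · rw [if_neg h2] at hp
      apply norm_contract (w := s.start) (d := iUnit * s.dir)
      rw [hp]
      simp only [Units.val_mul, Units.val_neg, opi_eq] at hy ⊢
      linear_combination -hy + q * s.dir * iUnit_sq

theorem dvd_of_dvd_parent (hq : q = 1 + 2 * k) (h : q ∣ (parent q s).start) : q ∣ s.start := by
  by_cases he : IsEv s.start
  · have e : s.start = opi * (parent q s).start := by
      rw [parent_of_isEv he]; exact (opi_mul_half he).symm
    rw [e]; exact h.mul_left _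
  · have e := parent_end_of_odd hq he
    rw [eq_sub_of_add_eq e]
    exact ((h.add (dvd_mul_right _ _)).mul_left _).sub (dvd_mul_right _ _)

/-- `s` belongs to the curve of a segment of `L`. -/
def OnCurve (q : GaussianInt) (L : List Seg) (s : Seg) : Prop :=
  ∃ f ∈ L, (succ q).SameCycle f s

/-- A set of coherent segments which is equal to the set of their parents. -/
structure ParentStable (q : GaussianInt) (L : List Seg) : Prop where
  coh : ∀ f ∈ L, Coh 0 f
  parent_mem : ∀ f ∈ L, parent q f ∈ L
  exists_parent : ∀ f ∈ L, ∃ g ∈ L, parent q g = f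

/-- Being on a common curve passes to parents and back; stability of `L` in both directions supplies
the representatives. -/
theorem onCurve_parent_iff (hq : q = 1 + 2 * k) {L : List Seg} (hL : ParentStable q L)
    (hs : Coh 0 s) : OnCurve q L (parent q s) ↔ OnCurve q L s := by
  constructor
  · rintro ⟨f, hf, h⟩
    obtain ⟨g, hg, rfl⟩ := hL.exists_parent f hf
    exact ⟨g, hg, sameCycle_of_parent hq (hL.coh g hg) hs h⟩
  · rintro ⟨f, hf, h⟩
    exact ⟨_, hL.parent_mem f hf, sameCycle_parent hq (hL.coh f hf) hs h⟩

/-- When the norm of the start exceeds `6 * q.norm`, the bound `4 * N' ≤ 3 * N + 6 * q.norm` makes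
the norm of the parent's start strictly smaller. The question is thus reduced to a finite set of
segments. -/
theorem onCurve_of_base (hq : q = 1 + 2 * k) {L : List Seg} (hL : ParentStable q L)
    (base : ∀ s, Coh 0 s → ¬ q ∣ s.start → s.start.norm ≤ 6 * q.norm → OnCurve q L s)
    (hs : Coh 0 s) (hd : ¬ q ∣ s.start) : OnCurve q L s := by
  induction hn : s.start.norm.natAbs using Nat.strong_induction_on generalizing s with
  | _ n ih =>
    by_cases h : s.start.norm ≤ 6 * q.norm
    · exact base s hs hd h
    · have h1 := norm_parent (s := s) hq
      have h2 := Zsqrtd.norm_nonneg (by norm_num : (-1 : ℤ) ≤ 0) (parent q s).start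
      exact (onCurve_parent_iff hq hL hs).1 (ih _ (by omega) (coh_parent hq hs)
        (fun h => hd (dvd_of_dvd_parent hq h)) rfl)

/-- No segment of `L` can be reached from another one. -/
theorem ParentStable.pow_ne (hq : q = 1 + 2 * k) {L : List Seg} (hL : ParentStable q L)
    (h1 : ∀ f ∈ L, succ q f ∉ L) (m : ℕ) (hm : 0 < m) :
    ∀ f ∈ L, (succ q ^ m) f ∉ L := by
  induction m using Nat.strong_induction_on with
  | _ m ih =>
    intro f hf hg
    by_cases hm1 : m = 1
    · subst hm1; rw [pow_one] at hg; exact h1 f hf hg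
    obtain ⟨n, hn1, hn2, e⟩ := exists_parent_pow hq (hL.coh f hf) m
    -- For `m ≥ 2`, the inequalities `m ≤ 2 * n + 1` and `2 * n ≤ m + 1` give `0 < n < m`. The
    -- descent ends at `m = 1`, which `h1` excludes.
    refine ih n (by omega) (by omega) _ (hL.parent_mem f hf) ?_
    rw [← e]
    exact hL.parent_mem _ hg

theorem ParentStable.zpow_eq (hq : q = 1 + 2 * k) {L : List Seg} (hL : ParentStable q L)
    (h1 : ∀ f ∈ L, succ q f ∉ L) {f : Seg} (hf : f ∈ L) (n : ℤ) (hn : (succ q ^ n) f ∈ L) :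
    n = 0 := by
  obtain ⟨m, rfl | rfl⟩ := n.eq_nat_or_neg
  · by_contra h
    exact hL.pow_ne hq h1 m (by omega) f hf (by simpa using hn)
  · by_contra h
    refine hL.pow_ne hq h1 m (by omega) _ hn ?_
    rw [← zpow_natCast, ← Equiv.Perm.mul_apply, ← zpow_add]
    simpa using hf

theorem OnCurve.of_sameCycle {L : List Seg} {s' : Seg} (h : OnCurve q L s)
    (hc : (succ q).SameCycle s s') : OnCurve q L s' := by
  obtain ⟨f, hf, h⟩ := h
  exact ⟨f, hf, h.trans hc⟩

theorem onCurve_congr {L : List Seg} {s' : Seg} (hc : (succ q).SameCycle s s') :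
    OnCurve q L s ↔ OnCurve q L s' :=
  ⟨fun h => h.of_sameCycle hc, fun h => h.of_sameCycle hc.symm⟩

theorem sameCycle_succ (q : GaussianInt) (s : Seg) : (succ q).SameCycle s (succ q s) :=
  ⟨1, by simp⟩

theorem coh_goLeft (hq : q = 1 + 2 * k) : Coh 0 (goLeft q s) ↔ Coh 0 s := by
  rw [coh_zero_iff, coh_zero_iff, goLeft, isEv_step hq]
  rcases unit_val_cases s.dir with h | h | h | h <;> simp [h, iUnit_val]

theorem coh_goRight (hq : q = 1 + 2 * k) : Coh 0 (goRight q s) ↔ Coh 0 s := by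
  rw [coh_zero_iff, coh_zero_iff, goRight, isEv_step hq]
  rcases unit_val_cases s.dir with h | h | h | h <;> simp [h, iUnit_val]

/-- The curves of `LB` are always turned away from the other ones at a left corner, and those
of `LA` at a right corner. -/
theorem corner_invariant (hq : q = 1 + 2 * k) {LA LB : List Seg} (hA : ParentStable q LA)
    (hB : ParentStable q LB)
    (base : ∀ s, Coh 0 s → ¬ q ∣ s.start + q * s.dir → (s.start + q * s.dir).norm ≤ 6 * q.norm →
      (OnCurve q LB s ↔ OnCurve q LB (goLeft q s)) ∧
      (OnCurve q LA s ↔ OnCurve q LA (goRight q s)))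
    (hs : Coh 0 s) (hd : ¬ q ∣ s.start + q * s.dir) :
    (OnCurve q LB s ↔ OnCurve q LB (goLeft q s)) ∧
      (OnCurve q LA s ↔ OnCurve q LA (goRight q s)) := by
  induction hn : (s.start + q * s.dir).norm.natAbs using Nat.strong_induction_on generalizing s with
  | _ n ih =>
    by_cases hle : (s.start + q * s.dir).norm ≤ 6 * q.norm
    · exact base s hs hd hle
    have hqn := Zsqrtd.norm_nonneg (by norm_num : (-1 : ℤ) ≤ 0) q
    have step : ∀ s' : Seg, Coh 0 s' → ∀ d : GaussianIntˣ,
        opi * (s'.start + q * s'.dir) = s.start + q * s.dir + q * d →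
        (OnCurve q LB s' ↔ OnCurve q LB (goLeft q s')) ∧
        (OnCurve q LA s' ↔ OnCurve q LA (goRight q s')) := by
      intro s' hs' d hd'
      have h1 := norm_contract hd'
      have h2 := Zsqrtd.norm_nonneg (by norm_num : (-1 : ℤ) ≤ 0) (s'.start + q * s'.dir)
      -- Beyond `6 * q.norm`, `4 * N' ≤ 3 * N + 6 * q.norm` forces `N' < N`.
      refine ih _ (by omega) hs' (fun h => hd ?_) rfl
      rw [eq_sub_of_add_eq hd'.symm]
      exact (h.mul_left _).sub (dvd_mul_right _ _)
    have hp := coh_parent hq hs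
    have hl := (coh_goLeft hq (s := s)).2 hs
    have hr := (coh_goRight hq (s := s)).2 hs
    by_cases he : IsEv s.start
    · by_cases ht : turnAt (s.start + q * s.dir) = 1
      -- The corner taken by the curve itself is trivial. The opposite one becomes, for parents, two
      -- corners of the same sense at vertices nearer to the origin.
      · have hsucc : succ q s = goLeft q s := by rw [succ_eq, if_pos ht]
        obtain ⟨e1, e2, e3⟩ := parent_goRight_of_isEv hq hs he ht
        refine ⟨onCurve_congr (hsucc ▸ sameCycle_succ q s), ?_⟩
        rw [← onCurve_parent_iff hq hA hs, ← onCurve_parent_iff hq hA hr, e1,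
          (step _ hp _ e2).2, (step _ ((coh_goRight hq).2 hp) _ e3).2]
      · have hsucc : succ q s = goRight q s := by rw [succ_eq, if_neg ht]
        obtain ⟨e1, e2, e3⟩ := parent_goLeft_of_isEv hq hs he ht
        refine ⟨?_, onCurve_congr (hsucc ▸ sameCycle_succ q s)⟩
        rw [← onCurve_parent_iff hq hB hs, ← onCurve_parent_iff hq hB hl, e1,
          (step _ hp _ e2).1, (step _ ((coh_goLeft hq).2 hp) _ e3).1]
    · have e := parent_end_of_odd hq he
      have h1 := norm_opi_mul ((parent q s).start + q * (parent q s).dir)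
      rw [← e] at h1
      have h2 := Zsqrtd.norm_nonneg (by norm_num : (-1 : ℤ) ≤ 0)
        ((parent q s).start + q * (parent q s).dir)
      rw [← onCurve_parent_iff hq hB hs, ← onCurve_parent_iff hq hB hl,
        ← onCurve_parent_iff hq hA hs, ← onCurve_parent_iff hq hA hr, parent_goLeft_of_odd hq he,
        parent_goRight_of_odd hq he]
      exact ih _ (by omega) hp (fun h => hd (e ▸ h.mul_left _)) rfl

end Paperfolding

/-! ### Certified computation with periodic segments -/

namespace Paperfolding

instance : DecidableEq Seg := fun s s' =>
  decidable_of_iff (s.start.re = s'.start.re ∧ s.start.im = s'.start.im ∧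
      (s.dir : GaussianInt).re = (s'.dir : GaussianInt).re ∧
      (s.dir : GaussianInt).im = (s'.dir : GaussianInt).im)
    (by rw [Seg.ext_iff, Units.ext_iff, Zsqrtd.ext_iff, Zsqrtd.ext_iff, and_assoc])

instance (κ : ℤ) (s : Seg) : Decidable (Coh κ s) := inferInstanceAs (Decidable (_ ↔ _))

/-- Whether `L` is reached from the segment which starts at `x + i y` with direction `u + i v` by
taking parents `n` times, for `q = a + i b`. -/
def reach (a b : ℤ) (L : List Seg) : ℕ → ℤ → ℤ → ℤ → ℤ → Bool
  | 0, x, y, u, v => L.any fun f => decide (f.start.re = x) && decide (f.start.im = y) &&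
      decide ((f.dir : GaussianInt).re = u) && decide ((f.dir : GaussianInt).im = v)
  | n + 1, x, y, u, v =>
      if (x + y) % 2 = 0 then
        if ((x + y) / 2 + (y - x) / 2) % 2 = 0 then
          reach a b L n ((x + y) / 2) ((y - x) / 2) u v
        else reach a b L n ((x + y) / 2) ((y - x) / 2) v (-u)
      else
        let x' := x + (a * u - b * v)
        let y' := y + (a * v + b * u)
        if ((x' + y') / 2 + (y' - x') / 2) % 2 = 0 then
          reach a b L n ((x' + y') / 2 - (a * u - b * v)) ((y' - x') / 2 - (a * v + b * u)) u v
        else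
          reach a b L n ((x' + y') / 2 - (a * v + b * u)) ((y' - x') / 2 - (b * v - a * u)) v (-u)

variable {k q : GaussianInt} {s : Seg}

theorem mem_of_reach_zero {a b : ℤ} {L : List Seg}
    (h : reach a b L 0 s.start.re s.start.im (s.dir : GaussianInt).re
      (s.dir : GaussianInt).im = true) : s ∈ L := by
  simp only [reach, List.any_eq_true, Bool.and_eq_true, decide_eq_true_eq] at h
  obtain ⟨f, hf, ⟨⟨h1, h2⟩, h3⟩, h4⟩ := h
  rwa [show s = f from Seg.ext (Zsqrtd.ext h1.symm h2.symm)
    (Units.ext (Zsqrtd.ext h3.symm h4.symm))]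

/-- `reach` carries out the parent map on integer coordinates, so success after `n` parents
certifies membership of the curve by `onCurve_parent_iff`. -/
theorem onCurve_of_reach (hq : q = 1 + 2 * k) {L : List Seg} (hL : ParentStable q L)
    {a b : ℤ} (ha : q.re = a) (hb : q.im = b) (hs : Coh 0 s) (n : ℕ)
    (h : reach a b L n s.start.re s.start.im (s.dir : GaussianInt).re
      (s.dir : GaussianInt).im = true) : OnCurve q L s := by
  subst ha hb
  induction n generalizing s with
  | zero => exact ⟨s, mem_of_reach_zero h, Equiv.Perm.SameCycle.refl _ _⟩
  | succ n ih =>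
    rw [reach] at h
    refine (onCurve_parent_iff hq hL hs).1 (ih (coh_parent hq hs) ?_)
    by_cases h1 : IsEv s.start
    · rw [if_pos (show _ = _ from h1)] at h
      rw [parent_of_isEv h1]
      by_cases h2 : IsEv (half s.start)
      · rw [if_pos (by exact h2)] at h
        simp only [if_pos h2]
        exact h
      · rw [if_neg (by exact h2)] at h
        simp only [if_neg h2]
        convert h using 1
        simp [iUnit_val, half]
    · rw [if_neg (show ¬ _ = _ from h1)] at h
      have e : half (s.start + q * s.dir) =
        ⟨(s.start.re + (q.re * (s.dir : GaussianInt).re - q.im * (s.dir : GaussianInt).im) +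
          (s.start.im + (q.re * (s.dir : GaussianInt).im + q.im * (s.dir : GaussianInt).re))) / 2,
          (s.start.im + (q.re * (s.dir : GaussianInt).im + q.im * (s.dir : GaussianInt).re) -
          (s.start.re + (q.re * (s.dir : GaussianInt).re
            - q.im * (s.dir : GaussianInt).im))) / 2⟩ := by
        simp [half, sub_eq_add_neg]
      rw [parent, if_neg h1, e]
      dsimp only at h ⊢
      split_ifs at h with h2
      · rw [if_pos (by exact h2)]
        convert h using 1
        simp [sub_eq_add_neg]
      · rw [if_neg (by exact h2)]
        convert h using 1
        simp [iUnit_val, sub_eq_add_neg, add_comm]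

attribute [irreducible] reach

/-- The periodic segments are listed along a cycle of `parent`, which then acts on the list as a
cyclic shift. -/
theorem ParentStable.of_rotate {L : List Seg} (h : ∀ f ∈ L, Coh 0 f)
    (hr : L.map (parent q) = L.rotate 1) : ParentStable q L where
  coh := h
  parent_mem f hf := by
    have := List.mem_map_of_mem (f := parent q) hf
    rwa [hr, List.mem_rotate] at this
  exists_parent f hf := by
    rw [← List.mem_rotate (n := 1), ← hr] at hf
    exact List.mem_map.1 hf

theorem ParentStable.append {L L' : List Seg} (h : ParentStable q L) (h' : ParentStable q L') :
    ParentStable q (L ++ L') where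
  coh f hf := (List.mem_append.1 hf).elim (h.coh f) (h'.coh f)
  parent_mem f hf := List.mem_append.2 ((List.mem_append.1 hf).imp (h.parent_mem f)
    (h'.parent_mem f))
  exists_parent f hf := by
    rcases List.mem_append.1 hf with hf | hf
    · obtain ⟨g, hg, e⟩ := h.exists_parent f hf
      exact ⟨g, List.mem_append_left _ hg, e⟩
    · obtain ⟨g, hg, e⟩ := h'.exists_parent f hf
      exact ⟨g, List.mem_append_right _ hg, e⟩

/-- The coordinates of the four units. -/
def units : List (ℤ × ℤ) := [(1, 0), (-1, 0), (0, 1), (0, -1)]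

theorem mem_units (d : GaussianIntˣ) : ((d : GaussianInt).re, (d : GaussianInt).im) ∈ units := by
  rcases unit_val_cases d with h | h | h | h <;> simp [units, h]

theorem mem_Icc_of_norm_le {w : GaussianInt} {n : ℤ} {N : ℤ} (h : w.norm ≤ N)
    (hN : N < (n + 1) ^ 2) (hn : 0 ≤ n) : w.re ∈ Finset.Icc (-n) n ∧ w.im ∈ Finset.Icc (-n) n := by
  rw [Zsqrtd.norm_def] at h
  simp only [Finset.mem_Icc, ← abs_le]
  constructor <;> rw [← Int.lt_add_one_iff] <;> apply abs_lt_of_sq_lt_sq _ (by omega)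
  · nlinarith [sq_nonneg w.im]
  · nlinarith [sq_nonneg w.re]

/-! ### The embedding of a covering in the set of all segments -/

/-- Rescale, rotate and translate a segment. -/
def embed (ρ : GaussianIntˣ) (q b : GaussianInt) (s : Seg) : Seg :=
  ⟨ρ * q * s.start + b, ρ * s.dir⟩

variable {ρ : GaussianIntˣ} {b : GaussianInt}

/-- The unit step with turns `turnAt (ρ * q * z + b)` is conjugate to the step `q` with turns
`turnAt`. All offsets `b` are thereby treated in one system, where a residue class modulo `q`
corresponds to one covering. -/
theorem embed_adv (s : Seg) :
    embed ρ q b (adv 1 (fun z => turnAt (ρ * q * z + b)) s) = succ q (embed ρ q b s) := by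
  have : (ρ : GaussianInt) * q * s.terminal + b
      = (embed ρ q b s).start + q * (embed ρ q b s).dir := by
    simp only [embed, Seg.terminal, Units.val_mul]; ring
  ext1
  · rw [adv_start, ← this, embed, adv_one_start]
  · rw [adv_dir, ← this, embed, adv_one_dir, embed, mul_left_comm]

theorem embed_adv_zpow (s : Seg) (n : ℤ) :
    embed ρ q b ((adv 1 (fun z => turnAt (ρ * q * z + b)) ^ n) s)
      = (succ q ^ n) (embed ρ q b s) := by
  induction n using Int.induction_on with
  | zero => simp
  | succ n ih =>
    rw [add_comm (n : ℤ), zpow_one_add, zpow_one_add, Equiv.Perm.mul_apply, Equiv.Perm.mul_apply,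
      embed_adv, ih]
  | pred n ih =>
    apply (succ q).injective
    rw [← embed_adv, ← Equiv.Perm.mul_apply, ← Equiv.Perm.mul_apply, ← zpow_one_add,
      ← zpow_one_add, add_sub_cancel, ih]

theorem odd_ne_zero' (hq : q = 1 + 2 * k) : q ≠ 0 := by
  apply odd_ne_zero
  have := not_isEv_mul_unit hq 1
  simpa using this

theorem embed_injective (hq : q ≠ 0) : Function.Injective (embed ρ q b) := by
  intro s s' h
  simp only [embed, Seg.mk.injEq, add_left_inj, mul_right_inj] at h
  exact Seg.ext (mul_left_cancel₀ (mul_ne_zero ρ.ne_zero hq) h.1) h.2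

theorem exists_embed_eq (s : Seg) (h : q ∣ s.start - b) : ∃ s', embed ρ q b s' = s := by
  obtain ⟨c, hc⟩ := h
  refine ⟨⟨(ρ⁻¹ : GaussianIntˣ) * c, ρ⁻¹ * s.dir⟩, ?_⟩
  ext1
  · simp only [embed]
    rw [show (ρ : GaussianInt) * q * ((ρ⁻¹ : GaussianIntˣ) * c) + b
      = ((ρ : GaussianInt) * (ρ⁻¹ : GaussianIntˣ)) * (q * c) + b by ring, ← hc, Units.mul_inv]
    ring
  · simp [embed]

theorem dvd_embed_start (s : Seg) : q ∣ (embed ρ q b s).start - b :=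
  ⟨ρ * s.start, by simp only [embed]; ring⟩

theorem coh_embed (hq : q = 1 + 2 * k) (s : Seg) : Coh 0 (embed ρ q b s) ↔
    Coh (b.re + b.im + (ρ : GaussianInt).im) s := by
  subst hq
  unfold Coh embed
  simp only [Units.val_mul]
  rcases unit_val_cases s.dir with h | h | h | h <;>
  rcases unit_val_cases ρ with h' | h' | h' | h' <;> simp [h, h'] <;> ring_nf <;> omega

/-- Starts of embedded segments are congruent to `b`, hence not divisible by `q`. Their curves meet
`L`, and pulling back along the conjugacy stays in the image of `embed`. -/
theorem isTransversal_embed (hq : q = 1 + 2 * k) {L : List Seg} (hL : ParentStable q L)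
    (hsucc : ∀ f ∈ L, succ q f ∉ L)
    (hall : ∀ s, Coh 0 s → ¬ q ∣ s.start → OnCurve q L s) (hb : ¬ q ∣ b) :
    IsTransversal (fun z => turnAt (ρ * q * z + b)) (b.re + b.im + (ρ : GaussianInt).im)
      {s | embed ρ q b s ∈ L} where
  coh r hr := (coh_embed hq r).1 (hL.coh _ hr)
  exists_sameCycle s hs := by
    have hd : ¬ q ∣ (embed ρ q b s).start := fun h => hb (by
      have := h.sub (dvd_embed_start (q := q) (ρ := ρ) (b := b) s)
      rwa [sub_sub_cancel] at this)
    obtain ⟨f, hf, n, hn⟩ := hall _ ((coh_embed hq s).2 hs) hd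
    have e : embed ρ q b ((adv 1 (fun z => turnAt (ρ * q * z + b)) ^ (-n)) s) = f := by
      rw [embed_adv_zpow, ← hn, ← Equiv.Perm.mul_apply, ← zpow_add]
      simp
    refine ⟨(adv 1 (fun z => turnAt (ρ * q * z + b)) ^ (-n)) s, ?_, n, ?_⟩
    · rw [Set.mem_ofPred_eq, e]; exact hf
    · rw [← Equiv.Perm.mul_apply, ← zpow_add]
      simp
  eq_of_zpow r hr r' hr' n hn := by
    apply hL.zpow_eq hq hsucc hr n
    rw [← embed_adv_zpow, hn]
    exact hr'

theorem ncard_embed (hq : q ≠ 0) {L : List Seg} {f₁ f₂ f₃ : Seg}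
    (h12 : f₁ ≠ f₂) (h13 : f₁ ≠ f₃) (h23 : f₂ ≠ f₃)
    (h₁ : q ∣ f₁.start - b) (h₂ : q ∣ f₂.start - b) (h₃ : q ∣ f₃.start - b)
    (hL : ∀ f, q ∣ f.start - b → (f ∈ L ↔ f = f₁ ∨ f = f₂ ∨ f = f₃)) :
    ∃ r₁ r₂ r₃ : Seg, r₁ ≠ r₂ ∧ r₁ ≠ r₃ ∧ r₂ ≠ r₃ ∧
      embed ρ q b r₁ = f₁ ∧ embed ρ q b r₂ = f₂ ∧ embed ρ q b r₃ = f₃ ∧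
      {s | embed ρ q b s ∈ L} = {r₁, r₂, r₃} := by
  obtain ⟨r₁, rfl⟩ := exists_embed_eq (ρ := ρ) _ h₁
  obtain ⟨r₂, rfl⟩ := exists_embed_eq (ρ := ρ) _ h₂
  obtain ⟨r₃, rfl⟩ := exists_embed_eq (ρ := ρ) _ h₃
  refine ⟨r₁, r₂, r₃, fun h => h12 (h ▸ rfl), fun h => h13 (h ▸ rfl), fun h => h23 (h ▸ rfl),
    rfl, rfl, rfl, ?_⟩
  ext s
  rw [Set.mem_ofPred_eq, hL _ (dvd_embed_start s)]
  simp [(embed_injective hq).eq_iff]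

/-! ### Three curves any two of which have a common vertex -/

/-- The multiplier `1 - 2 i`. -/
def qTriple : GaussianInt := ⟨1, -2⟩

/-- The segments which are iterated parents of themselves for `qTriple`. -/
def periodicTriple : List Seg :=
  [⟨⟨-1, 0⟩, iUnit⟩, ⟨⟨0, 2⟩, 1⟩, ⟨⟨1, 1⟩, 1⟩, ⟨⟨1, 0⟩, -iUnit⟩, ⟨⟨0, -2⟩, -1⟩, ⟨⟨-1, -1⟩, -1⟩] ++
    [⟨⟨1, 2⟩, -iUnit⟩, ⟨⟨1, -1⟩, -1⟩, ⟨⟨0, -1⟩, iUnit⟩, ⟨⟨-1, -2⟩, iUnit⟩, ⟨⟨-1, 1⟩, 1⟩,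
    ⟨⟨0, 1⟩, -iUnit⟩]

theorem qTriple_eq : qTriple = 1 + 2 * ⟨0, -1⟩ := by decide

theorem qTriple_dvd_iff (w : GaussianInt) : qTriple ∣ w ↔ (w.re - 2 * w.im) % 5 = 0 := by
  constructor
  · rintro ⟨v, rfl⟩
    simp [qTriple]; omega
  · intro h
    refine ⟨⟨(w.re - 2 * w.im) / 5, (2 * w.re + w.im) / 5⟩, ?_⟩
    ext <;> simp [qTriple] <;> omega

theorem parentStable_periodicTriple : ParentStable qTriple periodicTriple :=
  (ParentStable.of_rotate (by decide +kernel) (by decide +kernel)).append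
    (ParentStable.of_rotate (by decide +kernel) (by decide +kernel))

theorem succ_notMem_periodicTriple : ∀ f ∈ periodicTriple, succ qTriple f ∉ periodicTriple := by
  decide +kernel

/-- The multiplier has norm `5`, and `6 * 5 < 6 ^ 2` bounds the coordinates by `5`. -/
theorem reach_periodicTriple : ∀ x ∈ Finset.Icc (-5 : ℤ) 5, ∀ y ∈ Finset.Icc (-5 : ℤ) 5,
    ∀ d ∈ units, ((x + y + 0) % 2 = 0 ↔ d.2 = 0) → (x - 2 * y) % 5 ≠ 0 →
      reach 1 (-2) periodicTriple 10 x y d.1 d.2 = true := by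
  decide +kernel

theorem onCurve_periodicTriple (s : Seg) (hs : Coh 0 s) (hd : ¬ qTriple ∣ s.start) :
    OnCurve qTriple periodicTriple s := by
  refine onCurve_of_base qTriple_eq parentStable_periodicTriple ?_ hs hd
  intro s hs hd hn
  obtain ⟨h1, h2⟩ := mem_Icc_of_norm_le (n := 5) hn (by decide) (by norm_num)
  refine onCurve_of_reach qTriple_eq parentStable_periodicTriple (a := 1) (b := -2) rfl rfl hs 10 ?_
  exact reach_periodicTriple _ h1 _ h2 _ (mem_units s.dir) hs (by rwa [qTriple_dvd_iff] at hd)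

/-! ### Three curves one of which separates the other ones -/

/-- The multiplier `3`. -/
def qSep : GaussianInt := ⟨3, 0⟩

/-- The segments of the first curve which are iterated parents of themselves for `qSep`. -/
def periodicA : List Seg :=
  [⟨⟨3, 1⟩, -1⟩, ⟨⟨2, -1⟩, iUnit⟩, ⟨⟨2, -3⟩, iUnit⟩, ⟨⟨1, -4⟩, iUnit⟩, ⟨⟨-3, -1⟩, 1⟩,
    ⟨⟨-2, 1⟩, -iUnit⟩, ⟨⟨-2, 3⟩, -iUnit⟩, ⟨⟨-1, 4⟩, -iUnit⟩]

/-- The segments of the second curve which are iterated parents of themselves for `qSep`. -/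
def periodicM : List Seg :=
  [⟨⟨0, 1⟩, -iUnit⟩, ⟨⟨-1, 2⟩, -iUnit⟩, ⟨⟨2, 0⟩, -1⟩, ⟨⟨1, -1⟩, -1⟩, ⟨⟨0, -1⟩, iUnit⟩,
    ⟨⟨1, -2⟩, iUnit⟩, ⟨⟨-2, 0⟩, 1⟩, ⟨⟨-1, 1⟩, 1⟩]

/-- The segments of the third curve which are iterated parents of themselves for `qSep`. -/
def periodicB : List Seg :=
  [⟨⟨0, -2⟩, -1⟩, ⟨⟨-1, -1⟩, -1⟩, ⟨⟨-1, 0⟩, iUnit⟩, ⟨⟨-2, 2⟩, 1⟩, ⟨⟨0, 2⟩, 1⟩, ⟨⟨1, 1⟩, 1⟩,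
    ⟨⟨1, 0⟩, -iUnit⟩, ⟨⟨2, -2⟩, -1⟩]

/-- All the segments which are iterated parents of themselves for `qSep`. -/
def periodicSep : List Seg := periodicA ++ periodicM ++ periodicB

theorem qSep_eq : qSep = 1 + 2 * 1 := by decide

theorem qSep_dvd_iff (w : GaussianInt) : qSep ∣ w ↔ w.re % 3 = 0 ∧ w.im % 3 = 0 := by
  constructor
  · rintro ⟨v, rfl⟩
    simp [qSep]
  · intro h
    refine ⟨⟨w.re / 3, w.im / 3⟩, ?_⟩
    ext <;> simp [qSep] <;> omega

theorem parentStable_periodicA : ParentStable qSep periodicA :=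
  .of_rotate (by decide +kernel) (by decide +kernel)

theorem parentStable_periodicM : ParentStable qSep periodicM :=
  .of_rotate (by decide +kernel) (by decide +kernel)

theorem parentStable_periodicB : ParentStable qSep periodicB :=
  .of_rotate (by decide +kernel) (by decide +kernel)

theorem parentStable_periodicSep : ParentStable qSep periodicSep :=
  (parentStable_periodicA.append parentStable_periodicM).append parentStable_periodicB

theorem succ_notMem_periodicSep : ∀ f ∈ periodicSep, succ qSep f ∉ periodicSep := by
  decide +kernel

/-- The multiplier has norm `9`, and `6 * 9 < 8 ^ 2` bounds the coordinates by `7`. -/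
theorem reach_periodicSep : ∀ x ∈ Finset.Icc (-7 : ℤ) 7, ∀ y ∈ Finset.Icc (-7 : ℤ) 7,
    ∀ d ∈ units, ((x + y + 0) % 2 = 0 ↔ d.2 = 0) → ¬ (x % 3 = 0 ∧ y % 3 = 0) →
      reach 3 0 periodicSep 10 x y d.1 d.2 = true := by
  decide +kernel

theorem onCurve_periodicSep (s : Seg) (hs : Coh 0 s) (hd : ¬ qSep ∣ s.start) :
    OnCurve qSep periodicSep s := by
  refine onCurve_of_base qSep_eq parentStable_periodicSep ?_ hs hd
  intro s hs hd hn
  obtain ⟨h1, h2⟩ := mem_Icc_of_norm_le (n := 7) hn (by decide) (by norm_num)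
  refine onCurve_of_reach qSep_eq parentStable_periodicSep (a := 3) (b := 0) rfl rfl hs 10 ?_
  exact reach_periodicSep _ h1 _ h2 _ (mem_units s.dir) hs (by rwa [qSep_dvd_iff] at hd)

/-- Distinct periodic segments lie on distinct curves, since no nonzero number of steps joins two of
them. -/
theorem not_onCurve_both {L L' : List Seg} (hL : ∀ f ∈ L, f ∈ periodicSep)
    (hL' : ∀ f ∈ L', f ∈ periodicSep) (hdisj : ∀ f ∈ L, f ∉ L')
    (h : OnCurve qSep L s) (h' : OnCurve qSep L' s) : False := by
  obtain ⟨f, hf, h⟩ := h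
  obtain ⟨g, hg, h'⟩ := h'
  obtain ⟨n, hn⟩ := h.trans h'.symm
  have h0 := parentStable_periodicSep.zpow_eq qSep_eq succ_notMem_periodicSep (hL f hf) n
    (hn ▸ hL' g hg)
  subst h0
  simp only [zpow_zero, Equiv.Perm.one_apply] at hn
  exact hdisj f hf (hn ▸ hg)

/-- Whether it can be seen in `n` steps that two segments both belong to the curves of `L`, or
both to the curves of `L'`. -/
def sameReach (L L' : List Seg) (n : ℕ) (x y u v x' y' u' v' : ℤ) : Bool :=
  (reach 3 0 L n x y u v && reach 3 0 L n x' y' u' v') ||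
    (reach 3 0 L' n x y u v && reach 3 0 L' n x' y' u' v')

/-- Nonmembership is also certified by reaching a list: a segment on a curve of `L'` cannot be on a
curve of `L`. -/
theorem onCurve_iff_of_sameReach {L L' : List Seg} {s' : Seg} (hP : ParentStable qSep L)
    (hP' : ParentStable qSep L') (hL : ∀ f ∈ L, f ∈ periodicSep)
    (hL' : ∀ f ∈ L', f ∈ periodicSep) (hdisj : ∀ f ∈ L, f ∉ L') (hs : Coh 0 s) (hs' : Coh 0 s')
    (n : ℕ) (h : sameReach L L' n s.start.re s.start.im (s.dir : GaussianInt).re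
      (s.dir : GaussianInt).im s'.start.re s'.start.im (s'.dir : GaussianInt).re
      (s'.dir : GaussianInt).im = true) : OnCurve qSep L s ↔ OnCurve qSep L s' := by
  simp only [sameReach, Bool.or_eq_true, Bool.and_eq_true] at h
  rcases h with ⟨h1, h2⟩ | ⟨h1, h2⟩
  · exact iff_of_true (onCurve_of_reach qSep_eq hP rfl rfl hs n h1) (onCurve_of_reach qSep_eq hP rfl rfl hs' n h2)
  · refine iff_of_false (fun h => ?_) (fun h => ?_)
    · exact not_onCurve_both hL hL' hdisj h (onCurve_of_reach qSep_eq hP' rfl rfl hs n h1)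
    · exact not_onCurve_both hL hL' hdisj h (onCurve_of_reach qSep_eq hP' rfl rfl hs' n h2)

/-- Here `(x, y)` is the vertex of the corner, so the segment starts at `(x, y) - 3 * d`. Coherence
is expressed at its end, whence the condition on `d.1` instead of `d.2`. -/
theorem sameReach_corner : ∀ x ∈ Finset.Icc (-7 : ℤ) 7, ∀ y ∈ Finset.Icc (-7 : ℤ) 7,
    ∀ d ∈ units, ((x + y + 0) % 2 = 0 ↔ d.1 = 0) → ¬ (x % 3 = 0 ∧ y % 3 = 0) →
      (sameReach periodicB (periodicA ++ periodicM) 10 (x - 3 * d.1) (y - 3 * d.2) d.1 d.2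
        x y (-d.2) d.1 &&
      sameReach periodicA (periodicM ++ periodicB) 10 (x - 3 * d.1) (y - 3 * d.2) d.1 d.2
        x y d.2 (-d.1)) = true := by
  decide +kernel

theorem corner_periodic (hs : Coh 0 s) (hd : ¬ qSep ∣ s.start + qSep * s.dir) :
    (OnCurve qSep periodicB s ↔ OnCurve qSep periodicB (goLeft qSep s)) ∧
      (OnCurve qSep periodicA s ↔ OnCurve qSep periodicA (goRight qSep s)) := by
  refine corner_invariant qSep_eq parentStable_periodicA parentStable_periodicB ?_ hs hd
  intro s hs hd hn
  obtain ⟨h1, h2⟩ := mem_Icc_of_norm_le (n := 7) hn (by decide) (by norm_num)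
  have hl := (coh_goLeft qSep_eq (s := s)).2 hs
  have hr := (coh_goRight qSep_eq (s := s)).2 hs
  have hc : ((s.start + qSep * s.dir).re + (s.start + qSep * s.dir).im + 0) % 2 = 0 ↔
      (s.dir : GaussianInt).re = 0 := by
    have : Coh 0 (goLeft qSep s) := hl
    simpa [Coh, goLeft, iUnit_val] using this
  have key := sameReach_corner _ h1 _ h2 _ (mem_units s.dir) hc (by rwa [qSep_dvd_iff] at hd)
  rw [Bool.and_eq_true] at key
  have e1 : (s.start + qSep * s.dir).re - 3 * (s.dir : GaussianInt).re = s.start.re := by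
    simp [qSep]
  have e2 : (s.start + qSep * s.dir).im - 3 * (s.dir : GaussianInt).im = s.start.im := by
    simp [qSep]
  rw [e1, e2] at key
  refine ⟨onCurve_iff_of_sameReach parentStable_periodicB
      (parentStable_periodicA.append parentStable_periodicM)
      (by decide +kernel) (by decide +kernel) (by decide +kernel) hs hl 10 ?_,
    onCurve_iff_of_sameReach parentStable_periodicA
      (parentStable_periodicM.append parentStable_periodicB)
      (by decide +kernel) (by decide +kernel) (by decide +kernel) hs hr 10 ?_⟩
  · convert key.1 using 1
    simp [goLeft, iUnit_val]
  · convert key.2 using 1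
    simp [goRight, iUnit_val]

end Paperfolding

namespace Paperfolding

/-! ### The dragon sequence -/

theorem length_bar (S : List ℤˣ) : (bar S).length = S.length := by simp [bar]

theorem IsFoldingSeq.length {n : ℕ} {S : List ℤˣ} (h : IsFoldingSeq n S) :
    S.length = 2 ^ n - 1 := by
  induction h with
  | zero => rfl
  | succ n S ε h ih =>
    have := Nat.one_le_two_pow (n := n)
    simp only [List.length_append, length_bar, List.length_cons, ih, pow_succ]
    omega

/-- The first `2 ^ (n + 1) - 1` terms have the form `bar S ++ ε :: S` with `ε` in position `2 ^ n`,
so reflection in that position changes signs. -/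
theorem IsInftyFoldingSeq.symm {a : ℕ → ℤˣ} (ha : IsInftyFoldingSeq a) (n j : ℕ) (h1 : 1 ≤ j)
    (h2 : j < 2 ^ n) : a (2 ^ n + j) = -a (2 ^ n - j) := by
  have h := ha (n + 1)
  generalize hL : (List.ofFn fun k : Fin (2 ^ (n + 1) - 1) => a ((k : ℕ) + 1)) = L at h
  have hget : ∀ (i : ℕ) (hi : i < L.length), L[i] = a (i + 1) := by
    subst hL; intro i hi; simp
  cases h with
  | succ _ S ε h =>
    have hl := h.length
    have e1 := hget (2 ^ n - 1 + j) (by rw [List.length_append, length_bar, List.length_cons, hl]; omega)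
    have e2 := hget (2 ^ n - 1 - j)
      (by rw [List.length_append, length_bar, List.length_cons, hl]; omega)
    rw [List.getElem_append_right (by simp [length_bar, hl])] at e1
    rw [List.getElem_append_left (by rw [length_bar, hl]; omega)] at e2
    simp only [length_bar, hl, show 2 ^ n - 1 + j - (2 ^ n - 1) = j by omega] at e1
    rw [List.getElem_cons, dif_neg (by omega)] at e1
    simp only [bar, List.getElem_reverse, List.getElem_map, List.length_map, hl] at e2
    rw [show 2 ^ n + j = 2 ^ n - 1 + j + 1 by omega, show 2 ^ n - j = 2 ^ n - 1 - j + 1 by omega,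
      ← e1, ← e2, neg_neg]
    congr 1
    omega

theorem exists_two_pow (k : ℕ) (hk : 0 < k) : ∃ n j : ℕ, k = 2 ^ n + j ∧ j < 2 ^ n := by
  refine ⟨Nat.log 2 k, k - 2 ^ Nat.log 2 k, ?_, ?_⟩
  · have := Nat.pow_log_le_self 2 hk.ne'
    omega
  · have := Nat.lt_pow_succ_log_self (b := 2) (by norm_num) k
    rw [pow_succ] at this
    omega

/-- Induction by reflection in the largest power of two not exceeding `k`. Doubling commutes with
the reflection, and the powers of two all carry `1`. -/
theorem dragon_even {a : ℕ → ℤˣ} (ha : IsInftyFoldingSeq a)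
    (ha2 : ∀ n : ℕ, a (2 ^ n) = 1) (k : ℕ) (hk : 0 < k) : a (2 * k) = a k := by
  induction k using Nat.strong_induction_on with
  | _ k ih =>
    obtain ⟨n, j, rfl, hj⟩ := exists_two_pow k hk
    rcases Nat.eq_zero_or_pos j with rfl | hj0
    · rw [add_zero, ← pow_succ', ha2, ha2]
    · have e : 2 * (2 ^ n + j) = 2 ^ (n + 1) + 2 * j := by ring
      have e' : 2 ^ (n + 1) - 2 * j = 2 * (2 ^ n - j) := by rw [pow_succ]; omega
      rw [e, ha.symm (n + 1) (2 * j) (by omega) (by rw [pow_succ]; omega),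
        ha.symm n j hj0 hj, e', ih _ (by omega) (by omega)]

theorem dragon_odd {a : ℕ → ℤˣ} (ha : IsInftyFoldingSeq a)
    (ha2 : ∀ n : ℕ, a (2 ^ n) = 1) (k : ℕ) (hk : k % 2 = 1) : a k = if k % 4 = 1 then 1 else -1 := by
  induction k using Nat.strong_induction_on with
  | _ k ih =>
    obtain ⟨n, j, rfl, hj⟩ := exists_two_pow k (by omega)
    rcases Nat.eq_zero_or_pos j with rfl | hj0
    · rw [add_zero] at hk ⊢
      rw [ha2]
      rcases n with _ | n
      · simp
      · rw [pow_succ] at hk; omega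
    · rw [ha.symm n j hj0 hj]
      rcases n with _ | _ | n
      · simp at hj; omega
      · obtain rfl : j = 1 := by simp at hj; omega
        have := ha2 0
        simp at this
        simp [this]
      · have h4 : 2 ^ (n + 1 + 1) = 4 * 2 ^ n := by ring
        rw [ih _ (by omega) (by omega)]
        split_ifs <;> first | rfl | omega

/-- The even-indexed vertices form the same curve multiplied by `1 + i`, which matches both `a (2 *
k) = a k` and the invariance of `turnAt`. At odd indices, the vertex is odd and its residue modulo
`2` depends on the index modulo `4`. -/
theorem dragon_position {a : ℕ → ℤˣ} (ha : IsInftyFoldingSeq a)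
    (ha2 : ∀ n : ℕ, a (2 ^ n) = 1)
    {w : ℕ → GaussianInt} {e : ℕ → GaussianIntˣ} (hw0 : w 0 = 0)
    (he0 : e 0 = 1) (hw : ∀ n, w (n + 1) = w n + e n)
    (he : ∀ n, e (n + 1) = iUnit ^ (a (n + 1) : ℤ) * e n) (n : ℕ) (hn : 0 < n) :
    turnAt (w n) = a n ∧ w n ≠ 0 := by
  have parity : ∀ n, (IsEv (w n) ↔ n % 2 = 0) ∧ ((e n : GaussianInt).im = 0 ↔ n % 2 = 0) := by
    intro n
    induction n with
    | zero => simp [hw0, he0, IsEv]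
    | succ n ih =>
      rw [hw, he, isEv_add, ih.1]
      have h1 : ¬ IsEv (e n : GaussianInt) := by
        simpa using isEv_odd_mul_unit 0 (e n)
      refine ⟨by rw [iff_false_right h1]; omega, ?_⟩
      have : ((iUnit ^ (a (n + 1) : ℤ) * e n : GaussianIntˣ) : GaussianInt).im = 0 ↔
          ¬ (e n : GaussianInt).im = 0 := by
        rw [← dir_re_eq_zero_iff]
        rcases iUnit_zpow_cases (a (n + 1)) with h | h <;> simp [h, iUnit_val]
      rw [this, ih.2]; omega
  have double : ∀ k, w (2 * k) = opi * w k ∧ e (2 * k) = if k % 2 = 0 then e k else iUnit * e k := by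
    intro k
    induction k with
    | zero => simp [hw0]
    | succ k ih =>
      have e1 := he (2 * k)
      have e2 := he (2 * k + 1)
      rw [dragon_odd ha ha2 (2 * k + 1) (by omega)] at e1
      rw [show 2 * k + 1 + 1 = 2 * (k + 1) by ring, dragon_even ha ha2 (k + 1) (by omega)] at e2
      have w2 : w (2 * (k + 1)) = w (2 * k) + e (2 * k) + e (2 * k + 1) := by
        rw [show 2 * (k + 1) = 2 * k + 1 + 1 by ring, hw, hw]
      rw [w2, e2, ih.1, hw k]
      by_cases hk : k % 2 = 0
      · rw [if_pos (by omega), iUnit_zpow_one, ih.2, if_pos hk] at e1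
        rw [if_neg (by omega), e1, ih.2, if_pos hk, he]
        refine ⟨?_, mul_left_comm _ _ _⟩
        rw [opi_eq, Units.val_mul]; ring
      · rw [if_neg (by omega), iUnit_zpow_neg_one, ih.2, if_neg hk, ← mul_assoc,
          neg_iUnit_mul_iUnit, one_mul] at e1
        rw [if_pos (by omega), e1, ih.2, if_neg hk, he]
        refine ⟨?_, rfl⟩
        rw [opi_eq, Units.val_mul]; ring
  induction n using Nat.strong_induction_on with
  | _ n ih =>
    rcases Nat.even_or_odd' n with ⟨k, rfl | rfl⟩
    · obtain ⟨h1, h2⟩ := ih k (by omega) (by omega)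
      rw [(double k).1, turnAt_opi_mul, h1, dragon_even ha ha2 k (by omega)]
      exact ⟨rfl, mul_ne_zero (by decide) h2⟩
    · have hodd : ¬ IsEv (w (2 * k + 1)) := by rw [(parity _).1]; omega
      refine ⟨?_, odd_ne_zero hodd⟩
      rw [turnAt_of_odd hodd, dragon_odd ha ha2 _ (by omega), hw, (double k).1]
      have h1 := (parity (2 * k)).2.2 (by omega)
      have h2 := (parity k).1
      unfold IsEv at h2
      rcases unit_val_cases (e (2 * k)) with h | h | h | h <;> rw [h] at h1 ⊢ <;>
        simp [opi] at h1 ⊢ <;> split_ifs <;> first | rfl | omega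

theorem turnAt_unit_mul (u : GaussianIntˣ) (w : GaussianInt) (hw : w ≠ 0) :
    turnAt (u * w) = if (u : GaussianInt).im = 0 then turnAt w else -turnAt w := by
  rcases unit_cases u with rfl | rfl | rfl | rfl
  · simp
  · simp [turnAt_neg]
  · simp [iUnit_val]
    rw [← iUnit_val, turnAt_i_mul w hw]
  · simp [turnAt_neg, iUnit_val]
    rw [← iUnit_val, turnAt_i_mul w hw]

/-! ### Turns of the given covering -/

theorem IsCoherent.exists_coh {𝒞 : Set CompleteCurve} (h : IsCoherent 𝒞) :
    ∃ κ : ℤ, ∀ γ ∈ 𝒞, ∀ k : ℤ, Coh κ (γ.seg k) := by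
  rcases h with h | h
  · refine ⟨0, fun γ hγ k => ?_⟩
    obtain ⟨h1, h2⟩ := h (γ.seg k).start
    rcases Int.even_or_odd ((γ.seg k).start.re + (γ.seg k).start.im) with he | ho
    · exact iff_of_true (by rw [add_zero]; exact Int.even_iff.1 he) ((h1 he γ hγ k).1 rfl)
    · refine iff_of_false (by rw [add_zero]; have := Int.odd_iff.1 ho; omega) ?_
      exact (dir_re_eq_zero_iff _).1 ((h2 ho γ hγ k).1 rfl)
  · refine ⟨1, fun γ hγ k => ?_⟩
    obtain ⟨h1, h2⟩ := h (γ.seg k).start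
    rcases Int.even_or_odd ((γ.seg k).start.re + (γ.seg k).start.im) with he | ho
    · refine iff_of_false (by have := Int.even_iff.1 he; omega) ?_
      exact (dir_re_eq_zero_iff _).1 ((h1 he γ hγ k).1 rfl)
    · exact iff_of_true (by have := Int.odd_iff.1 ho; omega) ((h2 ho γ hγ k).1 rfl)

theorem turn_unique {s s₁ : Seg} {a b : ℤˣ} (h : s.Turn s₁ a) (h' : s.Turn s₁ b) : a = b := by
  have := mul_right_cancel (h.2.symm.trans h'.2)
  rcases Int.units_eq_one_or a with rfl | rfl <;> rcases Int.units_eq_one_or b with rfl | rfl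
  · rfl
  · rw [iUnit_zpow_one, iUnit_zpow_neg_one] at this; exact absurd this (by decide +kernel)
  · rw [iUnit_zpow_one, iUnit_zpow_neg_one] at this; exact absurd this (by decide +kernel)
  · rfl

/-- Coherent segments arriving at one vertex are parallel. -/
theorem eq_or_neg_of_coh {κ : ℤ} {s s' : Seg} (h : Coh κ s) (h' : Coh κ s')
    (ht : s.terminal = s'.terminal) : s = s' ∨ s'.dir = -s.dir := by
  have h1 := (coh_adv_one κ 1 s).2 h
  have h2 := (coh_adv_one κ 1 s').2 h'
  unfold Coh at h1 h2
  rw [adv_one_start, adv_one_dir, ht] at h1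
  rw [adv_one_start, adv_one_dir] at h2
  have h3 := h1.symm.trans h2
  have key : s.dir = s'.dir ∨ s'.dir = -s.dir := by
    rcases unit_cases s.dir with e | e | e | e <;> rcases unit_cases s'.dir with e' | e' | e' | e' <;>
      rw [e, e'] at h3 <;> simp [e, e', iUnit_val] at h3 ⊢
  refine key.imp_left fun hd => ?_
  ext1
  · simpa [Seg.terminal, hd] using ht
  · exact hd

/-- If the two opposite segments arriving at a vertex turned differently, both would leave along the
same segment. So the turn is a function of the vertex. -/
theorem IsCovering.turn_eq {𝒞 : Set CompleteCurve} (hc : IsCovering 𝒞) {κ : ℤ}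
    (hκ : ∀ γ ∈ 𝒞, ∀ k : ℤ, Coh κ (γ.seg k)) {γ γ' : CompleteCurve} (hγ : γ ∈ 𝒞) (hγ' : γ' ∈ 𝒞)
    {k k' : ℤ} (ht : (γ.seg k).terminal = (γ'.seg k').terminal) {a b : ℤˣ}
    (ha : (γ.seg k).Turn (γ.seg (k + 1)) a) (hb : (γ'.seg k').Turn (γ'.seg (k' + 1)) b) :
    a = b := by
  rcases eq_or_neg_of_coh (hκ γ hγ k) (hκ γ' hγ' k') ht with e | e
  · obtain ⟨rfl, rfl⟩ := hc.unique hγ hγ' (congrArg Seg.support e)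
    exact turn_unique ha hb
  · by_contra hne
    have e2 : γ.seg (k + 1) = γ'.seg (k' + 1) := by
      ext1
      · rw [ha.1, hb.1, ht]
      · rw [ha.2, hb.2, e]
        rcases Int.units_eq_one_or a with rfl | rfl <;> rcases Int.units_eq_one_or b with rfl | rfl
        · exact absurd rfl hne
        · rw [iUnit_zpow_one, iUnit_zpow_neg_one, neg_mul_neg]
        · rw [iUnit_zpow_one, iUnit_zpow_neg_one, neg_mul, mul_neg]
        · exact absurd rfl hne
    obtain ⟨rfl, h⟩ := hc.unique hγ hγ' (congrArg Seg.support e2)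
    obtain rfl : k = k' := by omega
    rcases unit_cases (γ.seg k).dir with h | h | h | h <;> rw [h] at e <;>
      exact absurd e (by decide +kernel)

/-- The turns of a covering generated by the dragon curve. -/
theorem IsGeneratedBy.exists_obeys {a : ℕ → ℤˣ} (ha : IsInftyFoldingSeq a)
    (ha2 : ∀ n : ℕ, a (2 ^ n) = 1) {H : HalfCurve} (hH : H.AssociatedTo a)
    {𝒞 : Set CompleteCurve} (hcov : IsCovering 𝒞) (hcoh : IsCoherent 𝒞)
    (hgen : IsGeneratedBy 𝒞 H) :
    ∃ (ρ : GaussianIntˣ) (p : GaussianInt) (t : GaussianInt → ℤˣ) (κ : ℤ), Obeys 𝒞 t κ ∧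
      (∀ z, z ≠ p → t z = turnAt (ρ * (z - p))) ∧
      ∀ s, Coh κ s ↔ Coh 0 (embed ρ 1 (-(ρ * p)) s) := by
  obtain ⟨κ, hκ⟩ := hcoh.exists_coh
  set p := (H.seg 0).start with hp
  set δ := (H.seg 0).dir with hδ
  -- The rotation `ρ`, equal to `1` or `i`, makes the coherent segments leaving the origin `p`
  -- horizontal.
  obtain ⟨ρ, hρ⟩ : ∃ ρ : GaussianIntˣ, ∀ d : GaussianIntˣ,
      Coh κ ⟨p, d⟩ ↔ ((ρ * d : GaussianIntˣ) : GaussianInt).im = 0 := by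
    by_cases h : (p.re + p.im + κ) % 2 = 0
    · exact ⟨1, fun d => by simp [Coh, h]⟩
    · refine ⟨iUnit, fun d => ?_⟩
      simp [Coh, h, iUnit_val, dir_re_eq_zero_iff]
  have hκρ : ∀ s, Coh κ s ↔ Coh 0 (embed ρ 1 (-(ρ * p)) s) := by
    intro s
    rw [coh_embed (k := 0) (by ring)]
    have h1 := hρ 1
    unfold Coh at h1 ⊢
    rcases unit_val_cases ρ with h | h | h | h <;> simp [h] at h1 ⊢ <;> omega
  -- the standard position of `H`
  have key := dragon_position ha ha2
    (w := fun n => ((δ⁻¹ : GaussianIntˣ) : GaussianInt) * ((H.seg n).start - p))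
    (e := fun n => δ⁻¹ * (H.seg n).dir) (by simp [hp]) (by simp [hδ])
    (fun n => by rw [(hH n).1, Seg.terminal, Units.val_mul]; ring)
    (fun n => by rw [(hH n).2, mul_left_comm])
  have hpos : ∀ (r : GaussianIntˣ) (n : ℕ), 0 < n →
      (ρ : GaussianInt) * (((H.rotate r).seg n).start - p)
        = ((ρ * (r * δ) : GaussianIntˣ) : GaussianInt)
          * (((δ⁻¹ : GaussianIntˣ) : GaussianInt) * ((H.seg n).start - p)) := by
    intro r n hn
    have : (δ : GaussianInt) * ((δ⁻¹ : GaussianIntˣ) : GaussianInt) = 1 := Units.mul_inv _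
    simp only [HalfCurve.rotate, Seg.rotate, Units.val_mul, ← hp]
    linear_combination -ρ * r * ((H.seg n).start - p) * this
  have hdir0 : ∀ r : GaussianIntˣ, (H.rotate r).seg 0 = ⟨p, r * δ⟩ := by
    intro r
    simp [HalfCurve.rotate, Seg.rotate, ← hp, ← hδ]
  have hturn : ∀ (r : GaussianIntˣ) (n : ℕ),
      ((H.rotate r).seg n).Turn ((H.rotate r).seg (n + 1)) (a (n + 1)) := by
    intro r n
    obtain ⟨h1, h2⟩ := hH n
    constructor
    · simp only [HalfCurve.rotate, Seg.rotate, Seg.terminal, Units.val_mul] at h1 ⊢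
      rw [h1]; ring
    · simp only [HalfCurve.rotate, Seg.rotate]
      rw [h2, mul_left_comm]
  have hne : ∀ (r : GaussianIntˣ) (n : ℕ), 0 < n → ((H.rotate r).seg n).start ≠ p := by
    intro r n hn h
    have h1 := hpos r n hn
    rw [h, sub_self, mul_zero] at h1
    exact mul_ne_zero (Units.ne_zero _) (key n hn).2 h1.symm
  -- the turns outside of the origin
  have main : ∀ γ ∈ 𝒞, ∀ k : ℤ, (γ.seg k).terminal = p ∨
      (γ.seg k).Turn (γ.seg (k + 1)) (turnAt (ρ * ((γ.seg k).terminal - p))) := by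
    intro γ hγ k
    obtain ⟨r, s, k₀, hk₀⟩ := hgen.1 γ hγ
    rcases le_or_gt k₀ k with hk | hk
    -- On the forward half, coherence makes `ρ * s * δ` equal to `1` or `-1`, which does not affect
    -- `turnAt`.
    · right
      obtain ⟨n, rfl⟩ := Int.le.dest hk
      have e1 := (hk₀ n).1
      have e2 := (hk₀ (n + 1)).1
      rw [Nat.cast_add, Nat.cast_one, ← add_assoc] at e2
      have ht := hturn s n
      rw [e1, e2, ← ht.1, hpos s (n + 1) (by omega), turnAt_unit_mul _ _ (key (n + 1) (by omega)).2,
        if_pos, (key (n + 1) (by omega)).1]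
      · exact ht
      · have h0 := hκ γ hγ (k₀ + (0 : ℕ))
        rwa [(hk₀ 0).1, hdir0, hρ] at h0
    · obtain ⟨n, hn⟩ := Int.le.dest (show k + 1 ≤ k₀ by omega)
      obtain rfl : k = k₀ - 1 - n := by omega
      have e1 := (hk₀ n).2
      rcases n with _ | n
      · left
        rw [e1, hdir0]
        simp [Seg.reverse, Seg.terminal]
      -- Running backwards negates the turns. Correspondingly, coherence of the reversed segments
      -- makes `ρ * r * δ` equal to `i` or `-i`, which negates `turnAt`.
      · right
        have e2 := (hk₀ n).2
        rw [show k₀ - 1 - (n : ℤ) = k₀ - 1 - ((n + 1 : ℕ) : ℤ) + 1 by push_cast; ring] at e2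
        have ht := hturn r n
        have e3 : ((H.rotate r).seg (n + 1)).reverse.terminal
            = ((H.rotate r).seg (n + 1)).start := by
          simp [Seg.reverse, Seg.terminal]
        rw [e1, e2, e3, hpos r (n + 1) (by omega), turnAt_unit_mul _ _ (key (n + 1) (by omega)).2,
          if_neg, (key (n + 1) (by omega)).1]
        · constructor
          · rw [e3, ht.1]; rfl
          · simp only [Seg.reverse]
            rw [ht.2]
            rcases Int.units_eq_one_or (a (n + 1)) with h | h <;> rw [h]
            · rw [iUnit_zpow_one, iUnit_zpow_neg_one, neg_mul_neg, ← mul_assoc, ← pow_two]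
              rw [show iUnit ^ 2 = -1 by decide +kernel, neg_one_mul]
            · rw [neg_neg, iUnit_zpow_one, iUnit_zpow_neg_one, neg_mul, neg_neg, ← mul_assoc,
                ← pow_two, show iUnit ^ 2 = -1 by decide +kernel, neg_one_mul]
        · have h0 := hκ γ hγ (k₀ - 1 - (0 : ℕ))
          rw [(hk₀ 0).2, coh_reverse, hdir0, hρ] at h0
          exact h0
  -- The folding sequence does not determine the turn at the origin, but it is common to all curves
  -- passing there.
  obtain ⟨θ, hθ⟩ : ∃ θ : ℤˣ, ∀ γ ∈ 𝒞, ∀ k : ℤ, (γ.seg k).terminal = p →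
      (γ.seg k).Turn (γ.seg (k + 1)) θ := by
    by_cases h : ∃ γ ∈ 𝒞, ∃ k : ℤ, (γ.seg k).terminal = p
    · obtain ⟨γ, hγ, k, hk⟩ := h
      obtain ⟨θ, hθ⟩ := γ.follows k
      refine ⟨θ, fun γ' hγ' k' hk' => ?_⟩
      obtain ⟨θ', hθ'⟩ := γ'.follows k'
      rwa [hcov.turn_eq hκ hγ hγ' (hk.trans hk'.symm) hθ hθ']
    · exact ⟨1, fun γ hγ k hk => absurd ⟨γ, hγ, k, hk⟩ h⟩
  classical
  refine ⟨ρ, p, fun z => if z = p then θ else turnAt (ρ * (z - p)), κ, fun γ hγ k => ⟨hκ γ hγ k, ?_⟩,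
    fun z hz => if_neg hz, hκρ⟩
  rw [← turn_iff_adv]
  split_ifs with h
  · exact hθ γ hγ k h
  · exact (main γ hγ k).resolve_left h

/-! ### Local isomorphism -/

theorem exists_uniform_turnAt_add {W : Set GaussianInt} (hW : W.Finite) :
    ∃ N : ℕ, ∀ w ∈ W, w ≠ 0 → ∀ h : GaussianInt, opi ^ N ∣ h →
      w + h ≠ 0 ∧ turnAt (w + h) = turnAt w := by
  induction W, hW using Set.Finite.induction_on with
  | empty => exact ⟨0, by simp⟩
  | @insert w W _ _ ih =>
    obtain ⟨N, hN⟩ := ih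
    by_cases hw : w = 0
    · refine ⟨N, ?_⟩
      rintro w' (rfl | hw') h0
      · exact absurd hw h0
      · exact hN w' hw' h0
    · obtain ⟨M, hM⟩ := turnAt_add w hw
      refine ⟨max N M, ?_⟩
      rintro w' (rfl | hw') h0 h hd
      · exact hM h ((pow_dvd_pow _ (le_max_right _ _)).trans hd)
      · exact hN w' hw' h0 h ((pow_dvd_pow _ (le_max_left _ _)).trans hd)

/-- Near `0` the turn takes both values at every scale, with `ε = 1` or `ε = i` as leading odd part.
This reproduces whatever turn occurs at the origin of the given covering. -/
theorem exists_turnAt_eq (θ : ℤˣ) : ∃ ε : GaussianInt, ∀ (N : ℕ) (v : GaussianInt),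
    turnAt (opi ^ N * (ε + opi ^ 2 * v)) = θ := by
  have key : ∀ (N : ℕ) (w : GaussianInt), turnAt (opi ^ N * w) = turnAt w := by
    intro N w
    induction N with
    | zero => simp
    | succ N ih => rw [pow_succ', mul_assoc, turnAt_opi_mul, ih]
  rcases Int.units_eq_one_or θ with rfl | rfl
  · refine ⟨1, fun N v => ?_⟩
    rw [key, turnAt_of_odd (by simp [IsEv, opi, pow_two]), if_neg]
    simp [opi, pow_two]
  · refine ⟨iUnit, fun N v => ?_⟩
    rw [key, turnAt_of_odd (by simp [IsEv, opi, pow_two, iUnit_val]; omega), if_pos]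
    simp [opi, pow_two, iUnit_val]

theorem coh_zero_congr {w w' : GaussianInt} (d : GaussianIntˣ) (h : IsEv w ↔ IsEv w') :
    Coh 0 ⟨w, d⟩ ↔ Coh 0 ⟨w', d⟩ := by
  rw [coh_zero_iff, coh_zero_iff]; simp only [h]

theorem isEv_odd_mul (k w : GaussianInt) : IsEv ((1 + 2 * k) * w) ↔ IsEv w := by
  simp [IsEv]; ring_nf; omega

/-- Each finite window of turns of one covering is found in the other by approximating a `(1 +
i)`-adic translation by a Gaussian integer. The congruences are solvable because `q` is coprime to
`1 + i`. -/
theorem locallyIsomorphic_of_obeys {𝒞 𝒟 : Set CompleteCurve} (h𝒞 : IsCovering 𝒞)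
    (h𝒟 : IsCovering 𝒟) {ρ : GaussianIntˣ} {p : GaussianInt} {t : GaussianInt → ℤˣ} {κ κ' : ℤ}
    (hobey : Obeys 𝒞 t κ) (ht : ∀ z, z ≠ p → t z = turnAt (ρ * (z - p)))
    (hκ : ∀ s, Coh κ s ↔ Coh 0 (embed ρ 1 (-(ρ * p)) s)) {k q b : GaussianInt}
    (hq : q = 1 + 2 * k) (hb : ¬ q ∣ b)
    (hobey' : Obeys 𝒟 (fun z => turnAt (ρ * q * z + b)) κ')
    (hκ' : ∀ s, Coh κ' s ↔ Coh 0 (embed ρ q b s)) : LocallyIsomorphic 𝒞 𝒟 := by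
  have hev : ∀ {N : ℕ} {h : GaussianInt}, opi ^ (N + 1) ∣ h → IsEv h := fun hd =>
    opi_dvd_iff.1 ((dvd_pow_self _ (Nat.succ_ne_zero _)).trans hd)
  intro ℬ hℬ
  constructor
  · refine Occurs.of_windows hℬ.1 h𝒟 hobey hobey' fun W hW => ?_
    obtain ⟨N, hN⟩ := exists_uniform_turnAt_add (hW.image fun z => (ρ : GaussianInt) * q * (z - p))
    obtain ⟨ε, hε⟩ := exists_turnAt_eq (t p)
    -- The exponent `N + 3` leaves `ε` known modulo `(1 + i) ^ 2` after division by `(1 + i) ^ (N +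
    -- 1)`. The shift keeps the turns at points other than `p`, gives `p` the turn `t p`, and is
    -- even, so that coherence is preserved.
    obtain ⟨u, v, hu⟩ := exists_congr k ρ (N + 3) (opi ^ (N + 1) * ε - b - ρ * q * p)
    have e : ∀ z, (ρ : GaussianInt) * q * (u + z) + b
        = ρ * q * (z - p) + opi ^ (N + 1) * (ε + opi ^ 2 * v) := by
      intro z
      rw [← hq] at hu
      linear_combination hu
    refine ⟨u, fun s => ?_, fun z hz => ?_⟩
    · rw [hκ, hκ', embed, embed]
      apply coh_zero_congr
      simp only [Seg.translate]
      rw [e, isEv_add, iff_true_right (hev (dvd_mul_right _ _)), mul_right_comm, hq,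
        mul_comm _ (1 + 2 * k), isEv_odd_mul]
      rw [show (ρ : GaussianInt) * 1 * s.start + -(ρ * p) = ρ * (s.start - p) by ring]
    · simp only [e]
      by_cases hzp : z = p
      · rw [hzp, sub_self, mul_zero, zero_add, hε]
      · have hne : (ρ : GaussianInt) * q * (z - p) ≠ 0 :=
          mul_ne_zero (mul_ne_zero ρ.ne_zero (odd_ne_zero' hq)) (sub_ne_zero.2 hzp)
        have h2 := (hN _ ⟨z, hz, rfl⟩ hne (opi ^ (N + 1) * (ε + opi ^ 2 * v))
          (by rw [pow_succ, mul_assoc]; exact dvd_mul_right _ _)).2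
        rw [h2]
        simp only
        rw [ht z hzp, mul_right_comm, hq, mul_comm _ (1 + 2 * k), turnAt_mul]
  · refine Occurs.of_windows hℬ.1 h𝒞 hobey' hobey fun W hW => ?_
    obtain ⟨N, hN⟩ := exists_uniform_turnAt_add (hW.image fun z => (ρ : GaussianInt) * q * z + b)
    -- No prescribed turn at a singular point is needed here, since `ρ * q * z + b` never vanishes.
    -- The exponent `N + 1` again makes the shift even.
    obtain ⟨u, hu⟩ := exists_congr k ρ (N + 1) (b + ρ * q * p)
    have e : ∀ z, q * ((ρ : GaussianInt) * (u + z - p))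
        = ρ * q * z + b + (ρ * (1 + 2 * k) * u - (b + ρ * q * p)) := by
      intro z; rw [← hq]; ring
    refine ⟨u, fun s => ?_, fun z hz => ?_⟩
    · rw [hκ, hκ', embed, embed]
      apply coh_zero_congr
      simp only [Seg.translate]
      rw [show (ρ : GaussianInt) * 1 * (u + s.start) + -(ρ * p) = ρ * (u + s.start - p) by ring,
        ← isEv_odd_mul k, ← hq, e, isEv_add, iff_true_right (hev hu)]
    · have hne : (ρ : GaussianInt) * q * z + b ≠ 0 := by
        intro h0
        exact hb ⟨-(ρ * z), by linear_combination h0⟩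
      obtain ⟨h1, h2⟩ := hN _ ⟨z, hz, rfl⟩ hne _ ((pow_dvd_pow _ (Nat.le_succ N)).trans hu)
      rw [← e] at h1 h2
      rw [ht _ (fun h => h1 (by rw [h, sub_self, mul_zero, mul_zero])), ← turnAt_mul k, ← hq, h2]

end Paperfolding

namespace Paperfolding

/-! ### The tiles of the plane which are bounded by rounded corners -/

/-- The closed square with center `g / 2` and vertices `(g ± 1) / 2`, `(g ± i) / 2`. -/
def tile (g : GaussianInt) : Set ℂ := {p | |2 * p.re - g.re| + |2 * p.im - g.im| ≤ 1}

theorem mem_tile {g : GaussianInt} {p : ℂ} :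
    p ∈ tile g ↔ |2 * p.re - g.re| + |2 * p.im - g.im| ≤ 1 := Iff.rfl

/-- The tile around the vertex `z`. -/
def vertexTile (z : GaussianInt) : Set ℂ := tile (2 * z)

/-- The tile in the middle of the unit square with lower left vertex `w`. -/
def faceTile (w : GaussianInt) : Set ℂ := tile (2 * w + ⟨1, 1⟩)

theorem mem_vertexTile {z : GaussianInt} {p : ℂ} :
    p ∈ vertexTile z ↔ |2 * p.re - 2 * z.re| + |2 * p.im - 2 * z.im| ≤ 1 := by
  simp [vertexTile, mem_tile]

theorem mem_faceTile {w : GaussianInt} {p : ℂ} :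
    p ∈ faceTile w ↔ |2 * p.re - (2 * w.re + 1)| + |2 * p.im - (2 * w.im + 1)| ≤ 1 := by
  simp [faceTile, mem_tile]

/-- After doubling coordinates, the union is the sum of a closed set of integer points and a compact
diamond. -/
theorem isClosed_biUnion_tile (C : Set GaussianInt) : IsClosed (⋃ g ∈ C, tile g) := by
  have h1 : IsClosed (Prod.map ((↑) : ℤ → ℝ) ((↑) : ℤ → ℝ) '' {g | (⟨g.1, g.2⟩ : GaussianInt) ∈ C}) :=
    (Int.isClosedEmbedding_coe_real.prodMap Int.isClosedEmbedding_coe_real).isClosedMap _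
      (isClosed_discrete _)
  have h2 : IsCompact {v : ℝ × ℝ | |v.1| + |v.2| ≤ 1} := by
    refine (isCompact_Icc (a := ((-1, -1) : ℝ × ℝ)) (b := (1, 1))).of_isClosed_subset
      (isClosed_le (by fun_prop) (by fun_prop)) fun v hv => ?_
    have hv' : |v.1| + |v.2| ≤ 1 := hv
    have := abs_le.1 (show |v.1| ≤ 1 by linarith [abs_nonneg v.2])
    have := abs_le.1 (show |v.2| ≤ 1 by linarith [abs_nonneg v.1])
    exact ⟨⟨by tauto, by tauto⟩, ⟨by tauto, by tauto⟩⟩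
  have h3 : Continuous fun p : ℂ => ((2 * p.re, 2 * p.im) : ℝ × ℝ) := by fun_prop
  convert (h1.add_right_of_isCompact h2).preimage h3 using 1
  ext p
  simp only [Set.mem_iUnion, Set.mem_preimage, Set.mem_add, exists_prop]
  constructor
  · rintro ⟨g, hg, hp⟩
    exact ⟨_, ⟨(g.re, g.im), hg, rfl⟩, (2 * p.re - g.re, 2 * p.im - g.im), hp, by simp⟩
  · rintro ⟨_, ⟨g, hg, rfl⟩, v, hv, h⟩
    refine ⟨⟨g.1, g.2⟩, hg, ?_⟩
    have e1 : v.1 = 2 * p.re - g.1 := eq_sub_of_add_eq' (congrArg Prod.fst h)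
    have e2 : v.2 = 2 * p.im - g.2 := eq_sub_of_add_eq' (congrArg Prod.snd h)
    have hv' : |v.1| + |v.2| ≤ 1 := hv
    rw [e1, e2] at hv'
    exact hv'

theorem exists_mem_tile (p : ℂ) : (∃ z, p ∈ vertexTile z) ∨ ∃ w, p ∈ faceTile w := by
  -- In the coordinates `re + im` and `re - im`, the tiles are unit squares centred at integer
  -- points: rounding selects one, and the parity of `u + v` decides between a vertex and a face.
  set u := ⌊p.re + p.im + 1 / 2⌋ with hu
  set v := ⌊p.re - p.im + 1 / 2⌋ with hv
  have h1 := Int.floor_le (p.re + p.im + 1 / 2)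
  have h2 := Int.lt_floor_add_one (p.re + p.im + 1 / 2)
  have h3 := Int.floor_le (p.re - p.im + 1 / 2)
  have h4 := Int.lt_floor_add_one (p.re - p.im + 1 / 2)
  rw [← hu] at h1 h2
  rw [← hv] at h3 h4
  have key : |2 * p.re - (u + v)| + |2 * p.im - (u - v)| ≤ 1 := by
    rcases abs_cases (2 * p.re - (u + v)) with ⟨e, -⟩ | ⟨e, -⟩ <;>
      rcases abs_cases (2 * p.im - (u - v)) with ⟨e', -⟩ | ⟨e', -⟩ <;> rw [e, e'] <;> linarith
  rcases Int.even_or_odd' (u + v) with ⟨c, hc | hc⟩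
  · refine Or.inl ⟨⟨c, c - v⟩, ?_⟩
    have hc' : (u : ℝ) + v = 2 * c := by exact_mod_cast hc
    rw [mem_vertexTile]
    convert key using 3
    · rw [hc']
    · push_cast; linarith
  · refine Or.inr ⟨⟨c, c - v⟩, ?_⟩
    have hc' : (u : ℝ) + v = 2 * c + 1 := by exact_mod_cast hc
    rw [mem_faceTile]
    convert key using 3
    · rw [hc']
    · push_cast; linarith

theorem mem_tile_iff {g : GaussianInt} {p : ℂ} : p ∈ tile g ↔
    ((2 * p.re - g.re) + (2 * p.im - g.im) ≤ 1 ∧ (2 * p.re - g.re) - (2 * p.im - g.im) ≤ 1) ∧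
      (-(2 * p.re - g.re) + (2 * p.im - g.im) ≤ 1 ∧
        -(2 * p.re - g.re) - (2 * p.im - g.im) ≤ 1) := by
  rw [mem_tile]
  constructor
  · intro h
    have h1 := abs_le.1 (le_refl |2 * p.re - g.re|)
    have h2 := abs_le.1 (le_refl |2 * p.im - g.im|)
    constructor <;> constructor <;> linarith
  · rintro ⟨⟨h1, h2⟩, h3, h4⟩
    rcases abs_cases (2 * p.re - g.re) with ⟨e, -⟩ | ⟨e, -⟩ <;>
      rcases abs_cases (2 * p.im - g.im) with ⟨e', -⟩ | ⟨e', -⟩ <;> rw [e, e'] <;> linarith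

theorem sub_mem_of_mem_tile {g g' : GaussianInt} {p : ℂ} (h : p ∈ tile g) (h' : p ∈ tile g') :
    ((g'.re - g.re) + (g'.im - g.im) ≤ 2 ∧ (g'.re - g.re) - (g'.im - g.im) ≤ 2) ∧
      (-(g'.re - g.re) + (g'.im - g.im) ≤ 2 ∧ -(g'.re - g.re) - (g'.im - g.im) ≤ 2) := by
  rw [mem_tile_iff] at h h'
  obtain ⟨⟨h1, h2⟩, h3, h4⟩ := h
  obtain ⟨⟨h1', h2'⟩, h3', h4'⟩ := h'
  refine ⟨⟨?_, ?_⟩, ?_, ?_⟩ <;> rw [← Int.cast_le (R := ℝ)] <;> push_cast <;> linarith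

theorem add_two_mul (g h : GaussianInt) :
    g + 2 * h = ⟨g.re + 2 * h.re, g.im + 2 * h.im⟩ := by
  ext <;> simp

theorem add_opi_mul (g h : GaussianInt) :
    g + opi * h = ⟨g.re + h.re - h.im, g.im + h.re + h.im⟩ := by
  ext <;> simp [opi] <;> ring

/-- A common point of two tiles of the same kind is a vertex of both of them. -/
theorem eq_add_unit_of_mem_tile {g h : GaussianInt} {p : ℂ} (hp : p ∈ tile g)
    (hp' : p ∈ tile (g + 2 * h)) (h0 : h ≠ 0) : ∃ η : GaussianIntˣ, h = η ∧
      2 * p.re = g.re + (η : GaussianInt).re ∧ 2 * p.im = g.im + (η : GaussianInt).im := by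
  have h1 := sub_mem_of_mem_tile hp hp'
  obtain ⟨η, rfl⟩ : ∃ η : GaussianIntˣ, h = η := by
    have h2 : ¬ (h.re = 0 ∧ h.im = 0) := fun e => h0 (Zsqrtd.ext e.1 e.2)
    rw [add_two_mul] at h1
    dsimp only at h1
    have : (h.re = 1 ∧ h.im = 0) ∨ (h.re = -1 ∧ h.im = 0) ∨ (h.re = 0 ∧ h.im = 1) ∨
        (h.re = 0 ∧ h.im = -1) := by omega
    rcases this with e | e | e | e
    · exact ⟨1, Zsqrtd.ext e.1 e.2⟩
    · exact ⟨-1, Zsqrtd.ext e.1 e.2⟩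
    · exact ⟨iUnit, Zsqrtd.ext e.1 e.2⟩
    · exact ⟨-iUnit, Zsqrtd.ext e.1 e.2⟩
  refine ⟨η, rfl, ?_⟩
  rw [mem_tile_iff] at hp
  rw [add_two_mul, mem_tile_iff] at hp'
  obtain ⟨⟨h1, h2⟩, h3, h4⟩ := hp
  obtain ⟨⟨h1', h2'⟩, h3', h4'⟩ := hp'
  rcases unit_val_cases η with e | e | e | e <;> rw [e] at h1' h2' h3' h4' ⊢ <;>
    push_cast at h1' h2' h3' h4' ⊢ <;> constructor <;> linarith

theorem mem_tile_add_opi_mul {g : GaussianInt} {η : GaussianIntˣ} {p : ℂ}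
    (hre : 2 * p.re = g.re + (η : GaussianInt).re) (him : 2 * p.im = g.im + (η : GaussianInt).im) :
    p ∈ tile (g + opi * η) := by
  rw [add_opi_mul, mem_tile_iff]
  rcases unit_val_cases η with e | e | e | e <;> rw [e] at hre him ⊢ <;>
    push_cast at hre him ⊢ <;> rw [hre, him] <;> norm_num

/-- Two vertex tiles meet only at a corner, the midpoint of an edge, where face tiles also meet. -/
theorem exists_mem_faceTile {z z' : GaussianInt} {p : ℂ} (h : p ∈ vertexTile z)
    (h' : p ∈ vertexTile z') (hne : z ≠ z') : ∃ w, p ∈ faceTile w := by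
  have h' : p ∈ tile (2 * z + 2 * (z' - z)) := by rw [← mul_add, add_sub_cancel]; exact h'
  obtain ⟨η, -, hre, him⟩ := eq_add_unit_of_mem_tile h h' (sub_ne_zero.2 hne.symm)
  have := mem_tile_add_opi_mul hre him
  obtain ⟨w, hw⟩ : ∃ w, 2 * z + opi * η = 2 * w + ⟨1, 1⟩ := by
    rcases unit_cases η with rfl | rfl | rfl | rfl
    · exact ⟨z + 0, by rw [mul_add, add_assoc]; congr 1⟩
    · exact ⟨z + ⟨-1, -1⟩, by rw [mul_add, add_assoc]; congr 1⟩
    · exact ⟨z + ⟨-1, 0⟩, by rw [mul_add, add_assoc]; congr 1⟩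
    · exact ⟨z + ⟨0, -1⟩, by rw [mul_add, add_assoc]; congr 1⟩
  exact ⟨w, by rw [faceTile, ← hw]; exact this⟩

theorem exists_mem_vertexTile {w w' : GaussianInt} {p : ℂ} (h : p ∈ faceTile w)
    (h' : p ∈ faceTile w') (hne : w ≠ w') : ∃ z, p ∈ vertexTile z := by
  have h' : p ∈ tile (2 * w + ⟨1, 1⟩ + 2 * (w' - w)) := by
    rw [add_right_comm, ← mul_add, add_sub_cancel]; exact h'
  obtain ⟨η, -, hre, him⟩ := eq_add_unit_of_mem_tile h h' (sub_ne_zero.2 hne.symm)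
  have := mem_tile_add_opi_mul hre him
  obtain ⟨z, hz⟩ : ∃ z, 2 * w + ⟨1, 1⟩ + opi * η = 2 * z := by
    rcases unit_cases η with rfl | rfl | rfl | rfl
    · exact ⟨w + ⟨1, 1⟩, by rw [mul_add, add_assoc]; congr 1⟩
    · exact ⟨w + 0, by rw [mul_add, add_assoc]; congr 1⟩
    · exact ⟨w + ⟨0, 1⟩, by rw [mul_add, add_assoc]; congr 1⟩
    · exact ⟨w + ⟨1, 0⟩, by rw [mul_add, add_assoc]; congr 1⟩
  exact ⟨z, by rw [vertexTile, ← hz]; exact this⟩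

/-- Tiles of different kinds which have a common point are adjacent. -/
theorem exists_unit_of_mem_tile {z w : GaussianInt} {p : ℂ} (h : p ∈ vertexTile z)
    (h' : p ∈ faceTile w) : ∃ η : GaussianIntˣ, 2 * w + ⟨1, 1⟩ = 2 * z + opi * η := by
  have h1 := sub_mem_of_mem_tile h h'
  simp only [Zsqrtd.re_add, Zsqrtd.im_add, Zsqrtd.re_mul, Zsqrtd.im_mul, Zsqrtd.re_ofNat,
    Zsqrtd.im_ofNat, Nat.cast_ofNat, mul_zero, zero_mul, add_zero] at h1
  have : (w.re = z.re ∧ w.im = z.im) ∨ (w.re = z.re - 1 ∧ w.im = z.im - 1) ∨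
      (w.re = z.re - 1 ∧ w.im = z.im) ∨ (w.re = z.re ∧ w.im = z.im - 1) := by omega
  rcases this with e | e | e | e
  · exact ⟨1, by ext <;> simp [opi, e.1, e.2]⟩
  · exact ⟨-1, by ext <;> simp [opi, e.1, e.2] <;> ring⟩
  · exact ⟨iUnit, by ext <;> simp [opi, e.1, e.2, iUnit_val]; ring⟩
  · exact ⟨-iUnit, by ext <;> simp [opi, e.1, e.2, iUnit_val]; ring⟩

end Paperfolding

/-! ### Rounded corners as sides of tiles -/

namespace Paperfolding

variable {t : GaussianInt → ℤˣ} {κ : ℤ} {s s' : Seg} {A B : Seg → Prop}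

theorem two_mul_mid_re (s : Seg) :
    2 * s.mid.re = 2 * s.start.re + (s.dir : GaussianInt).re := by
  simp [Seg.mid, mul_add]
  ring

theorem two_mul_mid_im (s : Seg) :
    2 * s.mid.im = 2 * s.start.im + (s.dir : GaussianInt).im := by
  simp [Seg.mid, mul_add]
  ring

theorem terminal_re (s : Seg) : s.terminal.re = s.start.re + (s.dir : GaussianInt).re := by
  simp [Seg.terminal]

theorem terminal_im (s : Seg) : s.terminal.im = s.start.im + (s.dir : GaussianInt).im := by
  simp [Seg.terminal]

/-- The common side of two adjacent tiles. -/
theorem mem_segment_of_mem_tile {z w : GaussianInt} {η : GaussianIntˣ} {p P Q : ℂ}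
    (h : p ∈ vertexTile z) (h' : p ∈ faceTile w) (hw : 2 * w + ⟨1, 1⟩ = 2 * z + opi * η)
    (h1 : 2 * P.re = 2 * z.re + (η : GaussianInt).re)
    (h2 : 2 * P.im = 2 * z.im + (η : GaussianInt).im)
    (h3 : 2 * Q.re = 2 * z.re - (η : GaussianInt).im)
    (h4 : 2 * Q.im = 2 * z.im + (η : GaussianInt).re) : p ∈ segment ℝ P Q := by
  have h' : p ∈ tile (2 * z + opi * η) := by rw [← hw]; exact h'
  rw [add_opi_mul, mem_tile_iff] at h'
  replace h : p ∈ tile (2 * z) := h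
  rw [mem_tile_iff] at h
  obtain ⟨⟨a1, a2⟩, a3, a4⟩ := h
  obtain ⟨⟨b1, b2⟩, b3, b4⟩ := h'
  have e1 : (2 * z).re = 2 * z.re := by simp
  have e2 : (2 * z).im = 2 * z.im := by simp
  dsimp only at b1 b2 b3 b4
  simp only [e1, e2] at a1 a2 a3 a4 b1 b2 b3 b4
  push_cast at a1 a2 a3 a4 b1 b2 b3 b4
  obtain ⟨α, β, hα, hβ, hαβ, e3, e4⟩ : ∃ α β : ℝ, 0 ≤ α ∧ 0 ≤ β ∧ α + β = 1 ∧
      2 * p.re = 2 * z.re + (α * (η : GaussianInt).re - β * (η : GaussianInt).im) ∧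
      2 * p.im = 2 * z.im + (α * (η : GaussianInt).im + β * (η : GaussianInt).re) := by
    rcases unit_val_cases η with e | e | e | e <;> rw [e] at b1 b2 b3 b4 ⊢ <;>
      push_cast at b1 b2 b3 b4 ⊢
    · exact ⟨2 * p.re - 2 * z.re, 2 * p.im - 2 * z.im, by linarith, by linarith, by linarith,
        by linarith, by linarith⟩
    · exact ⟨-(2 * p.re - 2 * z.re), -(2 * p.im - 2 * z.im), by linarith, by linarith, by linarith,
        by linarith, by linarith⟩
    · exact ⟨2 * p.im - 2 * z.im, -(2 * p.re - 2 * z.re), by linarith, by linarith, by linarith,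
        by linarith, by linarith⟩
    · exact ⟨-(2 * p.im - 2 * z.im), 2 * p.re - 2 * z.re, by linarith, by linarith, by linarith,
        by linarith, by linarith⟩
  obtain rfl : β = 1 - α := by linarith
  refine ⟨α, 1 - α, hα, hβ, hαβ, Complex.ext ?_ ?_⟩ <;>
    simp only [Complex.add_re, Complex.add_im, Complex.real_smul, Complex.mul_re, Complex.mul_im,
      Complex.ofReal_re, Complex.ofReal_im]
  · linear_combination α / 2 * h1 + (1 - α) / 2 * h3 - e3 / 2
  · linear_combination α / 2 * h2 + (1 - α) / 2 * h4 - e4 / 2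

theorem exists_of_mem_strand {p : ℂ} (h : p ∈ segment ℝ s.mid (adv 1 t s).mid) :
    ∃ α β : ℝ, 0 ≤ α ∧ 0 ≤ β ∧ α + β = 1 ∧
      2 * p.re = 2 * s.terminal.re
        + (β * ((adv 1 t s).dir : GaussianInt).re - α * (s.dir : GaussianInt).re) ∧
      2 * p.im = 2 * s.terminal.im
        + (β * ((adv 1 t s).dir : GaussianInt).im - α * (s.dir : GaussianInt).im) := by
  obtain ⟨α, β, hα, hβ, hαβ, rfl⟩ := h
  refine ⟨α, β, hα, hβ, hαβ, ?_, ?_⟩ <;>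
    simp only [Complex.add_re, Complex.add_im, Complex.real_smul, Complex.mul_re, Complex.mul_im,
      Complex.ofReal_re, Complex.ofReal_im]
  · have h1 := two_mul_mid_re s
    have h2 := two_mul_mid_re (adv 1 t s)
    rw [adv_one_start] at h2
    have h3 := congrArg (Int.cast : ℤ → ℝ) (terminal_re s)
    push_cast at h3
    linear_combination α * h1 + β * h2 + 2 * s.terminal.re * hαβ - 2 * α * h3
  · have h1 := two_mul_mid_im s
    have h2 := two_mul_mid_im (adv 1 t s)
    rw [adv_one_start] at h2
    have h3 := congrArg (Int.cast : ℤ → ℝ) (terminal_im s)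
    push_cast at h3
    linear_combination α * h1 + β * h2 + 2 * s.terminal.im * hαβ - 2 * α * h3

theorem adv_one_dir_cases (t : GaussianInt → ℤˣ) (s : Seg) :
    (((adv 1 t s).dir : GaussianInt).re = -(s.dir : GaussianInt).im ∧
      ((adv 1 t s).dir : GaussianInt).im = (s.dir : GaussianInt).re) ∨
    (((adv 1 t s).dir : GaussianInt).re = (s.dir : GaussianInt).im ∧
      ((adv 1 t s).dir : GaussianInt).im = -(s.dir : GaussianInt).re) := by
  rw [adv_one_dir]
  rcases iUnit_zpow_cases (t s.terminal) with e | e <;> rw [e]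
  · left; simp [iUnit_val]
  · right; simp [iUnit_val]

theorem mem_vertexTile_of_mem_strand {p : ℂ} (h : p ∈ segment ℝ s.mid (adv 1 t s).mid) :
    p ∈ vertexTile s.terminal := by
  obtain ⟨α, β, hα, hβ, hαβ, h1, h2⟩ := exists_of_mem_strand h
  rw [mem_vertexTile, h1, h2, add_sub_cancel_left, add_sub_cancel_left]
  rcases adv_one_dir_cases t s with ⟨e1, e2⟩ | ⟨e1, e2⟩ <;> rw [e1, e2] <;>
  rcases unit_val_cases s.dir with e | e | e | e <;> rw [e] <;>
  simp [abs_of_nonneg hα, abs_of_nonneg hβ, hαβ, add_comm β]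

theorem eq_of_mid_eq (hs : Coh κ s) (hs' : Coh κ s') (h : s.mid = s'.mid) : s = s' := by
  apply hs.eq_of_support hs'
  rw [support_eq_iff]
  have h1 := two_mul_mid_re s
  have h2 := two_mul_mid_im s
  rw [h, two_mul_mid_re] at h1
  rw [h, two_mul_mid_im] at h2
  norm_cast at h1 h2
  have key : s.dir = s'.dir ∨ s.dir = -s'.dir := by
    rcases unit_cases s.dir with e | e | e | e <;> rcases unit_cases s'.dir with e' | e' | e' | e' <;>
      rw [e, e'] at h1 h2 ⊢ <;> simp [iUnit_val] at h1 h2 ⊢ <;> omega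
  rcases key with e | e
  · left
    rw [e] at h1 h2
    exact Seg.ext (Zsqrtd.ext (by omega) (by omega)) e
  · right
    rw [e, Units.val_neg] at h1 h2
    simp only [Zsqrtd.re_neg, Zsqrtd.im_neg] at h1 h2
    refine Seg.ext (Zsqrtd.ext ?_ ?_) e
    · rw [Seg.reverse, terminal_re]; omega
    · rw [Seg.reverse, terminal_im]; omega

/-- A point of a rounded corner which lies on an edge is an endpoint of the corner. -/
theorem eq_mid_of_mem_strand {p : ℂ} {η : GaussianIntˣ}
    (h : p ∈ segment ℝ s.mid (adv 1 t s).mid)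
    (hre : 2 * p.re = 2 * s.terminal.re + (η : GaussianInt).re)
    (him : 2 * p.im = 2 * s.terminal.im + (η : GaussianInt).im) :
    p = s.mid ∨ p = (adv 1 t s).mid := by
  obtain ⟨α, β, hα, hβ, hαβ, h1, h2⟩ := exists_of_mem_strand h
  have h3 := hre.symm.trans h1
  have h4 := him.symm.trans h2
  rw [add_right_inj] at h3 h4
  have key : α = 1 ∨ β = 1 := by
    rcases adv_one_dir_cases t s with ⟨e1, e2⟩ | ⟨e1, e2⟩ <;> rw [e1] at h3 <;> rw [e2] at h4 <;>
    rcases unit_val_cases s.dir with e | e | e | e <;> rw [e] at h3 h4 <;>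
    rcases unit_val_cases η with e' | e' | e' | e' <;> rw [e'] at h3 h4 <;>
    push_cast at h3 h4 <;>
    first
    | exact Or.inl (by linarith)
    | exact Or.inr (by linarith)
  have h5 := two_mul_mid_re s
  have h6 := two_mul_mid_im s
  have h7 := two_mul_mid_re (adv 1 t s)
  have h8 := two_mul_mid_im (adv 1 t s)
  rw [adv_one_start] at h7 h8
  have h9 := congrArg (Int.cast : ℤ → ℝ) (terminal_re s)
  have h10 := congrArg (Int.cast : ℤ → ℝ) (terminal_im s)
  push_cast at h9 h10
  rcases key with rfl | rfl
  · obtain rfl : β = 0 := by linarith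
    exact Or.inl (Complex.ext (by linarith) (by linarith))
  · obtain rfl : α = 0 := by linarith
    exact Or.inr (Complex.ext (by linarith) (by linarith))

theorem adv_one_dir_neg (h : s.terminal = s'.terminal) (hd : s'.dir = -s.dir) :
    (adv 1 t s').dir = -(adv 1 t s).dir := by
  rw [adv_one_dir, adv_one_dir, hd, h, mul_neg]

/-- Rounded corners which meet are equal or consecutive. -/
theorem sameCycle_of_mem_strand {p : ℂ} (hs : Coh κ s) (hs' : Coh κ s')
    (h : p ∈ segment ℝ s.mid (adv 1 t s).mid) (h' : p ∈ segment ℝ s'.mid (adv 1 t s').mid) :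
    (adv 1 t).SameCycle s s' := by
  have ha := (coh_adv_one κ t s).2 hs
  have ha' := (coh_adv_one κ t s').2 hs'
  have c1 : (adv 1 t).SameCycle s (adv 1 t s) := ⟨1, by simp⟩
  have c2 : (adv 1 t).SameCycle s' (adv 1 t s') := ⟨1, by simp⟩
  by_cases hz : s.terminal = s'.terminal
  · rcases eq_or_neg_of_coh hs hs' hz with rfl | hd
    · exact Equiv.Perm.SameCycle.refl _ _
    -- The two rounded corners at a vertex are opposite sides of its tile, hence disjoint.
    exfalso
    have he := adv_one_dir_neg (t := t) hz hd
    obtain ⟨α, β, hα, hβ, hαβ, h1, h2⟩ := exists_of_mem_strand h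
    obtain ⟨α', β', hα', hβ', hαβ', h1', h2'⟩ := exists_of_mem_strand h'
    rw [← hz, he, hd] at h1' h2'
    have h3 := h1.symm.trans h1'
    have h4 := h2.symm.trans h2'
    rw [add_right_inj] at h3 h4
    simp only [Units.val_neg, Zsqrtd.re_neg, Zsqrtd.im_neg] at h3 h4
    rcases adv_one_dir_cases t s with ⟨e1, e2⟩ | ⟨e1, e2⟩ <;> rw [e1] at h3 <;> rw [e2] at h4 <;>
    rcases unit_val_cases s.dir with e | e | e | e <;> rw [e] at h3 h4 <;>
    push_cast at h3 h4 <;> linarith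
  -- At distinct vertices, the common point is a corner shared by the two tiles, hence the midpoint
  -- of a segment of each curve; a coherent segment is determined by its midpoint.
  · have hp := mem_vertexTile_of_mem_strand h
    have hp' : p ∈ tile (2 * s.terminal + 2 * (s'.terminal - s.terminal)) := by
      rw [← mul_add, add_sub_cancel]; exact mem_vertexTile_of_mem_strand h'
    obtain ⟨η, hη, hre, him⟩ := eq_add_unit_of_mem_tile hp hp' (sub_ne_zero.2 (Ne.symm hz))
    have k1 : ((2 * s.terminal).re : ℝ) = 2 * s.terminal.re := by simp
    have k2 : ((2 * s.terminal).im : ℝ) = 2 * s.terminal.im := by simp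
    rw [k1] at hre
    rw [k2] at him
    have k3 : (s'.terminal.re : ℝ) = s.terminal.re + (η : GaussianInt).re := by
      rw [eq_add_of_sub_eq' hη]; simp
    have k4 : (s'.terminal.im : ℝ) = s.terminal.im + (η : GaussianInt).im := by
      rw [eq_add_of_sub_eq' hη]; simp
    have m := eq_mid_of_mem_strand h hre him
    have m' := eq_mid_of_mem_strand (η := -η) h' (by rw [hre, k3]; simp; ring)
      (by rw [him, k4]; simp; ring)
    rcases m with rfl | rfl <;> rcases m' with m' | m'
    · rw [eq_of_mid_eq hs hs' m']
    · rw [eq_of_mid_eq hs ha' m']; exact c2.symm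
    · rw [← eq_of_mid_eq ha hs' m']; exact c1
    · exact c1.trans (by rw [eq_of_mid_eq ha ha' m']; exact c2.symm)

end Paperfolding

/-! ### Two-colouring of the tiles and separation -/

namespace Paperfolding

/-- Two unions `A` and `B` of curves with turns `t`, such that near each edge outside of them the
curves on the left side belong to `A` and those on the right side to `B`. -/
structure IsLabelling (t : GaussianInt → ℤˣ) (κ : ℤ) (A B : Seg → Prop) : Prop where
  adv_left : ∀ s, A (adv 1 t s) ↔ A s
  adv_right : ∀ s, B (adv 1 t s) ↔ B s
  not_both : ∀ s, A s → ¬ B s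
  goRight_left : ∀ s, Coh κ s → (A s ↔ A (goRight 1 s))
  goLeft_right : ∀ s, Coh κ s → (B s ↔ B (goLeft 1 s))

variable {t : GaussianInt → ℤˣ} {κ : ℤ} {s s' : Seg} {A B : Seg → Prop}

theorem adv_one_eq_goLeft (h : t s.terminal = 1) : adv 1 t s = goLeft 1 s := by
  ext1
  · rfl
  · rw [adv_one_dir, h, iUnit_zpow_one]; rfl

theorem adv_one_eq_goRight (h : t s.terminal ≠ 1) : adv 1 t s = goRight 1 s := by
  ext1
  · rfl
  · rw [adv_one_dir, (Int.units_eq_one_or _).resolve_left h, iUnit_zpow_neg_one]; rfl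

theorem coh_goLeft_one : Coh κ (goLeft 1 s) ↔ Coh κ s := by
  rw [← adv_one_eq_goLeft (t := 1) rfl, coh_adv_one]

theorem coh_goRight_one : Coh κ (goRight 1 s) ↔ Coh κ s := by
  rw [← adv_one_eq_goRight (t := -1) (by simp), coh_adv_one]

/-- Whether the tile around `z` lies on the left side of the curves outside `A` and `B`. -/
def vertexColor (t : GaussianInt → ℤˣ) (κ : ℤ) (A B : Seg → Prop) (z : GaussianInt) : Prop :=
  ∃ s, Coh κ s ∧ s.terminal = z ∧ if t z = 1 then A s else ¬ B s

/-- Whether the tile in the square with lower left vertex `w` lies on the left side of the curves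
outside `A` and `B`. -/
def faceColor (κ : ℤ) (A B : Seg → Prop) (w : GaussianInt) : Prop :=
  (Coh κ ⟨w, 1⟩ ∧ ¬ B ⟨w, 1⟩) ∨ (¬ Coh κ ⟨w, 1⟩ ∧ A ⟨w + 1, -1⟩)

theorem iff_of_sameCycle {C : Seg → Prop} (hC : ∀ s, C (adv 1 t s) ↔ C s)
    (h : (adv 1 t).SameCycle s s') : C s ↔ C s' := by
  obtain ⟨n, rfl⟩ := h
  induction n using Int.induction_on with
  | zero => rfl
  | succ n ih => rw [ih, add_comm, zpow_one_add, Equiv.Perm.mul_apply, hC]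
  | pred n ih => rw [ih, ← hC ((adv 1 t ^ (-(n : ℤ) - 1)) s), ← Equiv.Perm.mul_apply,
      ← zpow_one_add, add_sub_cancel]

/-- The union of the tiles with a given color. -/
def coloredTiles (C D : GaussianInt → Prop) : Set ℂ :=
  ⋃ g ∈ {g | (∃ z, C z ∧ g = 2 * z) ∨ ∃ w, D w ∧ g = 2 * w + ⟨1, 1⟩}, tile g

theorem mem_coloredTiles {C D : GaussianInt → Prop} {p : ℂ} : p ∈ coloredTiles C D ↔
    (∃ z, C z ∧ p ∈ vertexTile z) ∨ ∃ w, D w ∧ p ∈ faceTile w := by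
  simp only [coloredTiles, Set.mem_iUnion, exists_prop, Set.mem_ofPred_eq]
  constructor
  · rintro ⟨g, ⟨z, hz, rfl⟩ | ⟨w, hw, rfl⟩, hp⟩
    · exact Or.inl ⟨z, hz, hp⟩
    · exact Or.inr ⟨w, hw, hp⟩
  · rintro (⟨z, hz, hp⟩ | ⟨w, hw, hp⟩)
    · exact ⟨_, Or.inl ⟨z, hz, rfl⟩, hp⟩
    · exact ⟨_, Or.inr ⟨w, hw, rfl⟩, hp⟩

namespace IsLabelling

/-- The colour does not depend on which arriving segment is used: the corner opposite to the turn
leads from one arriving segment to the successor of the other, and the labelling is invariant along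
both. -/
theorem vertexColor_iff (hl : IsLabelling t κ A B) (hs : Coh κ s) :
    vertexColor t κ A B s.terminal ↔ if t s.terminal = 1 then A s else ¬ B s := by
  refine ⟨?_, fun h => ⟨s, hs, rfl, h⟩⟩
  rintro ⟨s', hs', hz, h⟩
  rcases eq_or_neg_of_coh hs' hs hz with rfl | hd
  · exact h
  have e1 : adv 1 t s = ⟨(adv 1 t s').start, -(adv 1 t s').dir⟩ := by
    ext1
    · rw [adv_one_start, adv_one_start, hz]
    · exact adv_one_dir_neg hz hd
  split_ifs at h ⊢ with ht
  · rw [← hl.adv_left, e1]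
    rw [hl.goRight_left s' hs'] at h
    rw [← hz] at ht
    rw [adv_one_eq_goLeft ht]
    simpa [goLeft, goRight] using h
  · rw [← hl.adv_right, e1]
    rw [hl.goLeft_right s' hs'] at h
    rw [← hz] at ht
    rw [adv_one_eq_goRight ht]
    simpa [goLeft, goRight] using h

theorem iterate_goLeft (hl : IsLabelling t κ A B) (n : ℕ) :
    (Coh κ ((goLeft 1)^[n] s) ↔ Coh κ s) ∧ (Coh κ s → (B ((goLeft 1)^[n] s) ↔ B s)) := by
  induction n with
  | zero => exact ⟨Iff.rfl, fun _ => Iff.rfl⟩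
  | succ n ih =>
    rw [Function.iterate_succ_apply']
    refine ⟨coh_goLeft_one.trans ih.1, fun hs => ?_⟩
    rw [← hl.goLeft_right _ (ih.1.2 hs), ih.2 hs]

theorem iterate_goRight (hl : IsLabelling t κ A B) (n : ℕ) :
    (Coh κ ((goRight 1)^[n] s) ↔ Coh κ s) ∧ (Coh κ s → (A ((goRight 1)^[n] s) ↔ A s)) := by
  induction n with
  | zero => exact ⟨Iff.rfl, fun _ => Iff.rfl⟩
  | succ n ih =>
    rw [Function.iterate_succ_apply']
    refine ⟨coh_goRight_one.trans ih.1, fun hs => ?_⟩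
    rw [← hl.goRight_left _ (ih.1.2 hs), ih.2 hs]

/-- The face lies to the left of `s`. Successive left corners run around it counterclockwise and
preserve membership in `B`. -/
theorem faceColor_left (hl : IsLabelling t κ A B) {w : GaussianInt} (hs : Coh κ s)
    (hw : 2 * w + ⟨1, 1⟩ = 2 * s.start + opi * s.dir) : faceColor κ A B w ↔ ¬ B s := by
  obtain ⟨n, hn⟩ : ∃ n, s = (goLeft 1)^[n] ⟨w, 1⟩ := by
    rw [add_comm _ (opi * _), add_two_mul, add_comm, add_two_mul, Zsqrtd.ext_iff] at hw
    obtain ⟨x, d⟩ := s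
    rcases unit_cases d with rfl | rfl | rfl | rfl
    · refine ⟨0, Seg.ext (Zsqrtd.ext ?_ ?_) rfl⟩ <;> simp [opi] at hw ⊢ <;> omega
    · refine ⟨2, Seg.ext (Zsqrtd.ext ?_ ?_) (by simp only [Function.iterate_succ, Function.comp, Function.iterate_zero, id, goLeft]; decide)⟩ <;>
        simp [opi, goLeft, iUnit_val] at hw ⊢ <;> omega
    · refine ⟨1, Seg.ext (Zsqrtd.ext ?_ ?_) (by simp only [Function.iterate_succ, Function.comp, Function.iterate_zero, id, goLeft]; decide)⟩ <;>
        simp [opi, goLeft, iUnit_val] at hw ⊢ <;> omega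
    · refine ⟨3, Seg.ext (Zsqrtd.ext ?_ ?_) (by simp only [Function.iterate_succ, Function.comp, Function.iterate_zero, id, goLeft]; decide)⟩ <;>
        simp [opi, goLeft, iUnit_val] at hw ⊢ <;> omega
  obtain ⟨h1, h2⟩ := hl.iterate_goLeft (s := ⟨w, 1⟩) n
  rw [← hn] at h1 h2
  have hc := h1.1 hs
  rw [h2 hc, faceColor]
  tauto

/-- The face lies to the right of `s`. Successive right corners run around it clockwise and preserve
membership in `A`. -/
theorem faceColor_right (hl : IsLabelling t κ A B) {w : GaussianInt} (hs : Coh κ s)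
    (hw : 2 * w + ⟨1, 1⟩ = 2 * s.start + opi * ((-iUnit * s.dir : GaussianIntˣ) : GaussianInt)) :
    faceColor κ A B w ↔ A s := by
  obtain ⟨n, hn⟩ : ∃ n, s = (goRight 1)^[n] ⟨w + 1, -1⟩ := by
    rw [add_comm _ (opi * _), add_two_mul, add_comm, add_two_mul, Zsqrtd.ext_iff] at hw
    obtain ⟨x, d⟩ := s
    rcases unit_cases d with rfl | rfl | rfl | rfl
    · refine ⟨2, Seg.ext (Zsqrtd.ext ?_ ?_) (by simp only [Function.iterate_succ, Function.comp, Function.iterate_zero, id, goRight]; decide)⟩ <;>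
        simp [opi, goRight, iUnit_val] at hw ⊢ <;> omega
    · refine ⟨0, Seg.ext (Zsqrtd.ext ?_ ?_) rfl⟩ <;>
        simp [opi, iUnit_val] at hw ⊢ <;> omega
    · refine ⟨1, Seg.ext (Zsqrtd.ext ?_ ?_) (by simp only [Function.iterate_succ, Function.comp, Function.iterate_zero, id, goRight]; decide)⟩ <;>
        simp [opi, goRight, iUnit_val] at hw ⊢ <;> omega
    · refine ⟨3, Seg.ext (Zsqrtd.ext ?_ ?_) (by simp only [Function.iterate_succ, Function.comp, Function.iterate_zero, id, goRight]; decide)⟩ <;>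
        simp [opi, goRight, iUnit_val] at hw ⊢ <;> omega
  obtain ⟨h1, h2⟩ := hl.iterate_goRight (s := ⟨w + 1, -1⟩) n
  rw [← hn] at h1 h2
  have hc := h1.1 hs
  have hc' : ¬ Coh κ ⟨w, 1⟩ := by
    rw [← coh_reverse]
    exact hc
  rw [h2 hc, faceColor]
  tauto

/-- Adjacent tiles have the same color, except if their common side belongs to a curve which is
neither in `A` nor in `B`. -/
theorem color_iff (hl : IsLabelling t κ A B) {z w : GaussianInt} {p : ℂ}
    (hz : p ∈ vertexTile z) (hw : p ∈ faceTile w)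
    (hp : ∀ s, Coh κ s → ¬ A s → ¬ B s → p ∉ segment ℝ s.mid (adv 1 t s).mid) :
    vertexColor t κ A B z ↔ faceColor κ A B w := by
  obtain ⟨η, hη⟩ := exists_unit_of_mem_tile hz hw
  -- The face lies between the directions `η` and `i * η` from `z`. Either the edge towards `i * η`
  -- is coherently oriented towards `z`, with the face on its left, or the edge towards `η` is, with
  -- the face on its right.
  by_cases hc : Coh κ ⟨z + iUnit * η, -iUnit * η⟩
  · set s : Seg := ⟨z + iUnit * η, -iUnit * η⟩ with hs
    have hst : s.terminal = z := by simp [Seg.terminal, hs]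
    have h1 := hl.vertexColor_iff hc
    have h2 := hl.faceColor_left (w := w) hc (by
      rw [hη, hs, Units.val_mul, opi_eq, Units.val_neg]
      linear_combination (η : GaussianInt) * iUnit_sq)
    rw [hst] at h1
    rw [h1, h2]
    split_ifs with ht
    · have := hl.not_both s
      -- The colours are `A s` and `¬ B s`. As `A` and `B` are disjoint, they differ only if `s` is
      -- in neither, and then the common side is the rounded corner following `s`.
      by_contra hne
      refine hp s hc (by tauto) (by tauto) ?_
      rw [← hst] at ht
      rw [adv_one_eq_goLeft ht, segment_symm]
      apply mem_segment_of_mem_tile hz hw hη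
      all_goals first
        | rw [two_mul_mid_re]
        | rw [two_mul_mid_im]
      all_goals simp [goLeft, hs, iUnit_val]
      all_goals ring
    · exact Iff.rfl
  · set s : Seg := ⟨z + η, -η⟩ with hs
    have hc : Coh κ s := by
      revert hc
      unfold Coh
      rcases unit_val_cases η with e | e | e | e <;> simp [hs, e, iUnit_val] <;> omega
    have hst : s.terminal = z := by simp [Seg.terminal, hs]
    have h1 := hl.vertexColor_iff hc
    have h2 := hl.faceColor_right (w := w) hc (by
      rw [hη, hs, Units.val_mul, opi_eq, Units.val_neg, Units.val_neg]
      linear_combination (-η : GaussianInt) * iUnit_sq)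
    rw [hst] at h1
    rw [h1, h2]
    split_ifs with ht
    · exact Iff.rfl
    · have := hl.not_both s
      by_contra hne
      refine hp s hc (by tauto) (by tauto) ?_
      rw [← hst] at ht
      rw [adv_one_eq_goRight ht]
      apply mem_segment_of_mem_tile hz hw hη
      all_goals first
        | rw [two_mul_mid_re]
        | rw [two_mul_mid_im]
      all_goals simp [goRight, hs, iUnit_val]
      all_goals ring

/-- A connected set which meets tiles of both colors meets a curve which is neither in `A`
nor in `B`. -/
theorem exists_mem_strand (hl : IsLabelling t κ A B) {K : Set ℂ} (hK : IsPreconnected K) {p p' : ℂ}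
    (hp : p ∈ K) (hp' : p' ∈ K)
    (h : p ∈ coloredTiles (vertexColor t κ A B) (faceColor κ A B))
    (h' : p' ∈ coloredTiles (fun z => ¬ vertexColor t κ A B z) (fun w => ¬ faceColor κ A B w)) :
    ∃ s, Coh κ s ∧ ¬ A s ∧ ¬ B s ∧ (K ∩ segment ℝ s.mid (adv 1 t s).mid).Nonempty := by
  by_contra! hcon
  -- The two coloured unions are closed and cover the plane, so a connected set meeting both
  -- contains a point `x` in tiles of both colours.
  obtain ⟨x, hx, h1, h2⟩ := isPreconnected_closed_iff.1 hK _ _ (isClosed_biUnion_tile _)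
    (isClosed_biUnion_tile _) (fun x _ => by
      rcases exists_mem_tile x with ⟨z, hz⟩ | ⟨w, hw⟩
      · by_cases hc : vertexColor t κ A B z
        · exact Or.inl (mem_coloredTiles.2 (Or.inl ⟨z, hc, hz⟩))
        · exact Or.inr (mem_coloredTiles.2 (Or.inl ⟨z, hc, hz⟩))
      · by_cases hc : faceColor κ A B w
        · exact Or.inl (mem_coloredTiles.2 (Or.inr ⟨w, hc, hw⟩))
        · exact Or.inr (mem_coloredTiles.2 (Or.inr ⟨w, hc, hw⟩))) ⟨p, hp, h⟩ ⟨p', hp', h'⟩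
  have key : ∀ {z w}, x ∈ vertexTile z → x ∈ faceTile w →
      (vertexColor t κ A B z ↔ faceColor κ A B w) := fun hz hw =>
    hl.color_iff hz hw fun s hs hA hB hxs =>
      (hcon s hs hA hB).subset (⟨hx, hxs⟩ : x ∈ K ∩ segment ℝ s.mid (adv 1 t s).mid)
  -- If both tiles are of the same kind, a tile of the other kind through `x` links them, so `key`
  -- still applies.
  rcases mem_coloredTiles.1 h1 with ⟨z, hz, h1⟩ | ⟨w, hw, h1⟩ <;>
    rcases mem_coloredTiles.1 h2 with ⟨z', hz', h2⟩ | ⟨w', hw', h2⟩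
  · obtain ⟨w, hw⟩ := exists_mem_faceTile h1 h2 fun e => hz' (e ▸ hz)
    exact hz' ((key h2 hw).2 ((key h1 hw).1 hz))
  · exact hw' ((key h1 h2).1 hz)
  · exact hz' ((key h2 h1).2 hw)
  · obtain ⟨z, hz⟩ := exists_mem_vertexTile h1 h2 fun e => hw' (e ▸ hw)
    exact hw' ((key hz h2).1 ((key hz h1).2 hw))

theorem separates (hl : IsLabelling t κ A B) {α β μ : CompleteCurve} {𝒟 : Set CompleteCurve}
    (h𝒟 : Obeys 𝒟 t κ) (hα : α ∈ 𝒟) (hβ : β ∈ 𝒟) (hμ : μ ∈ 𝒟)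
    (hαA : ∀ k, A (α.seg k)) (hβB : ∀ k, B (β.seg k)) (hμA : ∀ k, ¬ A (μ.seg k))
    (hμB : ∀ k, ¬ B (μ.seg k)) (hμ' : ∀ s, Coh κ s → ¬ A s → ¬ B s → ∃ k, μ.seg k = s) :
    Separates μ α β := by
  have htr : ∀ γ ∈ 𝒟, ∀ p ∈ γ.trace, ∃ k, p ∈ segment ℝ (γ.seg k).mid (adv 1 t (γ.seg k)).mid := by
    intro γ hγ p hp
    obtain ⟨k, hk⟩ := Set.mem_iUnion.1 hp
    rw [(h𝒟 γ hγ k).2] at hk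
    exact ⟨k, hk⟩
  refine ⟨Set.disjoint_left.2 fun p h1 h2 => ?_, Set.disjoint_left.2 fun p h1 h2 => ?_,
    fun p hp p' hp' h => ?_⟩
  · obtain ⟨k, hk⟩ := htr α hα p h1
    obtain ⟨j, hj⟩ := htr μ hμ p h2
    exact hμA j ((iff_of_sameCycle hl.adv_left (sameCycle_of_mem_strand (h𝒟 α hα k).1
      (h𝒟 μ hμ j).1 hk hj)).1 (hαA k))
  · obtain ⟨k, hk⟩ := htr β hβ p h1
    obtain ⟨j, hj⟩ := htr μ hμ p h2
    exact hμB j ((iff_of_sameCycle hl.adv_right (sameCycle_of_mem_strand (h𝒟 β hβ k).1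
      (h𝒟 μ hμ j).1 hk hj)).1 (hβB k))
  · obtain ⟨k, hk⟩ := htr α hα p hp
    obtain ⟨j, hj⟩ := htr β hβ p' hp'
    -- `connectedComponentIn` is empty when the base point is outside the set, which `h` excludes.
    have hpK : p ∈ connectedComponentIn (μ.trace)ᶜ p := by
      by_contra hn
      rw [connectedComponentIn_eq_empty fun hm => hn (mem_connectedComponentIn hm)] at h
      exact h
    have hc : vertexColor t κ A B (α.seg k).terminal := by
      rw [hl.vertexColor_iff (h𝒟 α hα k).1]
      split_ifs
      · exact hαA k
      · exact hl.not_both _ (hαA k)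
    have hc' : ¬ vertexColor t κ A B (β.seg j).terminal := by
      rw [hl.vertexColor_iff (h𝒟 β hβ j).1]
      split_ifs
      · exact fun h => hl.not_both _ h (hβB j)
      · exact not_not.2 (hβB j)
    obtain ⟨s, hs, hA, hB, x, hx, hxs⟩ := hl.exists_mem_strand isPreconnected_connectedComponentIn
      hpK h (mem_coloredTiles.2 (Or.inl ⟨_, hc, mem_vertexTile_of_mem_strand hk⟩))
      (mem_coloredTiles.2 (Or.inl ⟨_, hc', mem_vertexTile_of_mem_strand hj⟩))
    obtain ⟨i, rfl⟩ := hμ' s hs hA hB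
    rw [← (h𝒟 μ hμ i).2] at hxs
    exact connectedComponentIn_subset _ _ hx (Set.mem_iUnion.2 ⟨i, hxs⟩)

end IsLabelling

end Paperfolding

/-! ### Transfer to the embedded coverings -/

namespace Paperfolding

variable {ρ : GaussianIntˣ} {k q b : GaussianInt} {s : Seg}

theorem embed_goLeft (s : Seg) : embed ρ q b (goLeft 1 s) = goLeft q (embed ρ q b s) := by
  ext1
  · simp only [embed, goLeft, Units.val_mul]; ring
  · simp only [embed, goLeft]; rw [mul_left_comm]

theorem embed_goRight (s : Seg) : embed ρ q b (goRight 1 s) = goRight q (embed ρ q b s) := by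
  ext1
  · simp only [embed, goRight, Units.val_mul]; ring
  · simp only [embed, goRight]; rw [mul_left_comm]

theorem onCurve_embed_adv {L : List Seg} (s : Seg) :
    OnCurve q L (embed ρ q b (adv 1 (fun z => turnAt (ρ * q * z + b)) s)) ↔
      OnCurve q L (embed ρ q b s) := by
  rw [embed_adv, ← onCurve_congr (sameCycle_succ _ _)]

theorem onCurve_curveOf {L : List Seg} {r : Seg} (hr : embed ρ q b r ∈ L) (n : ℤ) :
    OnCurve q L (embed ρ q b ((curveOf (fun z => turnAt (ρ * q * z + b)) r).seg n)) :=
  ⟨_, hr, n, (embed_adv_zpow r n).symm⟩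

theorem start_eq_of_embed_start_eq {t : GaussianInt → ℤˣ} (hq : q ≠ 0) {r r' : Seg} {n : ℤ}
    (h : (embed ρ q b ((curveOf t r).seg n)).start = (embed ρ q b r').start) :
    ((curveOf t r).seg n).start = r'.start := by
  have hρ : (ρ : GaussianInt) * q ≠ 0 := mul_ne_zero ρ.ne_zero hq
  exact mul_left_cancel₀ hρ (add_right_cancel h)

/-- A vertex common to two curves can be found in the set of all segments. -/
theorem exists_common_vertex (hq : q ≠ 0) {r r' : Seg} (n : ℕ)
    (h : ((succ q)^[n] (embed ρ q b r)).start = (embed ρ q b r').start) :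
    ∃ z, (curveOf (fun z => turnAt (ρ * q * z + b)) r).IsVertex z ∧
      (curveOf (fun z => turnAt (ρ * q * z + b)) r').IsVertex z := by
  refine ⟨r'.start, ⟨n, Or.inl (start_eq_of_embed_start_eq (ρ := ρ) (b := b) hq ?_)⟩, ⟨0, Or.inl rfl⟩⟩
  rw [← h, curveOf, embed_adv_zpow, zpow_natCast, Equiv.Perm.iterate_eq_pow]

/-- As `q` does not divide `b`, no embedded vertex is divisible by `q`, so the corner property holds
at all of them. -/
theorem isLabelling_embed (hb : ¬ qSep ∣ b) :
    IsLabelling (fun z => turnAt (ρ * qSep * z + b)) (b.re + b.im + (ρ : GaussianInt).im)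
      (fun s => OnCurve qSep periodicA (embed ρ qSep b s))
      (fun s => OnCurve qSep periodicB (embed ρ qSep b s)) := by
  have hd : ∀ s, ¬ qSep ∣ (embed ρ qSep b s).start + qSep * (embed ρ qSep b s).dir := fun s h =>
    hb (by
    simpa using dvd_sub ((dvd_add_left (dvd_mul_right _ _)).1 h)
      (dvd_embed_start (ρ := ρ) (q := qSep) (b := b) s))
  exact {
    adv_left := onCurve_embed_adv
    adv_right := onCurve_embed_adv
    not_both := fun s => not_onCurve_both (by decide +kernel) (by decide +kernel) (by decide +kernel)
    goRight_left := fun s hs => by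
      rw [embed_goRight]; exact (corner_periodic ((coh_embed qSep_eq s).2 hs) (hd s)).2
    goLeft_right := fun s hs => by
      rw [embed_goLeft]; exact (corner_periodic ((coh_embed qSep_eq s).2 hs) (hd s)).1 }

end Paperfolding


theorem mainTheorem6 (a : ℕ → ℤˣ) (ha : IsInftyFoldingSeq a) (ha2 : ∀ n : ℕ, a (2 ^ n) = 1)
    (H : HalfCurve) (hH : H.AssociatedTo a)
    (𝒞 : Set CompleteCurve) (hcov : IsCovering 𝒞) (hcoh : IsCoherent 𝒞)
    (hgen : IsGeneratedBy 𝒞 H) :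
    (∃ 𝒟 : Set CompleteCurve, IsCovering 𝒟 ∧ IsCoherent 𝒟 ∧ LocallyIsomorphic 𝒞 𝒟 ∧
      𝒟.ncard = 3 ∧
      ∀ α ∈ 𝒟, ∀ β ∈ 𝒟, α ≠ β → ∃ z : GaussianInt, α.IsVertex z ∧ β.IsVertex z) ∧
    (∃ 𝒟 : Set CompleteCurve, IsCovering 𝒟 ∧ IsCoherent 𝒟 ∧ LocallyIsomorphic 𝒞 𝒟 ∧
      𝒟.ncard = 3 ∧
      ∃ α ∈ 𝒟, ∃ β ∈ 𝒟, ∃ μ ∈ 𝒟, α ≠ β ∧ α ≠ μ ∧ β ≠ μ ∧ Separates μ α β) := by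
  obtain ⟨ρ, p, t, κ, hobey, ht, hκ⟩ := hgen.exists_obeys ha ha2 hH hcov hcoh
  constructor
  · have hq := qTriple_eq
    -- The residue class of `-1` modulo `1 - 2 * i` contains the starts of exactly three of the
    -- twelve periodic segments.
    have hb : ¬ qTriple ∣ ⟨-1, 0⟩ := by rw [qTriple_dvd_iff]; decide
    have hT := isTransversal_embed (ρ := ρ) hq parentStable_periodicTriple
      succ_notMem_periodicTriple onCurve_periodicTriple hb
    obtain ⟨r₁, r₂, r₃, h12, h13, h23, e₁, e₂, e₃, hR⟩ := ncard_embed (ρ := ρ) (b := ⟨-1, 0⟩)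
      (odd_ne_zero' hq) (L := periodicTriple) (f₁ := ⟨⟨-1, 0⟩, iUnit⟩) (f₂ := ⟨⟨1, 1⟩, 1⟩)
      (f₃ := ⟨⟨0, -2⟩, -1⟩) (by decide) (by decide) (by decide)
      (by rw [qTriple_dvd_iff]; decide) (by rw [qTriple_dvd_iff]; decide)
      (by rw [qTriple_dvd_iff]; decide) (by
        intro f hf
        rw [qTriple_dvd_iff] at hf
        constructor
        · intro hm; revert hf; revert f; decide +kernel
        · rintro (rfl | rfl | rfl) <;> decide)
    rw [hR] at hT
    refine ⟨_, hT.isCovering, hT.obeys.isCoherent, locallyIsomorphic_of_obeys hcov hT.isCovering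
      hobey ht hκ hq hb hT.obeys fun s => (coh_embed hq s).symm, ?_, ?_⟩
    · rw [Set.ncard_image_of_injective _ (curveOf_injective _),
        Set.ncard_eq_three.2 ⟨_, _, _, h12, h13, h23, rfl⟩]
    · have v12 := exists_common_vertex (odd_ne_zero' hq) (r := r₁) (r' := r₂) 1
        (by rw [e₁, e₂]; decide +kernel)
      have v31 := exists_common_vertex (odd_ne_zero' hq) (r := r₃) (r' := r₁) 1
        (by rw [e₃, e₁]; decide +kernel)
      have v23 := exists_common_vertex (odd_ne_zero' hq) (r := r₂) (r' := r₃) 2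
        (by rw [e₂, e₃]; decide +kernel)
      rintro _ ⟨r, hr, rfl⟩ _ ⟨r', hr', rfl⟩ hne
      rcases hr with rfl | rfl | rfl <;> rcases hr' with rfl | rfl | rfl
      · exact absurd rfl hne
      · exact v12
      · exact v31.imp fun _ => And.symm
      · exact v12.imp fun _ => And.symm
      · exact absurd rfl hne
      · exact v23
      · exact v31
      · exact v23.imp fun _ => And.symm
      · exact absurd rfl hne
  · have hq := qSep_eq
    -- The residue class of `i` modulo `3` contains the start of exactly one segment from each of
    -- `periodicA`, `periodicM` and `periodicB`.
    have hb : ¬ qSep ∣ ⟨0, 1⟩ := by rw [qSep_dvd_iff]; decide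
    have hT := isTransversal_embed (ρ := ρ) hq parentStable_periodicSep
      succ_notMem_periodicSep onCurve_periodicSep hb
    obtain ⟨r₁, r₂, r₃, h12, h13, h23, e₁, e₂, e₃, hR⟩ := ncard_embed (ρ := ρ) (b := ⟨0, 1⟩)
      (odd_ne_zero' hq) (L := periodicSep) (f₁ := ⟨⟨3, 1⟩, -1⟩) (f₂ := ⟨⟨0, 1⟩, -iUnit⟩)
      (f₃ := ⟨⟨0, -2⟩, -1⟩) (by decide) (by decide) (by decide)
      (by rw [qSep_dvd_iff]; decide) (by rw [qSep_dvd_iff]; decide)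
      (by rw [qSep_dvd_iff]; decide) (by
        intro f hf
        rw [qSep_dvd_iff] at hf
        constructor
        · intro hm; revert hf; revert f; decide +kernel
        · rintro (rfl | rfl | rfl) <;> decide)
    rw [hR] at hT
    have hl := isLabelling_embed (ρ := ρ) hb
    have hA := onCurve_curveOf (L := periodicA) (r := r₁) (ρ := ρ) (b := ⟨0, 1⟩) (q := qSep)
      (by rw [e₁]; decide)
    have hM := onCurve_curveOf (L := periodicM) (r := r₂) (ρ := ρ) (b := ⟨0, 1⟩) (q := qSep)
      (by rw [e₂]; decide)
    have hB := onCurve_curveOf (L := periodicB) (r := r₃) (ρ := ρ) (b := ⟨0, 1⟩) (q := qSep)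
      (by rw [e₃]; decide)
    refine ⟨_, hT.isCovering, hT.obeys.isCoherent, locallyIsomorphic_of_obeys hcov hT.isCovering
      hobey ht hκ hq hb hT.obeys fun s => (coh_embed hq s).symm, ?_,
      _, ⟨r₁, by simp, rfl⟩, _, ⟨r₃, by simp, rfl⟩, _, ⟨r₂, by simp, rfl⟩,
      (curveOf_injective _).ne h13, (curveOf_injective _).ne h12,
      (curveOf_injective _).ne h23.symm, hl.separates hT.obeys ⟨r₁, by simp, rfl⟩
        ⟨r₃, by simp, rfl⟩ ⟨r₂, by simp, rfl⟩ hA hB (fun n h => ?_) (fun n h => ?_)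
        fun s hs h h' => ?_⟩
    · rw [Set.ncard_image_of_injective _ (curveOf_injective _),
        Set.ncard_eq_three.2 ⟨_, _, _, h12, h13, h23, rfl⟩]
    · exact not_onCurve_both (by decide +kernel) (by decide +kernel) (by decide +kernel) h (hM n)
    · exact not_onCurve_both (by decide +kernel) (by decide +kernel) (by decide +kernel) h (hM n)
    · obtain ⟨r, hr, n, hn⟩ := hT.exists_sameCycle s hs
      rcases hr with rfl | rfl | rfl
      · subst hn; exact absurd (hA n) h
      · exact ⟨n, hn⟩
      · subst hn; exact absurd (hB n) h'
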